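/- Let $n\ge 2$ and let $\lambda=\sum_{i=0}^{n-1}a_i\Lambda_i$ ($a_i\in\mathbb Z_{\ge 0}$) be a dominant integral weight of $\widehat{\mathfrak{sl}_n}(\mathbb C)$ of level $k=\sum_i a_i$; put $a_n=a_0$ and $A_\lambda=\{i\in[1,n]: a_i=0\}$. **Notation.** $\alpha_0,\dots,\alpha_{n-1}$ are the simple roots and $\delta=\sum_i\alpha_i$. For $i=j(n-1)+r$ with $j\ge 0$, $1\le r\le n-1$, let $\gamma_i=-(\alpha_1+\dots+\alpha_r)-j\delta$. $R$ is the ring of formal series $\sum c_\mu\exp\mu$ over the root lattice with complex coefficients and with support in a finite union of lower sets $\nu-\sum_i\mathbb Z_{\ge0}\alpha_i$. For a finitely supported integer sequence $x=(x_i)_{i\ge1}$ let $\exp x=\prod t_i^{x_i}$ and $\exp^*x=\exp(\sum_i x_i\gamma_i)\in R$. Let $\psi_i(x)=x_1+\dots+x_i$ and $b_i=a_1+\dots+a_i$ for $i<n$, and $\psi_i(x)=x_{i-n+1}+\dots+x_i$ and $b_i=k$ for $i\ge n$. Let $\Pi=\Pi_\lambda$ be the set of finitely supported real sequences with $x_i\ge0$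 and $\psi_i(x)\le b_i$ for all $i\ge 1$. Let $\Gamma_i$, $\Delta_i$ be its subsets $\{\psi_i(x)=b_i\}$, $\{x_i=0\}$. The vertices of $\Pi$ are its points for which the set of $\Gamma_i,\Delta_i$ containing the point is maximal. For a vertex $u$ let $C_u=\{u+c(y-u): y\in\Pi,\,c\ge 0\}$ and $C_u^m=\{x\in C_u: x_i=0\text{ for }i>m\}$. Let $\sigma(C_u^m)$ be the rational function $p/\theta$, where $\theta,p$ are Laurent polynomials with $\theta\cdot\sum_{x\in C_u^m\text{ integral}}\exp x=p$, let $\tau_u^m\in R$ be the image of $\sigma(C_u^m)$ under $\exp\mapsto\exp^*$ (with $\theta$ chosen so that it becomes invertible in $R$), and let $\tau_u=\lim_{m\to\infty}\tau_u^m$ coefficientwise. For $A\subset[1,n]$ let $\Omega_A$ be the set of all sets $\omega$ of symbols $\Gamma_i,\Delta_i$ ($i\ge1$) such that: (1) for every $i$ at least one of $\Gamma_i,\Delta_i$ is in $\omega$; (2) $\omega$ contains finitely many $\Gamma_i$; (3) for $i\notin A$, $\Gamma_i,\Delta_i\in\omega$ iff $i>n$ and $\Gamma_{i-1},\Delta_{i-n}\in\omega$;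 (4) for $i\in A$, $\Gamma_i,\Delta_i\in\omega$ iff $\Gamma_{i-1}\in\omega$ or $i=1$. **Theorem.** (I) Let $\lambda\neq0$. * Sending a vertex to the set of facets containing it is a bijection from the vertices of $\Pi_\lambda$ onto $\Omega_{A_\lambda}$. All vertices are integral, all the $\tau_u$ exist, and $\tau_\omega:=\exp^*(-u)\tau_u$, where $u$ is the vertex corresponding to $\omega\in\Omega_{A_\lambda}$, depends only on $A_\lambda$ and $\omega$. (In particular, taking a weight without zero coordinates, $\tau_{\omega'}$ is defined for $\omega'\in\Omega_\varnothing$.) * For each $\omega'\in\Omega_\varnothing$ there is a unique $\omega=\varphi_{\varnothing,A_\lambda}(\omega')\in\Omega_{A_\lambda}$ with $\omega'\subset\omega$. The map $\varphi_{\varnothing,A_\lambda}:\Omega_\varnothing\to\Omega_{A_\lambda}$ is surjective with finite fibres, and for each $\omega\in\Omega_{A_\lambda}$ $$\tau_\omega=\sum_{\omega'\in\varphi_{\varnothing,A_\lambda}^{-1}(\omega)}\tau_{\omega'} .$$ (II) Let $\lambda$ be any dominant integral weight ($\lambda=0$ included). Let $S$ be the span of the monomials $\prod_i X_i^{x_i}$,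 $x\in\Pi_\lambda$ integral, in the polynomial ring $\mathbb C[X_1,X_2,\dots]$, where $X_i$ has weight $\gamma_i$ (so $X_{j(n-1)+r}=f_r(-j)$). The weight spaces of $S$ are finite dimensional, and $$\operatorname{char}S=\exp(-\lambda)\sum_{y\in\Theta}\exp(w_y\lambda)F_y ,$$ where for every weight only finitely many terms contribute to its coefficient. Here $\Theta$ is the set of binary sequences $y=(y_i)_{i\ge1}$ with finite support such that $y_i=0$ implies $y_{i+n-1}=0$; $w_y=\cdots s_{\gamma_2}^{y_2}s_{\gamma_1}^{y_1}$ is a product of reflections in the affine Weyl group; and $F_y=\prod_{i\ge1}(1-\exp^*\varepsilon_i)^{-1}$ in $R$, where $\varepsilon_i=\varepsilon_i(y)$ is the integer sequence with $(\varepsilon_i)_j=0$ for $j<i$, $(\varepsilon_i)_i=(-1)^{y_i}$ and, for every $j\ne i$, $\psi_j(\varepsilon_i)=0$ if $y_j=1$ and $(\varepsilon_i)_j=0$ if $y_j=0$. -/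

import Mathlib

open Filter

noncomputable section

namespace FSChar

/-!
Conventions. Sequences `(x_i)_{i ≥ 1}` with finite support are finitely supported functions on `ℕ`
vanishing at `0`. A dominant integral weight of level `∑ i, a i` of the affine Lie algebra of type
`A_{n-1}` is given by its labels `a : Fin n → ℕ`, `λ = ∑ a_i Λ_i`. A vector `m : Fin n → ℤ` stands
for the element `-∑ m_i α_i` of the affine root lattice, `α_0, …, α_{n-1}` being the simple roots.
-/

/-- The label `a_i`, for any index `i`, read modulo `n` (so that `a_n = a_0`). -/
def label {n : ℕ} [NeZero n] (a : Fin n → ℕ) (i : ℕ) : ℕ := a (Fin.ofNat n i)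

/-- The set `A_λ ⊆ {1, …, n}` of the indices `i` with `a_i = 0` (where `a_n = a_0`). -/
def zeroSet {n : ℕ} [NeZero n] (a : Fin n → ℕ) : Set ℕ :=
  {i | 1 ≤ i ∧ i ≤ n ∧ label a i = 0}

/-- `γ_i` for `i = j (n - 1) + r`, `1 ≤ r ≤ n - 1`: the root `-(α_1 + ⋯ + α_r) - j δ`, which is the
weight of `f_r(-j)`. -/
def gamma (n : ℕ) (i : ℕ) : Fin n → ℤ := fun l =>
  (((i - 1) / (n - 1) : ℕ) : ℤ) +
    if 1 ≤ (l : ℕ) ∧ (l : ℕ) ≤ (i - 1) % (n - 1) + 1 then 1 else 0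

/-! ### The ring of characters -/

/-- The ring `R` of characters: formal sums `∑ c_m exp(-∑ m_i α_i)` whose support lies in a finite
union of lower sets `μ - ∑ ℕ α_i` (for the product order on `ℤ^n`, these are exactly the partially
well-ordered supports). -/
abbrev CharRing (n : ℕ) : Type := HahnSeries (Fin n → ℤ) ℂ

/-- The formal exponent of an element of the root lattice. -/
def expo {n : ℕ} (m : Fin n → ℤ) : CharRing n := HahnSeries.single m 1

/-- Coefficientwise stabilization of a sequence of characters. -/
def Stabilizes {n : ℕ} (s : ℕ → CharRing n) (t : CharRing n) : Prop :=
  ∀ m : Fin n → ℤ, ∀ᶠ i in atTop, (s i).coeff m = t.coeff m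

/-- The exponent vector of `exp^* x`. -/
def starWeight (n : ℕ) (x : ℕ →₀ ℤ) : Fin n → ℤ := x.sum fun i c => c • gamma n i

/-- `exp^* x`. -/
def expStar (n : ℕ) (x : ℕ →₀ ℤ) : CharRing n := expo (starWeight n x)

/-! ### The polytope -/

/-- `ψ_i(x) = x_1 + ⋯ + x_i` for `i < n`, and `x_{i-n+1} + ⋯ + x_i` for `i ≥ n`. -/
def psi {M : Type*} [AddCommMonoid M] (n : ℕ) (x : ℕ → M) (i : ℕ) : M :=
  if i < n then ∑ l ∈ Finset.Icc 1 i, x l else ∑ l ∈ Finset.Icc (i - n + 1) i, x l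

/-- `b_i = a_1 + ⋯ + a_i` for `i < n`, and the level `a_0 + ⋯ + a_{n-1}` for `i ≥ n`. -/
def bound {n : ℕ} [NeZero n] (a : Fin n → ℕ) (i : ℕ) : ℕ :=
  if i < n then ∑ l ∈ Finset.Icc 1 i, label a l else ∑ l, a l

/-- The polytope `Π`. -/
def polytope {n : ℕ} [NeZero n] (a : Fin n → ℕ) : Set (ℕ →₀ ℝ) :=
  {x | x 0 = 0 ∧ (∀ i, 0 ≤ x i) ∧ ∀ i, 1 ≤ i → psi n x i ≤ bound a i}

/-- An integral sequence as a real one. -/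
def toReal (x : ℕ →₀ ℤ) : ℕ →₀ ℝ := x.mapRange (fun c : ℤ => (c : ℝ)) Int.cast_zero

/-- The symbols `Γ_i` (for `ψ_i(x) = b_i`) and `Δ_i` (for `x_i = 0`). -/
inductive Facet : Type
  | Gam (i : ℕ) : Facet
  | Del (i : ℕ) : Facet

/-- The set of facets containing the point `u`. -/
def facetSet {n : ℕ} [NeZero n] (a : Fin n → ℕ) (u : ℕ →₀ ℝ) : Set Facet :=
  {f | ∃ i, 1 ≤ i ∧
    ((f = Facet.Gam i ∧ psi n u i = bound a i) ∨ (f = Facet.Del i ∧ u i = 0))}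

/-- The vertices of `Π`: its points for which the set of facets containing it is maximal. -/
def vertices {n : ℕ} [NeZero n] (a : Fin n → ℕ) : Set (ℕ →₀ ℝ) :=
  {u | u ∈ polytope a ∧ ∀ v ∈ polytope a, facetSet a u ⊆ facetSet a v →
    facetSet a v = facetSet a u}

/-- The vertex cone `C_u`, the cone with vertex `u` spanned by `Π`. -/
def vertexCone {n : ℕ} [NeZero n] (a : Fin n → ℕ) (u : ℕ →₀ ℝ) : Set (ℕ →₀ ℝ) :=
  {x | ∃ y ∈ polytope a, ∃ c : ℝ, 0 ≤ c ∧ x = u + c • (y - u)}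

/-- The section `C_u^m` of `C_u` by `{x | x_i = 0 for i > m}`. -/
def coneSection {n : ℕ} [NeZero n] (a : Fin n → ℕ) (u : ℕ →₀ ℝ) (m : ℕ) : Set (ℕ →₀ ℝ) :=
  {x | x ∈ vertexCone a u ∧ ∀ i, m < i → x i = 0}

/-! ### Generating functions and the contributions of vertices -/

/-- Laurent polynomials in the variables `t_i`. -/
abbrev LaurentPoly : Type := AddMonoidAlgebra ℂ (ℕ →₀ ℤ)

/-- The generating function `S(C)`, as a formal Laurent series given by its coefficients. -/
def genFun (C : Set (ℕ →₀ ℝ)) : (ℕ →₀ ℤ) → ℂ :=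
  Set.indicator {x | toReal x ∈ C} fun _ => 1

/-- The product of a Laurent polynomial and a formal Laurent series. -/
def laurentMul (θ : LaurentPoly) (S : (ℕ →₀ ℤ) → ℂ) : (ℕ →₀ ℤ) → ℂ := fun x =>
  θ.coeff.sum fun y c => c * S (x - y)

/-- The image in `R` of a Laurent polynomial under the substitution `exp ↦ exp^*`. -/
def substStar (n : ℕ) (θ : LaurentPoly) : CharRing n :=
  θ.coeff.sum fun y c => HahnSeries.single (starWeight n y) c

/-- `f` is the image in `R` of `σ^*(C)`: the rational function `σ(C)` can be written as `p / θ`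
with Laurent polynomials such that `θ S(C) = p` and `θ` becomes invertible in `R` after the
substitution, and `f` is the resulting quotient. -/
def IsSigmaStar (n : ℕ) (C : Set (ℕ →₀ ℝ)) (f : CharRing n) : Prop :=
  ∃ θ p : LaurentPoly, (∀ x, laurentMul θ (genFun C) x = p.coeff x) ∧
    IsUnit (substStar n θ) ∧ substStar n θ * f = substStar n p

/-- `t` is the character `τ_u`, the limit of the images `τ_u^m` of `σ^*(C_u^m)` in `R`. -/
def IsTauVertex {n : ℕ} [NeZero n] (a : Fin n → ℕ) (u : ℕ →₀ ℝ) (t : CharRing n) : Prop :=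
  ∃ s : ℕ → CharRing n, (∀ᶠ m in atTop, IsSigmaStar n (coneSection a u m) (s m)) ∧
    Stabilizes s t

/-- The set `Ω_A` of vertex data. -/
def Omega (n : ℕ) (A : Set ℕ) : Set (Set Facet) :=
  {ω | (Facet.Gam 0 ∉ ω ∧ Facet.Del 0 ∉ ω) ∧
    (∀ i, 1 ≤ i → Facet.Gam i ∈ ω ∨ Facet.Del i ∈ ω) ∧
    {i | Facet.Gam i ∈ ω}.Finite ∧
    (∀ i, 1 ≤ i → i ∉ A →
      ((Facet.Gam i ∈ ω ∧ Facet.Del i ∈ ω) ↔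
        (n < i ∧ Facet.Gam (i - 1) ∈ ω ∧ Facet.Del (i - n) ∈ ω))) ∧
    (∀ i ∈ A, ((Facet.Gam i ∈ ω ∧ Facet.Del i ∈ ω) ↔ (Facet.Gam (i - 1) ∈ ω ∨ i = 1)))}

/-- `t = exp^*(-u) τ_u` for a vertex `u` with facet set `ω` of the polytope of some weight whose set
of zero coordinates is `A`. -/
def IsTau (n : ℕ) [NeZero n] (A : Set ℕ) (ω : Set Facet) (t : CharRing n) : Prop :=
  ∃ a : Fin n → ℕ, zeroSet a = A ∧ ∃ u : ℕ →₀ ℤ, toReal u ∈ vertices a ∧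
    facetSet a (toReal u) = ω ∧
    ∃ s, IsTauVertex a (toReal u) s ∧ t = expStar n (-u) * s

open Classical in
/-- The character `τ_ω` for `ω ∈ Ω_A`. -/
def tau (n : ℕ) [NeZero n] (A : Set ℕ) (ω : Set Facet) : CharRing n :=
  if h : ∃ t, IsTau n A ω t then h.choose else 0

/-! ### The character of `S` -/

/-- The span `S ⊆ U(P)` of the monomials with exponents in `Π`. The commutative algebra `U(P)` is the
polynomial ring in the variables `X_i`, where `X_{j (n - 1) + r} = f_r(-j)` (the variable `X_0` is
not used). -/
def monomialSpan {n : ℕ} [NeZero n] (a : Fin n → ℕ) : Submodule ℂ (MvPolynomial ℕ ℂ) :=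
  Submodule.span ℂ {p | ∃ x : ℕ →₀ ℕ,
    x.mapRange (fun c : ℕ => (c : ℝ)) Nat.cast_zero ∈ polytope a ∧ p = MvPolynomial.monomial x 1}

/-- The weight subspace of `S` of weight `-∑ m_i α_i`. -/
def weightSpace {n : ℕ} [NeZero n] (a : Fin n → ℕ) (m : Fin n → ℤ) :
    Submodule ℂ (MvPolynomial ℕ ℂ) :=
  monomialSpan a ⊓ MvPolynomial.weightedHomogeneousSubmodule ℂ (gamma n) m

/-! ### The terms of the character formula -/

/-- The set `Θ` of good binary sequences, given by their sets of indices `i` with `y_i = 1`. -/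
def goodSeqs (n : ℕ) : Set (Finset ℕ) :=
  {y | 0 ∉ y ∧ ∀ i, 1 ≤ i → i ∉ y → i + n - 1 ∉ y}

/-- The invariant bilinear form on the affine root lattice, with the affine Cartan matrix of type
`A_{n-1}` as Gram matrix. -/
def form {n : ℕ} [NeZero n] (m m' : Fin n → ℤ) : ℤ :=
  ∑ i, (2 * m i * m' i - m i * m' (i + 1) - m (i + 1) * m' i)

/-- The reflection `s_β` in the real root `β` on `λ + Q`: if `m` stands for the weight
`μ = λ - ∑ m_i α_i`, then the result stands for `s_β μ = μ - ⟨μ, β^∨⟩ β`. -/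
def reflect {n : ℕ} [NeZero n] (a : Fin n → ℕ) (β m : Fin n → ℤ) : Fin n → ℤ :=
  m - (form m β - ∑ i, (a i : ℤ) * β i) • β

/-- `w_y λ - λ`, where `w_y = ⋯ s_{γ_2}^{y_2} s_{γ_1}^{y_1}`. -/
def weylShift {n : ℕ} [NeZero n] (a : Fin n → ℕ) (y : Finset ℕ) : Fin n → ℤ :=
  (y.sort (· ≤ ·)).foldl (fun m i => reflect a (gamma n i) m) 0

/-- `ε` is the direction vector `ε_i` of the edge, at the simple vertex `u_y`, whose first nonzero
coordinate has index `i`: along the edge one leaves the facet with index `i` and stays in `Γ_j` for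
`y_j = 1` and in `Δ_j` for `y_j = 0`, for all `j ≠ i`. -/
def IsEdgeDir (n : ℕ) (y : Finset ℕ) (i : ℕ) (ε : ℕ →₀ ℤ) : Prop :=
  (∀ j, j < i → ε j = 0) ∧ ε i = (if i ∈ y then -1 else 1) ∧
    ∀ j, 1 ≤ j → j ≠ i → (j ∈ y → psi n ε j = 0) ∧ (j ∉ y → ε j = 0)

/-- `F` is the character `F_y = ∏_{i ≥ 1} (1 - exp^* ε_i)⁻¹`. -/
def IsF (n : ℕ) (y : Finset ℕ) (F : CharRing n) : Prop :=
  ∃ ε : ℕ → ℕ →₀ ℤ, (∀ i, 1 ≤ i → IsEdgeDir n y i (ε i)) ∧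
    (∀ i, 1 ≤ i → IsUnit (1 - expStar n (ε i))) ∧
    Stabilizes (fun N => ∏ i ∈ Finset.Icc 1 N, Ring.inverse (1 - expStar n (ε i))) F

end FSChar

end

open Filter

noncomputable section

namespace FSChar

/-! The facets `Γ_i`, `Δ_i` involve only the coordinates up to `i`. Once `x_1, …, x_{i-1}` are
fixed, `x_i` runs through an interval from `0` to the solution of `ψ_i = b_i`, and the interval is
nonempty because `b` is nondecreasing. So `Π` is an iterated interval, and its truncations can be
summed one geometric progression at a time. A progression equals (start − end shifted by one step) /
(1 − step). Its start lies on `Δ_i`, its end on `Γ_i`, and its step is an edge direction. Iterating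
gives a sum over all selections `y` of one facet per index, with terms `exp^*(vert y) F_y`
(`region_step`, `isSig_region`). The same computation applies to the cone at any vertex, simple or
not. Every edge weight is nonzero and comparable to `0` (`eta_definite`), so all denominators are
units of `R`. Since the `γ_i` are unbounded, the products `F_y` converge coefficientwise.

For (I), the cone at a vertex with facet set `ω` gives `τ_ω = ∑ F_y` over the selections `y` of
facets of `ω` (`isSigmaStar_coneSection`, `tau_eq`), and only `ω` enters. Each selection belongs to
exactly one member of `Ω_{A_λ}` and to exactly one member of `Ω_∅` (`subset_of_selects`,
`facetSet_vert_mem`). This yields the bijection with the vertices, and the fibre formula is a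
regrouping of the sum (`exists_degeneration`).

For (II), counting lattice points of a given weight expresses `char S` as a sum over all finite `y`
(`card_points`). The terms with `y ∉ Θ` cancel in pairs (`sum_bad_eq_zero`). From the last bad index
of `y` one reaches an index `W` such that the vertex of `y` lies on both facets with index `W`.
Moving `W` into or out of `y` keeps the vertex, permutes the edge weights, keeps their sum over `y`
(`FlipAt.etaExchange`), and reverses the sign `(-1)^|y|`. For `y ∈ Θ` the coordinates of the vertex
obey the recursion of the successive reflections (`vert_eq_pairing`), so its weight is `w_y λ - λ`.
-/

/-! ### Formal Laurent series and the substitution `exp ↦ exp^*` -/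

/-- The character `exp^*` of the group of exponents. -/
def expStarHom (n : ℕ) : Multiplicative (ℕ →₀ ℤ) →* CharRing n where
  toFun x := expStar n x.toAdd
  map_one' := by
    simp only [expStar, expo, starWeight, toAdd_one, Finsupp.sum_zero_index]
    rfl
  map_mul' x y := by
    have : starWeight n (x.toAdd + y.toAdd) = starWeight n x.toAdd + starWeight n y.toAdd :=
      Finsupp.sum_add_index' (by simp) (by intros; simp [add_smul])
    simp [expStar, expo, this]

lemma starWeight_add (n : ℕ) (x y : ℕ →₀ ℤ) :
    starWeight n (x + y) = starWeight n x + starWeight n y :=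
  Finsupp.sum_add_index' (by simp) (by intros; simp [add_smul])

lemma starWeight_zero (n : ℕ) : starWeight n 0 = 0 := by simp [starWeight]

lemma starWeight_neg (n : ℕ) (x : ℕ →₀ ℤ) : starWeight n (-x) = -starWeight n x := by
  have := starWeight_add n x (-x)
  rw [add_neg_cancel, starWeight_zero] at this
  exact (neg_eq_of_add_eq_zero_right this.symm).symm

lemma expo_zero {n : ℕ} : expo (0 : Fin n → ℤ) = 1 := rfl

lemma expo_add {n : ℕ} (x y : Fin n → ℤ) : expo (x + y) = expo x * expo y := by
  simp [expo]

lemma expStar_add (n : ℕ) (x y : ℕ →₀ ℤ) : expStar n (x + y) = expStar n x * expStar n y := by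
  simp [expStar, starWeight_add, expo_add]

lemma isUnit_expo {n : ℕ} (x : Fin n → ℤ) : IsUnit (expo x) :=
  IsUnit.of_mul_eq_one (expo (-x)) (by rw [← expo_add, add_neg_cancel, expo_zero])

/-- The substitution `exp ↦ exp^*` as a homomorphism of algebras. -/
def substHom (n : ℕ) : LaurentPoly →ₐ[ℂ] CharRing n :=
  AddMonoidAlgebra.lift ℂ (CharRing n) (ℕ →₀ ℤ) (expStarHom n)

lemma substStar_eq (n : ℕ) (θ : LaurentPoly) : substStar n θ = substHom n θ := by
  rw [substHom, AddMonoidAlgebra.lift_apply, substStar]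
  refine Finsupp.sum_congr fun x _ => ?_
  change _ = _ • HahnSeries.single _ (1 : ℂ)
  ext m
  simp only [HahnSeries.coeff_smul, HahnSeries.coeff_single, smul_eq_mul, toAdd_ofAdd]
  split_ifs <;> simp

lemma substStar_single (n : ℕ) (x : ℕ →₀ ℤ) :
    substStar n (AddMonoidAlgebra.single x 1) = expStar n x := by
  rw [substStar_eq, substHom, AddMonoidAlgebra.lift_single, one_smul]
  rfl

lemma laurentMul_single (x : ℕ →₀ ℤ) (c : ℂ) (S : (ℕ →₀ ℤ) → ℂ) (z : ℕ →₀ ℤ) :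
    laurentMul (AddMonoidAlgebra.single x c) S z = c * S (z - x) := by
  simp [laurentMul]

lemma laurentMul_add (θ θ' : LaurentPoly) (S : (ℕ →₀ ℤ) → ℂ) :
    laurentMul (θ + θ') S = laurentMul θ S + laurentMul θ' S := by
  funext z
  classical
  simp only [laurentMul, Pi.add_apply, AddMonoidAlgebra.coeff_add]
  exact Finsupp.sum_add_index' (by simp) (by intros; ring)

lemma laurentMul_zero_left (S : (ℕ →₀ ℤ) → ℂ) : laurentMul 0 S = 0 := by
  funext z
  simp [laurentMul]

lemma laurentMul_add_right (θ : LaurentPoly) (S S' : (ℕ →₀ ℤ) → ℂ) :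
    laurentMul θ (S + S') = laurentMul θ S + laurentMul θ S' := by
  funext z
  simp [laurentMul, Finsupp.sum, mul_add, Finset.sum_add_distrib]

lemma laurentMul_mul (θ θ' : LaurentPoly) (S : (ℕ →₀ ℤ) → ℂ) :
    laurentMul (θ * θ') S = laurentMul θ (laurentMul θ' S) := by
  induction θ using AddMonoidAlgebra.induction_linear with
  | zero => rw [zero_mul, laurentMul_zero_left, laurentMul_zero_left]
  | add f g hf hg => rw [add_mul, laurentMul_add, hf, hg, laurentMul_add]
  | single x c =>
    induction θ' using AddMonoidAlgebra.induction_linear with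
    | zero =>
      rw [mul_zero, laurentMul_zero_left]
      funext z
      simp [laurentMul_single]
    | add f g hf hg =>
      rw [mul_add, laurentMul_add, hf, hg, laurentMul_add, laurentMul_add_right]
    | single x' c' =>
      funext z
      rw [AddMonoidAlgebra.single_mul_single]
      simp only [laurentMul_single]
      rw [sub_sub, mul_assoc]

lemma laurentMul_coeff (θ p : LaurentPoly) : laurentMul θ p.coeff = (θ * p).coeff := by
  induction θ using AddMonoidAlgebra.induction_linear with
  | zero => rw [laurentMul_zero_left]; simp
  | add f g hf hg => rw [laurentMul_add, hf, hg, add_mul]; rfl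
  | single x c =>
    induction p using AddMonoidAlgebra.induction_linear with
    | zero => funext z; simp [laurentMul_single]
    | add f g hf hg =>
      rw [mul_add, AddMonoidAlgebra.coeff_add, AddMonoidAlgebra.coeff_add, Finsupp.coe_add,
        laurentMul_add_right, hf, hg]
      rfl
    | single x' c' =>
      classical
      funext z
      rw [laurentMul_single, AddMonoidAlgebra.single_mul_single]
      simp only [AddMonoidAlgebra.coeff_single, Finsupp.single_apply]
      by_cases h : x + x' = z
      · rw [if_pos h, if_pos (by rw [← h]; abel)]
      · rw [if_neg h, if_neg (fun h' => h (by rw [h']; abel)), mul_zero]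

/-- `f` is the image in `R` of the rational function represented by the formal series `S`. -/
def IsSig (n : ℕ) (S : (ℕ →₀ ℤ) → ℂ) (f : CharRing n) : Prop :=
  ∃ θ p : LaurentPoly, (∀ x, laurentMul θ S x = p.coeff x) ∧
    IsUnit (substStar n θ) ∧ substStar n θ * f = substStar n p

/-! ### Calculus of rational functions represented by formal series -/

section IsSig

variable {n : ℕ} {S S' : (ℕ →₀ ℤ) → ℂ} {f f' : CharRing n}

/-- Cross-multiplication: computing `θ θ' S` in two ways gives `θ p' = θ' p` for Laurent
polynomials, and the images of `θ`, `θ'` can be cancelled because they are units. -/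
lemma IsSig.unique (h : IsSig n S f) (h' : IsSig n S f') : f = f' := by
  obtain ⟨θ, p, h1, h2, h3⟩ := h
  obtain ⟨θ', p', h1', h2', h3'⟩ := h'
  have h1 : laurentMul θ S = p.coeff := funext h1
  have h1' : laurentMul θ' S = p'.coeff := funext h1'
  have key : θ * p' = θ' * p := by
    have : (θ * p').coeff = (θ' * p).coeff := by
      apply DFunLike.coe_injective
      rw [← laurentMul_coeff, ← laurentMul_coeff, ← h1, ← h1', ← laurentMul_mul,
        ← laurentMul_mul, mul_comm]
    exact AddMonoidAlgebra.coeff_injective this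
  have key' := congrArg (substStar n) key
  simp only [substStar_eq, map_mul] at key' h2 h2' h3 h3'
  rw [← h3, ← h3'] at key'
  apply (h2.mul h2').mul_left_cancel
  linear_combination -key'

lemma IsSig.add (h : IsSig n S f) (h' : IsSig n S' f') : IsSig n (S + S') (f + f') := by
  obtain ⟨θ, p, h1, h2, h3⟩ := h
  obtain ⟨θ', p', h1', h2', h3'⟩ := h'
  have h1 : laurentMul θ S = p.coeff := funext h1
  have h1' : laurentMul θ' S' = p'.coeff := funext h1'
  refine ⟨θ * θ', θ' * p + θ * p', fun x => ?_, ?_, ?_⟩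
  · rw [laurentMul_add_right, laurentMul_mul θ θ' S', h1', mul_comm θ θ', laurentMul_mul, h1,
      laurentMul_coeff, laurentMul_coeff]
    rfl
  · simp only [substStar_eq, map_mul] at *
    exact h2.mul h2'
  · simp only [substStar_eq, map_mul, map_add] at *
    linear_combination (substHom n θ') * h3 + (substHom n θ) * h3'

lemma IsSig.laurentMul (q : LaurentPoly) (h : IsSig n S f) :
    IsSig n (laurentMul q S) (substStar n q * f) := by
  obtain ⟨θ, p, h1, h2, h3⟩ := h
  have h1 : FSChar.laurentMul θ S = p.coeff := funext h1
  refine ⟨θ, q * p, fun x => ?_, h2, ?_⟩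
  · rw [← laurentMul_mul, mul_comm, laurentMul_mul, h1, laurentMul_coeff]
  · simp only [substStar_eq, map_mul] at *
    linear_combination (substHom n q) * h3

/-- The factor `q` is absorbed into the denominator. This is how a geometric progression is summed
in `isSig_region`. -/
lemma IsSig.of_laurentMul {q : LaurentPoly} (hq : IsUnit (substStar n q))
    (h : IsSig n (FSChar.laurentMul q S) (substStar n q * f)) : IsSig n S f := by
  obtain ⟨θ, p, h1, h2, h3⟩ := h
  refine ⟨θ * q, p, fun x => ?_, ?_, ?_⟩
  · rw [laurentMul_mul, h1]
  · simp only [substStar_eq, map_mul] at *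
    exact h2.mul hq
  · simp only [substStar_eq, map_mul] at *
    rw [mul_assoc, h3]

lemma isSig_coeff (p : LaurentPoly) : IsSig n p.coeff (substStar n p) := by
  refine ⟨1, p, fun x => ?_, ?_, ?_⟩
  · rw [laurentMul_coeff, one_mul]
  · simp [substStar_eq]
  · simp [substStar_eq]

end IsSig

/-! ### Characters supported above a weight -/

/-- All exponents of `f` are at least `c`. -/
def SuppGE {n : ℕ} (c : Fin n → ℤ) (f : CharRing n) : Prop := ∀ m, f.coeff m ≠ 0 → c ≤ m

section SuppGE

variable {n : ℕ} {c d : Fin n → ℤ} {f g : CharRing n}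

lemma SuppGE.mono (h : SuppGE c f) (hd : d ≤ c) : SuppGE d f := fun m hm => hd.trans (h m hm)

lemma SuppGE.mul (hf : SuppGE c f) (hg : SuppGE d g) : SuppGE (c + d) (f * g) := by
  intro m hm
  obtain ⟨i, hi, j, hj, rfl⟩ := HahnSeries.support_mul_subset ((HahnSeries.mem_support _ _).2 hm)
  exact add_le_add (hf i hi) (hg j hj)

lemma SuppGE.neg (hf : SuppGE c f) : SuppGE c (-f) := by
  intro m hm
  exact hf m fun h => hm (by rw [HahnSeries.coeff_neg, h, neg_zero])

lemma suppGE_expo (c : Fin n → ℤ) : SuppGE c (expo c) := by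
  intro m hm
  rw [expo, HahnSeries.coeff_single] at hm
  split_ifs at hm with h
  · exact h.ge
  · exact absurd rfl hm

lemma suppGE_one : SuppGE 0 (1 : CharRing n) := suppGE_expo 0

lemma SuppGE.prod {ι : Type*} {s : Finset ι} {f : ι → CharRing n}
    (h : ∀ i ∈ s, SuppGE 0 (f i)) : SuppGE 0 (∏ i ∈ s, f i) := by
  classical
  induction s using Finset.induction_on with
  | empty => simpa using suppGE_one
  | insert i s hi ih =>
    rw [Finset.prod_insert hi]
    have := (h i (Finset.mem_insert_self _ _)).mul
      (ih fun j hj => h j (Finset.mem_insert_of_mem hj))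
    rwa [add_zero] at this

lemma SuppGE.coeff_eq_zero (h : SuppGE c f) {m : Fin n → ℤ} (hm : ¬ c ≤ m) : f.coeff m = 0 := by
  by_contra h'
  exact hm (h m h')

lemma coeff_expo_mul (c m : Fin n → ℤ) (f : CharRing n) :
    (expo c * f).coeff m = f.coeff (m - c) := by
  rw [expo, HahnSeries.coeff_single_mul, one_mul]

/-- Dickson's lemma, transported from `ℕ^n`. It provides the support condition for series given by
their coefficients. -/
lemma isPWO_nonneg (n : ℕ) : {m : Fin n → ℤ | 0 ≤ m}.IsPWO := by
  have h : (Set.univ : Set (Fin n → ℕ)).IsPWO := Set.isPWO_of_wellQuasiOrderedLE _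
  have h2 := h.image_of_monotone (f := fun (m : Fin n → ℕ) (i : Fin n) => (m i : ℤ))
    (fun a b hab i => Int.ofNat_le.2 (hab i))
  refine h2.mono fun m hm => ⟨fun i => (m i).toNat, trivial, ?_⟩
  funext i
  exact Int.toNat_of_nonneg (hm i)

/-- The geometric series. -/
lemma exists_geometric {β : Fin n → ℤ} (h0 : 0 ≤ β) (h1 : β ≠ 0) :
    ∃ g : CharRing n, (1 - expo β) * g = 1 ∧ SuppGE 0 g := by
  classical
  have hk : ∀ k : ℕ, 0 ≤ k • β := fun k => nsmul_nonneg h0 k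
  refine ⟨⟨fun m => if ∃ k : ℕ, m = k • β then 1 else 0,
    (isPWO_nonneg n).mono fun m hm => ?_⟩, ?_, fun m hm => ?_⟩
  · simp only [Function.mem_support, ne_eq, ite_eq_right_iff, one_ne_zero, imp_false, not_not] at hm
    obtain ⟨k, rfl⟩ := hm
    exact hk k
  · ext m
    rw [sub_mul, one_mul, HahnSeries.coeff_sub, coeff_expo_mul, HahnSeries.coeff_one]
    dsimp only
    by_cases hm : m = 0
    · rw [if_pos ⟨0, by simp [hm]⟩, if_neg, if_pos hm, sub_zero]
      rintro ⟨k, hk'⟩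
      apply h1
      have : β ≤ 0 := by
        have := hk k
        rw [← hk', hm, zero_sub] at this
        exact neg_nonneg.1 this
      exact le_antisymm this h0
    · rw [if_neg hm]
      by_cases h : ∃ k : ℕ, m = k • β
      · obtain ⟨k, rfl⟩ := h
        rcases k with _ | k
        · simp at hm
        · rw [if_pos ⟨k + 1, rfl⟩, if_pos ⟨k, by rw [succ_nsmul, add_sub_cancel_right]⟩, sub_self]
      · rw [if_neg h, if_neg, sub_zero]
        rintro ⟨k, hk'⟩
        exact h ⟨k + 1, by rw [succ_nsmul, ← hk', sub_add_cancel]⟩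
  · dsimp only at hm
    split_ifs at hm with h
    · obtain ⟨k, rfl⟩ := h
      exact hk k
    · exact absurd rfl hm

/-- `β` is nonzero and comparable to `0`. -/
def Definite (β : Fin n → ℤ) : Prop := β ≠ 0 ∧ (0 ≤ β ∨ β ≤ 0)

lemma Definite.neg {β : Fin n → ℤ} (h : Definite β) : Definite (-β) :=
  ⟨neg_ne_zero.2 h.1, h.2.symm.imp (fun h => neg_nonneg.2 h) (fun h => neg_nonpos.2 h)⟩

/-- `(1 - exp β)⁻¹`. -/
def geom (β : Fin n → ℤ) : CharRing n := Ring.inverse (1 - expo β)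

lemma geom_eq {β : Fin n → ℤ} {g : CharRing n} (h : (1 - expo β) * g = 1) : geom β = g := by
  have hu : IsUnit (1 - expo β) := IsUnit.of_mul_eq_one g h
  apply hu.mul_left_cancel
  rw [h, geom, Ring.mul_inverse_cancel _ hu]

lemma one_sub_expo_neg (β : Fin n → ℤ) : 1 - expo (-β) = -expo (-β) * (1 - expo β) := by
  have : expo (-β) * expo β = 1 := by rw [← expo_add, neg_add_cancel, expo_zero]
  linear_combination -this

lemma Definite.isUnit {β : Fin n → ℤ} (h : Definite β) : IsUnit (1 - expo β) := by
  have key : ∀ β : Fin n → ℤ, 0 ≤ β → β ≠ 0 → IsUnit (1 - expo β) := fun β h0 h1 => by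
    obtain ⟨g, hg, -⟩ := exists_geometric h0 h1
    exact IsUnit.of_mul_eq_one g hg
  rcases h.2 with h0 | h0
  · exact key β h0 h.1
  · have := one_sub_expo_neg (-β)
    rw [neg_neg] at this
    rw [this]
    exact (isUnit_expo _).neg.mul (key _ (neg_nonneg.2 h0) (neg_ne_zero.2 h.1))

lemma Definite.mul_geom {β : Fin n → ℤ} (h : Definite β) : (1 - expo β) * geom β = 1 :=
  Ring.mul_inverse_cancel _ h.isUnit

/-- Reversing an edge costs a sign and a shift; this is the origin of the signs in the cancellation
of bad sequences. -/
lemma Definite.geom_neg {β : Fin n → ℤ} (h : Definite β) :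
    geom (-β) = -expo β * geom β := by
  apply geom_eq
  rw [one_sub_expo_neg]
  have : expo (-β) * expo β = 1 := by rw [← expo_add, neg_add_cancel, expo_zero]
  linear_combination ((1 - expo β) * geom β) * this + h.mul_geom

lemma suppGE_geom_of_nonneg {β : Fin n → ℤ} (h0 : 0 ≤ β) (h1 : β ≠ 0) : SuppGE 0 (geom β) := by
  obtain ⟨g, hg, hg'⟩ := exists_geometric h0 h1
  rwa [geom_eq hg]

lemma suppGE_geom_of_nonpos {β : Fin n → ℤ} (h0 : β ≤ 0) (h1 : β ≠ 0) :
    SuppGE (-β) (geom β) := by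
  have h2 : 0 ≤ -β := neg_nonneg.2 h0
  have h3 : -β ≠ 0 := neg_ne_zero.2 h1
  have := (Definite.geom_neg ⟨h3, Or.inl h2⟩)
  rw [neg_neg] at this
  rw [this]
  have := (suppGE_expo (-β)).neg.mul (suppGE_geom_of_nonneg h2 h3)
  rwa [add_zero] at this

lemma Definite.suppGE {β : Fin n → ℤ} (h : Definite β) : SuppGE 0 (geom β) := by
  rcases h.2 with h0 | h0
  · exact suppGE_geom_of_nonneg h0 h.1
  · exact (suppGE_geom_of_nonpos h0 h.1).mono (neg_nonneg.2 h0)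

lemma suppGE_geom_sub_one {β : Fin n → ℤ} (h0 : 0 ≤ β) (h1 : β ≠ 0) :
    SuppGE β (geom β - 1) := by
  have : geom β - 1 = expo β * geom β := by
    linear_combination (Definite.mul_geom (β := β) ⟨h1, Or.inl h0⟩)
  rw [this]
  have := (suppGE_expo β).mul (suppGE_geom_of_nonneg h0 h1)
  rwa [add_zero] at this

end SuppGE

/-! ### Stabilization -/

section Stabilizes

variable {n : ℕ}

lemma Stabilizes.unique {s : ℕ → CharRing n} {t t' : CharRing n} (h : Stabilizes s t)
    (h' : Stabilizes s t') : t = t' := by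
  ext m
  obtain ⟨i, h1, h2⟩ := ((h m).and (h' m)).exists
  rw [← h1, h2]

lemma Stabilizes.congr {s s' : ℕ → CharRing n} {t : CharRing n} (h : Stabilizes s t)
    (hs : ∀ᶠ i in atTop, s i = s' i) : Stabilizes s' t := by
  intro m
  filter_upwards [h m, hs] with i h1 h2
  rw [← h2, h1]

lemma Stabilizes.expo_mul {s : ℕ → CharRing n} {t : CharRing n} (h : Stabilizes s t)
    (c : Fin n → ℤ) : Stabilizes (fun i => expo c * s i) (expo c * t) := by
  intro m
  filter_upwards [h (m - c)] with i hi
  rw [coeff_expo_mul, coeff_expo_mul, hi]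

lemma Stabilizes.sum {ι : Type*} {I : Finset ι} {s : ι → ℕ → CharRing n} {t : ι → CharRing n}
    (h : ∀ j ∈ I, Stabilizes (s j) (t j)) :
    Stabilizes (fun i => ∑ j ∈ I, s j i) (∑ j ∈ I, t j) := by
  intro m
  have : ∀ᶠ i in atTop, ∀ j ∈ I, (s j i).coeff m = (t j).coeff m :=
    (Filter.eventually_all_finset I).2 fun j hj => h j hj m
  filter_upwards [this] with i hi
  rw [HahnSeries.coeff_sum, HahnSeries.coeff_sum]
  exact Finset.sum_congr rfl hi

/-- The uniform support bound makes the coefficientwise limit a Hahn series. -/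
lemma exists_stabilizes {s : ℕ → CharRing n} (h0 : ∀ i, SuppGE 0 (s i))
    (h : ∀ m, ∃ N, ∀ i, N ≤ i → (s i).coeff m = (s N).coeff m) : ∃ t, Stabilizes s t := by
  choose N hN using h
  refine ⟨⟨fun m => (s (N m)).coeff m, (isPWO_nonneg n).mono fun m hm => h0 _ m hm⟩, fun m => ?_⟩
  filter_upwards [eventually_ge_atTop (N m)] with i hi
  exact hN m i hi

end Stabilizes

/-! ### The roots `γ_i` -/

section gamma

variable {n : ℕ}

lemma gamma_nonneg (n i : ℕ) : 0 ≤ gamma n i := fun l => by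
  simp only [gamma, Pi.zero_apply]
  split_ifs <;> positivity

lemma gamma_add (hn : 2 ≤ n) {i : ℕ} (hi : 1 ≤ i) : gamma n (i + (n - 1)) = gamma n i + 1 := by
  funext l
  have h : i + (n - 1) - 1 = (i - 1) + (n - 1) := by omega
  simp only [gamma, h, Pi.add_apply, Pi.one_apply, Nat.add_mod_right,
    Nat.add_div_right _ (show 0 < n - 1 by omega)]
  push_cast
  ring

/-- Inside a block of `n - 1` indices each step adds one unit vector; passing to the next block adds
the unit vectors at `0` and `1`. -/
lemma gamma_mono (n : ℕ) : Monotone (gamma n) := by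
  intro i j hij l
  have hd : (i - 1) / (n - 1) ≤ (j - 1) / (n - 1) := Nat.div_le_div_right (by omega)
  simp only [gamma]
  rcases hd.lt_or_eq with h | h
  · have : (((i - 1) / (n - 1) : ℕ) : ℤ) + 1 ≤ (((j - 1) / (n - 1) : ℕ) : ℤ) := by exact_mod_cast h
    split_ifs <;> linarith
  · have h1 := Nat.div_add_mod (i - 1) (n - 1)
    have h2 := Nat.div_add_mod (j - 1) (n - 1)
    rw [← h] at h2
    rw [h]
    have h3 : (i - 1) % (n - 1) ≤ (j - 1) % (n - 1) := by omega
    split_ifs <;> first | linarith | omega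

lemma gamma_ne_succ (hn : 2 ≤ n) {i : ℕ} (hi : 1 ≤ i) : gamma n i ≠ gamma n (i + 1) := by
  intro h
  have h0 := congrFun h ⟨0, by omega⟩
  simp only [gamma] at h0
  rw [if_neg (by omega), if_neg (by omega), add_zero, add_zero] at h0
  have h0' : (i - 1) / (n - 1) = (i + 1 - 1) / (n - 1) := Int.natCast_inj.1 h0
  have h1 := Nat.div_add_mod (i - 1) (n - 1)
  have h2 := Nat.div_add_mod (i + 1 - 1) (n - 1)
  rw [← h0'] at h2
  have h3 : (i + 1 - 1) % (n - 1) = (i - 1) % (n - 1) + 1 := by omega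
  have h4 : (i + 1 - 1) % (n - 1) < n - 1 := Nat.mod_lt _ (by omega)
  have h5 := congrFun h ⟨(i + 1 - 1) % (n - 1) + 1, by omega⟩
  simp only [gamma] at h5
  rw [if_neg (by omega), if_pos (by omega), h0'] at h5
  omega

lemma one_le_gamma_one (hn : 2 ≤ n) (i : ℕ) : 1 ≤ gamma n i ⟨1, by omega⟩ := by
  simp only [gamma]
  rw [if_pos (by omega)]
  have : (0 : ℤ) ≤ (((i - 1) / (n - 1) : ℕ) : ℤ) := Int.natCast_nonneg _
  linarith

lemma gamma_ne_zero (hn : 2 ≤ n) (i : ℕ) : gamma n i ≠ 0 := fun h => by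
  have := one_le_gamma_one hn i
  rw [h] at this
  simp at this

/-- `γ_i` is not bounded by `m` when `i` is large. -/
lemma exists_not_gamma_le (hn : 2 ≤ n) (m : Fin n → ℤ) : ∃ M, ∀ i, M < i → ¬ gamma n i ≤ m := by
  -- The coordinate at `0` of `gamma n i` is `(i - 1) / (n - 1)`, which is unbounded in `i`.
  refine ⟨((m ⟨0, by omega⟩).toNat + 1) * (n - 1), fun i hi h => ?_⟩
  have h0 := h ⟨0, by omega⟩
  simp only [gamma] at h0
  rw [if_neg (by omega)] at h0
  have : (m ⟨0, by omega⟩).toNat + 1 ≤ (i - 1) / (n - 1) := by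
    rw [Nat.le_div_iff_mul_le (by omega)]
    omega
  omega

end gamma

/-! ### Partial sums -/

/-- The partial sums `x_1 + ⋯ + x_i`. -/
def psum {M : Type*} [AddCommMonoid M] (x : ℕ → M) (i : ℕ) : M := ∑ l ∈ Finset.Icc 1 i, x l

section psum

variable {M : Type*} [AddCommGroup M] {n : ℕ}

lemma psum_zero {M : Type*} [AddCommMonoid M] (x : ℕ → M) : psum x 0 = 0 := by simp [psum]

lemma psum_succ {M : Type*} [AddCommMonoid M] (x : ℕ → M) (i : ℕ) :
    psum x (i + 1) = psum x i + x (i + 1) := by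
  rw [psum, Finset.sum_Icc_succ_top (by omega), psum]

lemma psum_eq_add {x : ℕ → M} {i : ℕ} (hi : 1 ≤ i) : psum x i = psum x (i - 1) + x i := by
  obtain ⟨i, rfl⟩ := Nat.exists_eq_add_of_le' hi
  exact psum_succ x i

lemma psi_eq (x : ℕ → M) (i : ℕ) : psi n x i = psum x i - psum x (i - n) := by
  rw [psi]
  split_ifs with h
  · rw [Nat.sub_eq_zero_of_le h.le, psum_zero, sub_zero, psum]
  · obtain ⟨k, rfl⟩ := Nat.exists_eq_add_of_le' (not_lt.1 h)
    rw [Nat.add_sub_cancel, psum, psum, eq_sub_iff_add_eq]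
    have : Finset.Icc 1 (k + n) = Finset.Icc 1 k ∪ Finset.Icc (k + 1) (k + n) := by
      ext; simp; omega
    rw [this, Finset.sum_union, add_comm]
    rw [Finset.disjoint_left]
    intro a
    simp
    omega

lemma psum_add (x x' : ℕ → M) (i : ℕ) : psum (x + x') i = psum x i + psum x' i := by
  simp [psum, Finset.sum_add_distrib]

lemma psum_neg (x : ℕ → M) (i : ℕ) : psum (-x) i = -psum x i := by
  simp [psum]

lemma psum_sub (x x' : ℕ → M) (i : ℕ) : psum (x - x') i = psum x i - psum x' i := by
  simp [psum]

lemma ext_psum {x x' : ℕ →₀ M} (h0 : x 0 = x' 0) (h : ∀ i, psum x i = psum x' i) : x = x' := by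
  ext i
  rcases Nat.eq_zero_or_pos i with rfl | hi
  · exact h0
  · have h1 := psum_eq_add (x := x) hi
    have h2 := psum_eq_add (x := x') hi
    rw [h, h, h2] at h1
    exact (add_left_cancel h1).symm

lemma psum_eq_of_support {x : ℕ → M} {m : ℕ} (h : ∀ j, m < j → x j = 0) {i : ℕ} (hi : m ≤ i) :
    psum x i = psum x m := by
  induction i, hi using Nat.le_induction with
  | base => rfl
  | succ i hi ih => rw [psum_succ, ih, h _ (by omega), add_zero]

end psum

lemma starWeight_eq_sum (n : ℕ) {x : ℕ →₀ ℤ} {N : ℕ} (h0 : x 0 = 0) (hN : ∀ j, N < j → x j = 0) :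
    starWeight n x = ∑ j ∈ Finset.Icc 1 N, x j • gamma n j := by
  apply Finsupp.sum_of_support_subset _ _ _ (by simp)
  intro j hj
  rw [Finsupp.mem_support_iff] at hj
  rw [Finset.mem_Icc]
  constructor
  · by_contra h
    exact hj (by rw [show j = 0 by omega, h0])
  · by_contra h
    exact hj (hN j (by omega))

lemma starWeight_nonneg (n : ℕ) {x : ℕ →₀ ℤ} (h : ∀ i, 0 ≤ x i) : 0 ≤ starWeight n x :=
  Finset.sum_nonneg fun i _ => smul_nonneg (h i) (gamma_nonneg n i)

lemma gamma_le_starWeight (n : ℕ) {x : ℕ →₀ ℤ} (h : ∀ i, 0 ≤ x i) {i : ℕ} (hi : x i ≠ 0) :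
    gamma n i ≤ starWeight n x := by
  have h1 : gamma n i ≤ x i • gamma n i := by
    have : (1 : ℤ) ≤ x i := by have := h i; omega
    calc gamma n i = (1 : ℤ) • gamma n i := (one_smul _ _).symm
      _ ≤ x i • gamma n i := smul_le_smul_of_nonneg_right this (gamma_nonneg n i)
  refine h1.trans ?_
  exact Finset.single_le_sum (f := fun i => x i • gamma n i)
    (fun j _ => smul_nonneg (h j) (gamma_nonneg n j)) (Finsupp.mem_support_iff.2 hi)

/-! ### Solutions of the facet equations -/

/-- The partial sums of the solution of the system `ψ_j(x) = c_j` for `j ∈ y`, `x_j = c_j` for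
`j ∉ y`. -/
def sol (n : ℕ) (y : Finset ℕ) (c : ℕ → ℤ) : ℕ → ℤ
  | 0 => 0
  -- In terms of partial sums, the equation with index `j + 1` refers back to `j + 1 - n` for `Γ`
  -- and to `j` for `Δ`. Truncated subtraction covers the indices below `n`, where `ψ` starts at
  -- `1`.
  | j + 1 => c (j + 1) + sol n y c (if j + 1 ∈ y then j - (n - 1) else j)
decreasing_by split_ifs <;> omega

section sol

variable {n : ℕ} {y y' : Finset ℕ} {c c' : ℕ → ℤ}

lemma sol_zero : sol n y c 0 = 0 := by rw [sol]

lemma sol_mem (hn : 2 ≤ n) {j : ℕ} (hj : 1 ≤ j) (h : j ∈ y) :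
    sol n y c j = c j + sol n y c (j - n) := by
  obtain ⟨j, rfl⟩ := Nat.exists_eq_add_of_le' hj
  rw [sol, if_pos h, show j - (n - 1) = j + 1 - n by omega]

lemma sol_notMem {j : ℕ} (hj : 1 ≤ j) (h : j ∉ y) :
    sol n y c j = c j + sol n y c (j - 1) := by
  obtain ⟨j, rfl⟩ := Nat.exists_eq_add_of_le' hj
  rw [sol, if_neg h, Nat.add_sub_cancel]

/-- A function satisfying the recursion agrees with `sol`. -/
lemma eq_sol (hn : 2 ≤ n) {S : ℕ → ℤ} (h0 : S 0 = 0)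
    (h1 : ∀ j, 1 ≤ j → j ∈ y → S j = c j + S (j - n))
    (h2 : ∀ j, 1 ≤ j → j ∉ y → S j = c j + S (j - 1)) (j : ℕ) : S j = sol n y c j := by
  induction j using Nat.strong_induction_on with
  | _ j ih =>
    rcases Nat.eq_zero_or_pos j with rfl | hj
    · rw [h0, sol_zero]
    · by_cases h : j ∈ y
      · rw [h1 j hj h, sol_mem hn hj h, ih _ (by omega)]
      · rw [h2 j hj h, sol_notMem hj h, ih _ (by omega)]

/-- The solution of the system `ψ_j(x) = c_j` for `j ∈ y`, `x_j = c_j` for `j ∉ y`. -/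
def solSeq (n : ℕ) (y : Finset ℕ) (c : ℕ →₀ ℤ) : ℕ →₀ ℤ :=
  Finsupp.onFinset (y ∪ c.support) (fun j => sol n y c j - sol n y c (j - 1)) fun j hj => by
    by_contra h
    rw [Finset.notMem_union, Finsupp.notMem_support_iff] at h
    rcases Nat.eq_zero_or_pos j with rfl | hj'
    · simp at hj
    · rw [sol_notMem hj' h.1, h.2] at hj
      simp at hj

lemma solSeq_apply (c : ℕ →₀ ℤ) (j : ℕ) :
    solSeq n y c j = sol n y c j - sol n y c (j - 1) := rfl

lemma solSeq_zero (c : ℕ →₀ ℤ) : solSeq n y c 0 = 0 := by simp [solSeq_apply]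

lemma psum_solSeq (c : ℕ →₀ ℤ) (j : ℕ) : psum (solSeq n y c) j = sol n y c j := by
  induction j with
  | zero => rw [psum_zero, sol_zero]
  | succ j ih => rw [psum_succ, ih, solSeq_apply]; simp

lemma eq_solSeq (hn : 2 ≤ n) {x c : ℕ →₀ ℤ} (h0 : x 0 = 0)
    (h1 : ∀ j, 1 ≤ j → j ∈ y → psum x j = c j + psum x (j - n))
    (h2 : ∀ j, 1 ≤ j → j ∉ y → psum x j = c j + psum x (j - 1)) : x = solSeq n y c := by
  apply ext_psum
  · rw [h0, solSeq_zero]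
  · intro j
    rw [psum_solSeq]
    exact eq_sol hn (psum_zero _) h1 h2 j

lemma solSeq_eq_zero_of_notMem {c : ℕ →₀ ℤ} {j : ℕ} (h : j ∉ y) (hc : c j = 0) :
    solSeq n y c j = 0 := by
  by_contra h'
  have := Finsupp.support_onFinset_subset (Finsupp.mem_support_iff.2 h')
  simp [h, hc] at this

/-! ### Edge directions and their weights -/

/-- The direction of the edge at the vertex given by `y` which leaves the facet with index `i`,
normalized so that its coordinate with index `i` is `1`. -/
def edge (n : ℕ) (y : Finset ℕ) (i : ℕ) : ℕ →₀ ℤ := solSeq n y (Finsupp.single i 1)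

lemma edge_sol_of_lt (hn : 2 ≤ n) {i j : ℕ} (hj : j < i) : sol n y (Finsupp.single i 1) j = 0 := by
  induction j using Nat.strong_induction_on with
  | _ j ih =>
    rcases Nat.eq_zero_or_pos j with rfl | hj'
    · rw [sol_zero]
    · by_cases h : j ∈ y
      · rw [sol_mem hn hj' h, ih _ (by omega) (by omega), Finsupp.single_eq_of_ne (by omega),
          add_zero]
      · rw [sol_notMem hj' h, ih _ (by omega) (by omega), Finsupp.single_eq_of_ne (by omega),
          add_zero]

lemma edge_sol_self (hn : 2 ≤ n) {i : ℕ} (hi : 1 ≤ i) : sol n y (Finsupp.single i 1) i = 1 := by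
  by_cases h : i ∈ y
  · rw [sol_mem hn hi h, edge_sol_of_lt hn (by omega), Finsupp.single_eq_same, add_zero]
  · rw [sol_notMem hi h, edge_sol_of_lt hn (by omega), Finsupp.single_eq_same, add_zero]

lemma edge_sol_mem (hn : 2 ≤ n) {i j : ℕ} (hj : i < j) (h : j ∈ y) :
    sol n y (Finsupp.single i 1) j = sol n y (Finsupp.single i 1) (j - n) := by
  rw [sol_mem hn (by omega) h, Finsupp.single_eq_of_ne (by omega), zero_add]

lemma edge_sol_notMem {i j : ℕ} (hj : i < j) (h : j ∉ y) :
    sol n y (Finsupp.single i 1) j = sol n y (Finsupp.single i 1) (j - 1) := by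
  rw [sol_notMem (by omega) h, Finsupp.single_eq_of_ne (by omega), zero_add]

lemma edge_of_lt (hn : 2 ≤ n) {i j : ℕ} (hj : j < i) : edge n y i j = 0 := by
  rw [edge, solSeq_apply, edge_sol_of_lt hn hj, edge_sol_of_lt hn (by omega), sub_zero]

lemma edge_self (hn : 2 ≤ n) {i : ℕ} (hi : 1 ≤ i) : edge n y i i = 1 := by
  rw [edge, solSeq_apply, edge_sol_self hn hi, edge_sol_of_lt hn (by omega), sub_zero]

lemma edge_notMem {i j : ℕ} (hj : i < j) (h : j ∉ y) : edge n y i j = 0 := by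
  rw [edge, solSeq_apply, edge_sol_notMem hj h, sub_self]

lemma psum_edge (i j : ℕ) : psum (edge n y i) j = sol n y (Finsupp.single i 1) j :=
  psum_solSeq _ _

/-- A characterization of the sequence `edge n y i`. -/
lemma eq_edge (hn : 2 ≤ n) {i : ℕ} (hi : 1 ≤ i) {x : ℕ →₀ ℤ} (h0 : ∀ j < i, x j = 0)
    (h1 : x i = 1) (h2 : ∀ j, i < j → j ∈ y → psum x j = psum x (j - n))
    (h3 : ∀ j, i < j → j ∉ y → x j = 0) : x = edge n y i := by
  have hlt : ∀ j, j < i → psum x j = 0 := fun j hj => by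
    rw [psum]
    exact Finset.sum_eq_zero fun l hl => h0 l (by simp at hl; omega)
  have hs : psum x i = 1 := by rw [psum_eq_add hi, hlt _ (by omega), h1, zero_add]
  refine eq_solSeq hn (h0 0 (by omega)) (fun j hj hy => ?_) (fun j hj hy => ?_)
  · rcases lt_trichotomy j i with h | rfl | h
    · rw [hlt j h, hlt _ (by omega), Finsupp.single_eq_of_ne (by omega), add_zero]
    · rw [hs, hlt _ (by omega), Finsupp.single_eq_same, add_zero]
    · rw [h2 j h hy, Finsupp.single_eq_of_ne (by omega), zero_add]
  · rcases lt_trichotomy j i with h | rfl | h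
    · rw [hlt j h, hlt _ (by omega), Finsupp.single_eq_of_ne (by omega), add_zero]
    · rw [hs, hlt _ (by omega), Finsupp.single_eq_same, add_zero]
    · rw [psum_eq_add hj, h3 j h hy, Finsupp.single_eq_of_ne (by omega), zero_add, add_zero]

lemma edge_congr (hn : 2 ≤ n) {i : ℕ} (hi : 1 ≤ i) (h : ∀ j, i < j → (j ∈ y ↔ j ∈ y')) :
    edge n y i = edge n y' i := by
  apply eq_edge hn hi (fun j hj => edge_of_lt hn hj) (edge_self hn hi)
  · intro j hj hy
    rw [psum_edge, psum_edge, edge_sol_mem hn hj ((h j hj).2 hy)]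
  · intro j hj hy
    exact edge_notMem hj fun h' => hy ((h j hj).1 h')

lemma edge_eq_single (hn : 2 ≤ n) {i : ℕ} (hi : 1 ≤ i) (h : ∀ j, i < j → j ∉ y) :
    edge n y i = Finsupp.single i 1 := by
  symm
  apply eq_edge hn hi (fun j hj => Finsupp.single_eq_of_ne (by omega)) Finsupp.single_eq_same
  · intro j hj hy
    exact absurd hy (h j hj)
  · intro j hj _
    exact Finsupp.single_eq_of_ne (by omega)

/-- The indices form a tree in which the parent of `l` is `l - n` if `l ∈ y` and `l - 1` otherwise.
The partial sums of an edge are the indicator function of the subtree below `i`. -/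
lemma edge_sol_zero_or_one (hn : 2 ≤ n) {i : ℕ} (hi : 1 ≤ i) (j : ℕ) :
    sol n y (Finsupp.single i 1) j = 0 ∨ sol n y (Finsupp.single i 1) j = 1 := by
  induction j using Nat.strong_induction_on with
  | _ j ih =>
    rcases lt_trichotomy j i with h | rfl | h
    · exact Or.inl (edge_sol_of_lt hn h)
    · exact Or.inr (edge_sol_self hn hi)
    · by_cases hy : j ∈ y
      · rw [edge_sol_mem hn h hy]
        exact ih _ (by omega)
      · rw [edge_sol_notMem h hy]
        exact ih _ (by omega)

/-- The weight of the edge direction. -/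
def eta (n : ℕ) (y : Finset ℕ) (i : ℕ) : Fin n → ℤ := starWeight n (edge n y i)

/-- Since the partial sums are `0` or `1`, the nonzero coordinates of the edge alternate `1, -1, 1,
…`, and they are paired with the monotone chain `γ`. If the total is `1`, the weight is at least
`γ_i`. If the total is `0`, it is at most `γ_i - γ_{i+1}`, which is nonpositive and nonzero. -/
lemma eta_definite (hn : 2 ≤ n) {i : ℕ} (hi : 1 ≤ i) : Definite (eta n y i) := by
  set s := sol n y (Finsupp.single i 1) with hs
  have hs01 := fun j => edge_sol_zero_or_one (y := y) hn hi j
  rw [← hs] at hs01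
  have hsi : s i = 1 := edge_sol_self hn hi
  have hslt : ∀ j, j < i → s j = 0 := fun j hj => edge_sol_of_lt hn hj
  -- Both bounds contain the current partial sum `s N`, so that they are preserved when a term `(s
  -- (N + 1) - s N) γ_{N+1}` is added; `s N = 0` and `s N = 1` give the two cases.
  have key : ∀ N, i + 1 ≤ N → ∀ l : Fin n,
      (∑ j ∈ Finset.Icc 1 N, edge n y i j • gamma n j) l ≤
        s N * gamma n N l - (gamma n (i + 1) l - gamma n i l) ∧
      gamma n i l + (s N - 1) * gamma n N l ≤
        (∑ j ∈ Finset.Icc 1 N, edge n y i j • gamma n j) l := by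
    intro N hN l
    induction N, hN using Nat.le_induction with
    | base =>
      rw [Finset.sum_Icc_succ_top (by omega)]
      obtain ⟨k, rfl⟩ := Nat.exists_eq_add_of_le' hi
      rw [Finset.sum_Icc_succ_top (by omega), Finset.sum_eq_zero, zero_add]
      · have h1 : edge n y (k + 1) (k + 1) = 1 := edge_self hn hi
        have h2 : edge n y (k + 1) (k + 1 + 1) = s (k + 1 + 1) - 1 := by
          rw [edge, solSeq_apply, ← hs, Nat.add_sub_cancel, hsi]
        rw [h1, h2]
        simp only [Pi.add_apply, Pi.smul_apply, smul_eq_mul, one_mul]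
        constructor <;> linarith
      · intro j hj
        rw [Finset.mem_Icc] at hj
        rw [edge_of_lt hn (by omega), zero_smul]
    | succ N hN ih =>
      rw [Finset.sum_Icc_succ_top (by omega)]
      have h2 : edge n y i (N + 1) = s (N + 1) - s N := rfl
      rw [h2]
      simp only [Pi.add_apply, Pi.smul_apply, smul_eq_mul]
      have hg : gamma n N l ≤ gamma n (N + 1) l := gamma_mono n (Nat.le_succ N) l
      rcases hs01 N with h | h <;> rw [h] at ih ⊢ <;> constructor <;> nlinarith [ih.1, ih.2]
  have hbound : ∃ N, i + 1 ≤ N ∧ ∀ j, N < j → edge n y i j = 0 := by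
    refine ⟨i + 1 + (edge n y i).support.sup id, by omega, fun j hj => ?_⟩
    by_contra h
    have := Finset.le_sup (f := id) (Finsupp.mem_support_iff.2 h)
    simp only [id] at this
    omega
  obtain ⟨N, hN, hsupp⟩ := hbound
  have hw : eta n y i = ∑ j ∈ Finset.Icc 1 N, edge n y i j • gamma n j :=
    starWeight_eq_sum n (edge_of_lt hn (by omega)) hsupp
  have key := key N hN
  rw [← hw] at key
  rcases hs01 N with h | h <;> simp only [h] at key
  · have hle : eta n y i ≤ 0 := fun l => by
      have h1 := (key l).1
      have h2 : gamma n i l ≤ gamma n (i + 1) l := gamma_mono n (Nat.le_succ i) l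
      simp only [Pi.zero_apply]
      linarith
    refine ⟨fun h0 => gamma_ne_succ hn hi ?_, Or.inr hle⟩
    funext l
    have h1 := (key l).1
    have h2 : gamma n i l ≤ gamma n (i + 1) l := gamma_mono n (Nat.le_succ i) l
    rw [h0] at h1
    simp only [Pi.zero_apply] at h1
    linarith
  · have hle : gamma n i ≤ eta n y i := fun l => by
      have h1 := (key l).2
      linarith
    refine ⟨fun h0 => gamma_ne_zero hn i ?_, Or.inl ((gamma_nonneg n i).trans hle)⟩
    exact le_antisymm (h0 ▸ hle) (gamma_nonneg n i)

end sol

/-! ### The characters `F_y` -/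

section F

variable {n : ℕ} {y y' : Finset ℕ}

/-- The weight of the edge direction `ε_i(y)`. -/
def epsWt (n : ℕ) (y : Finset ℕ) (i : ℕ) : Fin n → ℤ := if i ∈ y then -eta n y i else eta n y i

lemma epsWt_definite (hn : 2 ≤ n) {i : ℕ} (hi : 1 ≤ i) : Definite (epsWt n y i) := by
  rw [epsWt]
  split_ifs
  · exact (eta_definite hn hi).neg
  · exact eta_definite hn hi

lemma eta_congr (hn : 2 ≤ n) {i : ℕ} (hi : 1 ≤ i) (h : ∀ j, i < j → (j ∈ y ↔ j ∈ y')) :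
    eta n y i = eta n y' i := by rw [eta, edge_congr hn hi h, eta]

lemma eta_eq_gamma (hn : 2 ≤ n) {i : ℕ} (hi : 1 ≤ i) (h : ∀ j, i < j → j ∉ y) :
    eta n y i = gamma n i := by
  rw [eta, edge_eq_single hn hi h, starWeight, Finsupp.sum_single_index] <;> simp

lemma epsWt_eq_gamma (hn : 2 ≤ n) {i : ℕ} (hi : 1 ≤ i) (h : ∀ j, i ≤ j → j ∉ y) :
    epsWt n y i = gamma n i := by
  rw [epsWt, if_neg (h i le_rfl), eta_eq_gamma hn hi fun j hj => h j hj.le]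

/-- The partial products of `F_y`. -/
def partialF (n : ℕ) (y : Finset ℕ) (N : ℕ) : CharRing n :=
  ∏ i ∈ Finset.Icc 1 N, geom (epsWt n y i)

lemma suppGE_partialF (hn : 2 ≤ n) (N : ℕ) : SuppGE 0 (partialF n y N) :=
  SuppGE.prod fun _ hi => (epsWt_definite hn (Finset.mem_Icc.1 hi).1).suppGE

/-- Beyond `M` each factor is `(1 - exp γ_i)⁻¹`, which differs from `1` only in exponents at least
`γ_i`, and these cannot contribute to the coefficient at `m`. -/
lemma partialF_coeff (hn : 2 ≤ n) {M : ℕ} (hy : ∀ j, M < j → j ∉ y) {m : Fin n → ℤ}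
    (hM : ∀ i, M < i → ¬ gamma n i ≤ m) {N : ℕ} (hN : M ≤ N) {f : CharRing n} (hf : SuppGE 0 f) :
    (f * partialF n y N).coeff m = (f * partialF n y M).coeff m := by
  induction N, hN using Nat.le_induction with
  | base => rfl
  | succ N hN ih =>
    rw [← ih]
    have h1 : partialF n y (N + 1) =
        partialF n y N + partialF n y N * (geom (gamma n (N + 1)) - 1) := by
      rw [partialF, Finset.prod_Icc_succ_top (by omega), ← partialF,
        epsWt_eq_gamma hn (by omega) fun j hj => hy j (by omega)]
      ring
    rw [h1, mul_add, HahnSeries.coeff_add, add_eq_left]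
    have h2 := hf.mul ((suppGE_partialF (y := y) hn N).mul
      (suppGE_geom_sub_one (gamma_nonneg n (N + 1)) (gamma_ne_zero hn (N + 1))))
    rw [zero_add, zero_add] at h2
    exact h2.coeff_eq_zero (hM _ (by omega))

lemma exists_bound (y : Finset ℕ) : ∃ M, ∀ j, M < j → j ∉ y :=
  ⟨y.sup id, fun j hj h => by have := Finset.le_sup (f := id) h; simp only [id] at this; omega⟩

lemma exists_stabilizes_partialF (hn : 2 ≤ n) (y : Finset ℕ) :
    ∃ t, Stabilizes (partialF n y) t := by
  refine exists_stabilizes (fun N => suppGE_partialF hn N) fun m => ?_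
  obtain ⟨M, hM⟩ := exists_not_gamma_le hn m
  obtain ⟨M', hM'⟩ := exists_bound y
  refine ⟨max M M', fun i hi => ?_⟩
  have := partialF_coeff hn (M := max M M') (y := y) (m := m) (fun j hj => hM' j (by omega))
    (fun j hj => hM j (by omega)) hi suppGE_one
  rwa [one_mul, one_mul] at this

open Classical in
/-- The character `F_y`. -/
def charF (n : ℕ) (y : Finset ℕ) : CharRing n :=
  if h : ∃ t, Stabilizes (partialF n y) t then h.choose else 0

lemma stabilizes_charF (hn : 2 ≤ n) (y : Finset ℕ) : Stabilizes (partialF n y) (charF n y) := by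
  have h := exists_stabilizes_partialF hn y
  rw [charF, dif_pos h]
  exact h.choose_spec

lemma isF_charF (hn : 2 ≤ n) (y : Finset ℕ) : IsF n y (charF n y) := by
  refine ⟨fun i => if i ∈ y then -edge n y i else edge n y i, fun i hi => ?_, fun i hi => ?_, ?_⟩
  · have hj : ∀ j, 1 ≤ j → j ≠ i →
        (j ∈ y → psi n (edge n y i) j = 0) ∧ (j ∉ y → edge n y i j = 0) := by
      intro j hj hji
      rcases hji.lt_or_gt with h | h
      · refine ⟨fun _ => ?_, fun _ => edge_of_lt hn h⟩
        rw [psi_eq, psum_edge, psum_edge, edge_sol_of_lt hn h, edge_sol_of_lt hn (by omega),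
          sub_zero]
      · refine ⟨fun hy => ?_, edge_notMem h⟩
        rw [psi_eq, psum_edge, psum_edge, edge_sol_mem hn h hy, sub_self]
    by_cases h : i ∈ y
    · simp only [if_pos h]
      refine ⟨fun j hj => ?_, ?_, fun j hj1 hji => ⟨fun hy => ?_, fun hy => ?_⟩⟩
      · rw [Finsupp.neg_apply, edge_of_lt hn hj, neg_zero]
      · rw [Finsupp.neg_apply, edge_self hn hi, if_pos h]
      · have := (hj j hj1 hji).1 hy
        rw [psi_eq] at this ⊢
        rw [Finsupp.coe_neg, psum_neg, psum_neg]
        linarith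
      · rw [Finsupp.neg_apply, (hj j hj1 hji).2 hy, neg_zero]
    · simp only [if_neg h]
      exact ⟨fun j hj => edge_of_lt hn hj, by rw [edge_self hn hi, if_neg h], hj⟩
  · have := (epsWt_definite (y := y) hn hi).isUnit
    rw [epsWt] at this
    dsimp only
    split_ifs at this ⊢
    · rwa [expStar, starWeight_neg]
    · exact this
  · refine (stabilizes_charF hn y).congr (Eventually.of_forall fun N => ?_)
    rw [partialF]
    refine Finset.prod_congr rfl fun i _ => ?_
    rw [geom, epsWt]
    dsimp only
    split_ifs
    · rw [expStar, starWeight_neg, eta]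
    · rfl

lemma expo_mul_charF_coeff (hn : 2 ≤ n) {M : ℕ} (hy : ∀ j, M < j → j ∉ y) {m : Fin n → ℤ}
    (hM : ∀ i, M < i → ¬ gamma n i ≤ m) {c : Fin n → ℤ} (hc : 0 ≤ c) :
    (expo c * charF n y).coeff m = (expo c * partialF n y M).coeff m := by
  obtain ⟨N, h1, h2⟩ := (((stabilizes_charF hn y).expo_mul c m).and (eventually_ge_atTop M)).exists
  rw [← h1]
  exact partialF_coeff hn hy hM h2 ((suppGE_expo c).mono hc)

/-- At the largest element `k` of `y` the edge weight is `-γ_k`, so the corresponding factor is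
`-exp γ_k / (1 - exp γ_k)`, supported above `γ_k ≥ γ_j`. Hence only finitely many `y` contribute to
a given weight. -/
lemma expo_mul_charF_coeff_eq_zero (hn : 2 ≤ n) {j : ℕ} (h1 : 1 ≤ j) (hj : j ∈ y) {m : Fin n → ℤ}
    (hm : ¬ gamma n j ≤ m) {c : Fin n → ℤ} (hc : 0 ≤ c) :
    (expo c * charF n y).coeff m = 0 := by
  obtain ⟨N, h2, h3⟩ :=
    (((stabilizes_charF hn y).expo_mul c m).and (eventually_ge_atTop (y.sup id))).exists
  rw [← h2]
  have hne : y.Nonempty := ⟨j, hj⟩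
  set k := y.max' hne with hk
  have hky : k ∈ y := y.max'_mem hne
  have hjk : j ≤ k := y.le_max' j hj
  have hkN : k ≤ N := (Finset.le_sup (f := id) hky).trans h3
  have hkI : k ∈ Finset.Icc 1 N := Finset.mem_Icc.2 ⟨by omega, hkN⟩
  dsimp only
  rw [show partialF n y N = ∏ i ∈ Finset.Icc 1 N, geom (epsWt n y i) from rfl,
    ← Finset.mul_prod_erase _ _ hkI]
  have he : epsWt n y k = -gamma n k := by
    rw [epsWt, if_pos hky, eta_eq_gamma hn (by omega)]
    intro l hl hl'
    exact absurd (y.le_max' l hl') (by omega)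
  have h4 : SuppGE (gamma n k) (geom (epsWt n y k)) := by
    have := suppGE_geom_of_nonpos (β := -gamma n k) (neg_nonpos.2 (gamma_nonneg n k))
      (neg_ne_zero.2 (gamma_ne_zero hn k))
    rwa [neg_neg, ← he] at this
  have h5 : SuppGE 0 (∏ i ∈ (Finset.Icc 1 N).erase k, geom (epsWt n y i)) :=
    SuppGE.prod fun i hi =>
      (epsWt_definite hn (Finset.mem_Icc.1 (Finset.mem_of_mem_erase hi)).1).suppGE
  have h6 := ((suppGE_expo c).mono hc).mul (h4.mul h5)
  rw [zero_add, add_zero] at h6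
  exact h6.coeff_eq_zero fun h => hm ((gamma_mono n hjk).trans h)

end F

/-! ### Generating functions of regions -/

/-- The integral solution of the facet equations `ψ_j = b_j` for `j ∈ y` and `x_j = 0` for
`j ∉ y`. -/
def vert (n : ℕ) (b : ℕ → ℤ) (y : Finset ℕ) : ℕ →₀ ℤ :=
  solSeq n y (Finsupp.indicator y fun j _ => b j)

section vert

variable {n : ℕ} {b : ℕ → ℤ} {y : Finset ℕ}

lemma vert_zero : vert n b y 0 = 0 := solSeq_zero _

lemma vert_notMem {j : ℕ} (h : j ∉ y) : vert n b y j = 0 :=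
  solSeq_eq_zero_of_notMem h (Finsupp.indicator_of_notMem h _)

lemma psum_vert (hn : 2 ≤ n) {j : ℕ} (hj : 1 ≤ j) (h : j ∈ y) :
    psum (vert n b y) j = b j + psum (vert n b y) (j - n) := by
  rw [vert, psum_solSeq, psum_solSeq, sol_mem hn hj h, Finsupp.indicator_of_mem h]

lemma eq_vert (hn : 2 ≤ n) {x : ℕ →₀ ℤ} (h0 : x 0 = 0)
    (h1 : ∀ j, 1 ≤ j → j ∈ y → psum x j = b j + psum x (j - n))
    (h2 : ∀ j, 1 ≤ j → j ∉ y → x j = 0) : x = vert n b y := by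
  refine eq_solSeq hn h0 (fun j hj hy => ?_) (fun j hj hy => ?_)
  · rw [h1 j hj hy, Finsupp.indicator_of_mem hy]
  · rw [psum_eq_add hj, h2 j hj hy, Finsupp.indicator_of_notMem hy, add_zero, zero_add]

end vert

/-- The integral points satisfying the constraints in `ω` at the indices `j ≤ i` and the equations
given by `y` at the indices `i < j ≤ m`. -/
def region (n : ℕ) (ω : Set Facet) (b : ℕ → ℤ) (m i : ℕ) (y : Finset ℕ) : Set (ℕ →₀ ℤ) :=
  {z | z 0 = 0 ∧ (∀ j, m < j → z j = 0) ∧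
    (∀ j, 1 ≤ j → j ≤ i → (Facet.Gam j ∈ ω → psum z j ≤ b j + psum z (j - n)) ∧
      (Facet.Del j ∈ ω → 0 ≤ z j)) ∧
    ∀ j, i < j → j ≤ m → (j ∈ y → psum z j = b j + psum z (j - n)) ∧ (j ∉ y → z j = 0)}

/-- The generating function of a set of integral points. -/
def indFun (C : Set (ℕ →₀ ℤ)) : (ℕ →₀ ℤ) → ℂ := Set.indicator C fun _ => 1

open Classical in
lemma indFun_apply (C : Set (ℕ →₀ ℤ)) (z : ℕ →₀ ℤ) : indFun C z = if z ∈ C then 1 else 0 :=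
  Set.indicator_apply _ _ _

open Classical in
/-- `1` if `y` selects at the index `j` a facet of `ω`, and `0` otherwise. -/
def selInd (ω : Set Facet) (y : Finset ℕ) (j : ℕ) : ℂ :=
  if j ∈ y then (if Facet.Gam j ∈ ω then 1 else 0) else if Facet.Del j ∈ ω then 1 else 0

/-- The sum over the vertices `y₀ ∪ y`, `y₀ ⊆ [1, i]`, of their contributions. -/
def vertexSum (n : ℕ) (ω : Set Facet) (b : ℕ → ℤ) (i : ℕ) (y : Finset ℕ) : CharRing n :=
  ∑ y₀ ∈ (Finset.Icc 1 i).powerset, expStar n (vert n b (y₀ ∪ y)) *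
    ∏ j ∈ Finset.Icc 1 i, (algebraMap ℂ (CharRing n) (selInd ω (y₀ ∪ y) j) * geom (epsWt n (y₀ ∪ y) j))

section region

variable {n : ℕ} {ω : Set Facet} {b : ℕ → ℤ} {m i : ℕ} {y : Finset ℕ}

-- The sum is split by whether `i + 1` is chosen. The factor with index `i + 1` depends only on the
-- choices from `i + 1` on, so it is common to all terms of each half.
open Classical in
lemma vertexSum_succ (hn : 2 ≤ n) (hy : ∀ j ∈ y, i + 1 < j) :
    vertexSum n ω b (i + 1) y =
      algebraMap ℂ (CharRing n) (if Facet.Del (i + 1) ∈ ω then (1 : ℂ) else 0) *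
          (geom (eta n y (i + 1)) * vertexSum n ω b i y) +
        algebraMap ℂ (CharRing n) (if Facet.Gam (i + 1) ∈ ω then (1 : ℂ) else 0) *
          (geom (-eta n y (i + 1)) * vertexSum n ω b i (insert (i + 1) y)) := by
  have hI : Finset.Icc 1 (i + 1) = insert (i + 1) (Finset.Icc 1 i) := by ext; simp; omega
  have hI' : i + 1 ∉ Finset.Icc 1 i := by simp
  rw [vertexSum, hI, Finset.sum_powerset_insert hI', vertexSum, vertexSum]
  simp only [Finset.prod_insert hI', Finset.mul_sum]
  have hsub : ∀ y₀ ∈ (Finset.Icc 1 i).powerset, i + 1 ∉ y₀ := fun y₀ h h' =>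
    hI' (Finset.mem_powerset.1 h h')
  have heta : ∀ y₀ ∈ (Finset.Icc 1 i).powerset,
      eta n (y₀ ∪ y) (i + 1) = eta n y (i + 1) := fun y₀ h =>
    eta_congr hn (by omega) fun j hj => by
      have : j ∉ y₀ := fun h' => by
        have := Finset.mem_Icc.1 (Finset.mem_powerset.1 h h'); omega
      simp [this]
  have hyi : i + 1 ∉ y := fun h => by have := hy _ h; omega
  congr 1
  · refine Finset.sum_congr rfl fun y₀ h => ?_
    have h1 : i + 1 ∉ y₀ ∪ y := by simp [hsub y₀ h, hyi]
    rw [selInd, if_neg h1, epsWt, if_neg h1, heta y₀ h]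
    ring
  · refine Finset.sum_congr rfl fun y₀ h => ?_
    have h2 : insert (i + 1) y₀ ∪ y = y₀ ∪ insert (i + 1) y := by
      ext; simp
    have h1 : i + 1 ∈ y₀ ∪ insert (i + 1) y := by simp
    have h3 : eta n (y₀ ∪ insert (i + 1) y) (i + 1) = eta n y (i + 1) := by
      rw [← heta y₀ h]
      refine eta_congr hn (by omega) fun j hj => ?_
      have : j ≠ i + 1 := by omega
      simp [this]
    rw [h2, selInd, if_pos h1, epsWt, if_pos h1, h3]
    ring

lemma substStar_single' (x : ℕ →₀ ℤ) (c : ℂ) :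
    substStar n (AddMonoidAlgebra.single x c) =
      algebraMap ℂ (CharRing n) c * expStar n x := by
  rw [substStar_eq, substHom, AddMonoidAlgebra.lift_single, Algebra.smul_def]
  rfl

open Classical in
/-- The sum over the values of the coordinate `z_{i + 1}` is geometric. -/
lemma region_step (hn : 2 ≤ n) (hy : ∀ j ∈ y, i + 1 < j ∧ j ≤ m) (him : i + 1 ≤ m)
    (hω : Facet.Gam (i + 1) ∈ ω ∨ Facet.Del (i + 1) ∈ ω)
    (hboth : Facet.Gam (i + 1) ∈ ω → Facet.Del (i + 1) ∈ ω →
      ∀ z : ℕ →₀ ℤ, (∀ j, 1 ≤ j → j ≤ i →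
        (Facet.Gam j ∈ ω → psum z j ≤ b j + psum z (j - n)) ∧ (Facet.Del j ∈ ω → 0 ≤ z j)) →
      psum z i ≤ b (i + 1) + psum z (i + 1 - n)) (z : ℕ →₀ ℤ) :
    indFun (region n ω b m (i + 1) y) z -
        indFun (region n ω b m (i + 1) y) (z - edge n y (i + 1)) =
      (if Facet.Del (i + 1) ∈ ω then (1 : ℂ) else 0) * indFun (region n ω b m i y) z -
        (if Facet.Gam (i + 1) ∈ ω then (1 : ℂ) else 0) *
          indFun (region n ω b m i (insert (i + 1) y)) (z - edge n y (i + 1)) := by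
  set ε := edge n y (i + 1) with hε
  have hpε : ∀ j, psum (z - ε) j = psum z j - psum ε j := fun j => psum_sub _ _ j
  have hεlt : ∀ j, j < i + 1 → ε j = 0 := fun j hj => edge_of_lt hn hj
  have hpεlt : ∀ j, j < i + 1 → psum ε j = 0 := fun j hj => by
    rw [hε, psum_edge, edge_sol_of_lt hn hj]
  have hpε1 : psum ε (i + 1) = 1 := by rw [hε, psum_edge, edge_sol_self hn (by omega)]
  have hεself : ε (i + 1) = 1 := edge_self hn (by omega)
  have hεgt : ∀ j, i + 1 < j → j ∉ y → ε j = 0 := fun j hj hy => edge_notMem hj hy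
  have hεmem : ∀ j, i + 1 < j → j ∈ y → psum ε j = psum ε (j - n) := fun j hj hy => by
    rw [hε, psum_edge, psum_edge, edge_sol_mem hn hj hy]
  -- The conditions not involving the facets with index `i + 1`. They are invariant under
  -- translation by `ε`, which solves the homogeneous equations above `i + 1` and vanishes below.
  let base : (ℕ →₀ ℤ) → Prop := fun z => z 0 = 0 ∧ (∀ j, m < j → z j = 0) ∧
    (∀ j, 1 ≤ j → j ≤ i → (Facet.Gam j ∈ ω → psum z j ≤ b j + psum z (j - n)) ∧
      (Facet.Del j ∈ ω → 0 ≤ z j)) ∧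
    ∀ j, i + 1 < j → j ≤ m → (j ∈ y → psum z j = b j + psum z (j - n)) ∧ (j ∉ y → z j = 0)
  have hbase : base (z - ε) ↔ base z := by
    have e1 : ∀ j, m < j → ((z - ε) j = 0 ↔ z j = 0) := fun j hj => by
      rw [Finsupp.sub_apply, hεgt j (by omega) fun h => by have := hy j h; omega, sub_zero]
    have e2 : ∀ j, j ≤ i → psum (z - ε) j = psum z j := fun j hj => by
      rw [hpε, hpεlt j (by omega), sub_zero]
    have e3 : ∀ j, j ≤ i → (z - ε) j = z j := fun j hj => by
      rw [Finsupp.sub_apply, hεlt j (by omega), sub_zero]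
    have e4 : ∀ j, i + 1 < j → j ∈ y → (psum (z - ε) j = b j + psum (z - ε) (j - n) ↔
        psum z j = b j + psum z (j - n)) := fun j hj hjy => by
      rw [hpε, hpε, hεmem j hj hjy]
      constructor <;> intro h <;> linarith
    have e5 : ∀ j, i + 1 < j → j ∉ y → ((z - ε) j = 0 ↔ z j = 0) := fun j hj hjy => by
      rw [Finsupp.sub_apply, hεgt j hj hjy, sub_zero]
    refine and_congr (by rw [e3 0 (by omega)]) (and_congr ?_ (and_congr ?_ ?_))
    · exact forall_congr' fun j => imp_congr_right fun hj => e1 j hj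
    · refine forall_congr' fun j => imp_congr_right fun hj => imp_congr_right fun hji => ?_
      rw [e2 j hji, e2 (j - n) (by omega), e3 j hji]
    · refine forall_congr' fun j => imp_congr_right fun hj => imp_congr_right fun _ => ?_
      exact and_congr (imp_congr_right (e4 j hj)) (imp_congr_right (e5 j hj))
  have hR1 : ∀ z, z ∈ region n ω b m (i + 1) y ↔ base z ∧
      ((Facet.Gam (i + 1) ∈ ω → psum z (i + 1) ≤ b (i + 1) + psum z (i + 1 - n)) ∧
      (Facet.Del (i + 1) ∈ ω → 0 ≤ z (i + 1))) := fun z => by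
    constructor
    · rintro ⟨h1, h2, h3, h4⟩
      exact ⟨⟨h1, h2, fun j hj hji => h3 j hj (by omega), h4⟩, h3 _ (by omega) le_rfl⟩
    · rintro ⟨⟨h1, h2, h3, h4⟩, h5⟩
      refine ⟨h1, h2, fun j hj hji => ?_, h4⟩
      rcases Nat.le_succ_iff.1 hji with h | rfl
      · exact h3 j hj h
      · exact h5
  have hyi : i + 1 ∉ y := fun h => by have := hy _ h; omega
  have hR2 : ∀ z, z ∈ region n ω b m i y ↔ base z ∧ z (i + 1) = 0 := fun z => by
    constructor
    · rintro ⟨h1, h2, h3, h4⟩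
      exact ⟨⟨h1, h2, h3, fun j hj => h4 j (by omega)⟩, (h4 (i + 1) (by omega) him).2 hyi⟩
    · rintro ⟨⟨h1, h2, h3, h4⟩, h5⟩
      refine ⟨h1, h2, h3, fun j hj hjm => ?_⟩
      rcases Nat.lt_or_ge (i + 1) j with h | h
      · exact h4 j h hjm
      · obtain rfl : j = i + 1 := by omega
        exact ⟨fun h => absurd h hyi, fun _ => h5⟩
  have hR3 : ∀ z, z ∈ region n ω b m i (insert (i + 1) y) ↔
      base z ∧ psum z (i + 1) = b (i + 1) + psum z (i + 1 - n) := fun z => by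
    have hins : ∀ j, i + 1 < j → (j ∈ insert (i + 1) y ↔ j ∈ y) := fun j hj => by
      rw [Finset.mem_insert, or_iff_right (by omega)]
    constructor
    · rintro ⟨h1, h2, h3, h4⟩
      refine ⟨⟨h1, h2, h3, fun j hj hjm => ?_⟩,
        (h4 (i + 1) (by omega) him).1 (Finset.mem_insert_self _ _)⟩
      rw [← hins j hj]
      exact h4 j (by omega) hjm
    · rintro ⟨⟨h1, h2, h3, h4⟩, h5⟩
      refine ⟨h1, h2, h3, fun j hj hjm => ?_⟩
      rcases Nat.lt_or_ge (i + 1) j with h | h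
      · rw [hins j h]
        exact h4 j h hjm
      · obtain rfl : j = i + 1 := by omega
        exact ⟨fun _ => h5, fun h => absurd (Finset.mem_insert_self _ _) h⟩
  simp only [indFun_apply, hR1, hR2, hR3, hbase]
  -- On the line `z + ℤ ε` the coordinate `i + 1` runs through an interval or a ray. The difference
  -- of the indicator and its translate is concentrated at the start and one step past the end. When
  -- both ends exist, `hboth'` ensures that the start does not lie beyond the end.
  by_cases hb : base z
  · have hs : psum z (i + 1) = psum z i + z (i + 1) := psum_succ _ _
    have hboth' : Facet.Gam (i + 1) ∈ ω → Facet.Del (i + 1) ∈ ω →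
        psum z i ≤ b (i + 1) + psum z (i + 1 - n) := fun h1 h2 =>
      hboth h1 h2 z hb.2.2.1
    rw [hpε, hpε, hpεlt (i + 1 - n) (by omega), hpε1, Finsupp.sub_apply, hεself, sub_zero]
    simp only [hb, true_and]
    generalize psum z (i + 1 - n) = W at *
    generalize psum z (i + 1) = T at *
    generalize psum z i = T' at *
    generalize z (i + 1) = t at *
    by_cases h1 : Facet.Gam (i + 1) ∈ ω <;> by_cases h2 : Facet.Del (i + 1) ∈ ω
    · have := hboth' h1 h2
      simp only [h1, h2, true_implies, if_true, one_mul]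
      split_ifs <;> first | omega | norm_num
    · simp only [h1, h2, true_implies, false_implies, and_true, if_true, if_false, one_mul,
        zero_mul]
      split_ifs <;> first | omega | norm_num
    · simp only [h1, h2, true_implies, false_implies, true_and, if_true, if_false, one_mul,
        zero_mul]
      split_ifs <;> first | omega | norm_num
    · exact absurd hω (by simp [h1, h2])
  · simp [hb]

/-- The rational function of a region is the sum of the contributions of its vertices. -/
theorem isSig_region (hn : 2 ≤ n)
    (hω : ∀ i, i + 1 ≤ m → Facet.Gam (i + 1) ∈ ω ∨ Facet.Del (i + 1) ∈ ω)
    (hboth : ∀ i, i + 1 ≤ m → Facet.Gam (i + 1) ∈ ω → Facet.Del (i + 1) ∈ ω →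
      ∀ z : ℕ →₀ ℤ, (∀ j, 1 ≤ j → j ≤ i →
        (Facet.Gam j ∈ ω → psum z j ≤ b j + psum z (j - n)) ∧ (Facet.Del j ∈ ω → 0 ≤ z j)) →
      psum z i ≤ b (i + 1) + psum z (i + 1 - n))
    (him : i ≤ m) (hy : ∀ j ∈ y, i < j ∧ j ≤ m) :
    IsSig n (indFun (region n ω b m i y)) (vertexSum n ω b i y) := by
  classical
  induction i generalizing y with
  | zero =>
    -- With no inequality left, the region is the single point `vert n b y`.
    have h1 : vertexSum n ω b 0 y = expStar n (vert n b y) := by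
      simp [vertexSum]
    have h2 : indFun (region n ω b m 0 y) =
        (AddMonoidAlgebra.single (vert n b y) (1 : ℂ) : LaurentPoly).coeff := by
      funext z
      rw [indFun_apply, AddMonoidAlgebra.coeff_single, Finsupp.single_apply]
      refine if_congr ⟨fun hz => ?_, fun hz => ?_⟩ rfl rfl
      · symm
        refine eq_vert hn hz.1 (fun j hj hjy => (hz.2.2.2 j (by omega) (hy j hjy).2).1 hjy)
          fun j hj hjy => ?_
        by_cases hjm : j ≤ m
        · exact (hz.2.2.2 j (by omega) hjm).2 hjy
        · exact hz.2.1 j (by omega)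
      · subst hz
        refine ⟨vert_zero, fun j hj => vert_notMem fun h => ?_, fun j hj hj' => by omega,
          fun j hj hjm => ⟨fun h => psum_vert hn (by omega) h, vert_notMem⟩⟩
        have := hy j h
        omega
    rw [h1, h2, ← substStar_single]
    exact isSig_coeff _
  | succ i ih =>
    have hA := ih (y := y) (by omega) fun j hj => by have := hy j hj; omega
    have hB := ih (y := insert (i + 1) y) (by omega) fun j hj => by
      rcases Finset.mem_insert.1 hj with rfl | hj
      · omega
      · have := hy j hj; omega
    have hdef : Definite (eta n y (i + 1)) := eta_definite hn (by omega)
    set ε := edge n y (i + 1) with hε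
    set q : LaurentPoly := 1 - AddMonoidAlgebra.single ε 1 with hq
    have hqs : substStar n q = 1 - expo (eta n y (i + 1)) := by
      rw [substStar_eq, hq, map_sub, map_one, ← substStar_eq, substStar_single]
      rfl
    set d : ℂ := if Facet.Del (i + 1) ∈ ω then (1 : ℂ) else 0 with hd
    set g : ℂ := if Facet.Gam (i + 1) ∈ ω then (1 : ℂ) else 0 with hg
    have hC := (hA.laurentMul (AddMonoidAlgebra.single 0 d)).add
      (hB.laurentMul (AddMonoidAlgebra.single ε (-g)))
    -- After multiplication by `1 - t^ε` there remain the part on `Δ_{i+1}` minus the translated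
    -- part on `Γ_{i+1}`. Both have one inequality index fewer.
    refine IsSig.of_laurentMul (q := q) (hqs ▸ hdef.isUnit) ?_
    convert hC using 1
    · funext z
      have := region_step hn hy him (hω i him) (hboth i him) z
      have hone : q = AddMonoidAlgebra.single 0 1 + AddMonoidAlgebra.single ε (-1) := by
        rw [hq, AddMonoidAlgebra.single_neg, ← sub_eq_add_neg]
        rfl
      rw [hone, laurentMul_add]
      simp only [Pi.add_apply, laurentMul_single, sub_zero, one_mul]
      rw [← hε] at this
      linear_combination this
    · rw [vertexSum_succ hn fun j hj => (hy j hj).1, hqs, substStar_single', substStar_single',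
        hdef.geom_neg]
      have h0 : expStar n 0 = 1 := by rw [expStar, starWeight_zero, expo_zero]
      have h1 := hdef.mul_geom
      rw [h0, show expStar n ε = expo (eta n y (i + 1)) from rfl]
      rw [map_neg]
      linear_combination (algebraMap ℂ (CharRing n) d * vertexSum n ω b i y -
        algebraMap ℂ (CharRing n) g * expo (eta n y (i + 1)) *
          vertexSum n ω b i (insert (i + 1) y)) * h1

end region

/-! ### Vertices and their facets -/

section vertices

variable {n : ℕ} [NeZero n] {a : Fin n → ℕ}

lemma label_add_self (a : Fin n → ℕ) : label a n = label a 0 := by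
  simp [label, Fin.ofNat]

/-- At `i = n` the level is again a partial sum of labels, because `a_n = a_0`. Hence degeneracies
at the index `n` can be treated like those at smaller indices. -/
lemma bound_of_le {i : ℕ} (hi : i ≤ n) : bound a i = ∑ l ∈ Finset.Icc 1 i, label a l := by
  rw [bound]
  split_ifs with h
  · rfl
  · obtain rfl : i = n := by omega
    have hpos := Nat.pos_of_ne_zero (NeZero.ne i)
    have h1 : ∑ l, a l = ∑ l ∈ Finset.range i, label a l := by
      rw [Finset.sum_range]
      refine Finset.sum_congr rfl fun l _ => ?_
      rw [label]
      congr 1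
      ext
      simp [Fin.ofNat, Nat.mod_eq_of_lt l.2]
    obtain ⟨k, rfl⟩ := Nat.exists_eq_add_of_le' hpos
    rw [h1, Finset.sum_range_succ', Finset.sum_Icc_succ_top (by omega), label_add_self,
      Finset.range_eq_Ico, Finset.sum_Ico_add' (fun l => label a l) 0 k 1]
    rfl

lemma bound_zero : bound a 0 = 0 := by rw [bound_of_le (Nat.zero_le _)]; simp

lemma bound_succ {i : ℕ} (hi : i + 1 ≤ n) : bound a (i + 1) = bound a i + label a (i + 1) := by
  rw [bound_of_le hi, bound_of_le (by omega), Finset.sum_Icc_succ_top (by omega)]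

lemma bound_of_ge {i : ℕ} (hi : n ≤ i) : bound a i = ∑ l, a l := by
  rw [bound, if_neg (by omega)]

lemma bound_le_succ (i : ℕ) : bound a i ≤ bound a (i + 1) := by
  by_cases h : i + 1 ≤ n
  · rw [bound_succ h]
    omega
  · rw [bound_of_ge (by omega), bound_of_ge (by omega)]

lemma toReal_apply (x : ℕ →₀ ℤ) (i : ℕ) : toReal x i = (x i : ℝ) := rfl

lemma psum_toReal (x : ℕ →₀ ℤ) (i : ℕ) : psum (toReal x) i = ((psum x i : ℤ) : ℝ) := by
  simp [psum, toReal_apply]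

lemma mem_polytope {x : ℕ →₀ ℝ} : x ∈ polytope a ↔ x 0 = 0 ∧ (∀ i, 0 ≤ x i) ∧
    ∀ i, 1 ≤ i → psum x i ≤ bound a i + psum x (i - n) := by
  simp only [polytope, Set.mem_ofPred_eq, psi_eq, sub_le_iff_le_add]

lemma gam_mem {x : ℕ →₀ ℝ} {i : ℕ} : Facet.Gam i ∈ facetSet a x ↔
    1 ≤ i ∧ psum x i = bound a i + psum x (i - n) := by
  simp only [facetSet, Set.mem_ofPred_eq, Facet.Gam.injEq, reduceCtorEq, false_and, or_false,
    psi_eq, sub_eq_iff_eq_add]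
  constructor
  · rintro ⟨j, hj, rfl, h⟩
    exact ⟨hj, h⟩
  · rintro ⟨h1, h2⟩
    exact ⟨i, h1, rfl, h2⟩

lemma del_mem {x : ℕ →₀ ℝ} {i : ℕ} : Facet.Del i ∈ facetSet a x ↔ 1 ≤ i ∧ x i = 0 := by
  simp only [facetSet, Set.mem_ofPred_eq, Facet.Del.injEq, reduceCtorEq, false_and, false_or]
  constructor
  · rintro ⟨j, hj, rfl, h⟩
    exact ⟨hj, h⟩
  · rintro ⟨h1, h2⟩
    exact ⟨i, h1, rfl, h2⟩

/-- Both facets with index `i ≤ n` contain a point only if `a_i = 0`. -/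
lemma both_mem_of_le {u : ℕ →₀ ℝ} (hu : u ∈ polytope a) {i : ℕ} (hi : 1 ≤ i) (hin : i ≤ n) :
    (Facet.Gam i ∈ facetSet a u ∧ Facet.Del i ∈ facetSet a u) ↔
      label a i = 0 ∧ (Facet.Gam (i - 1) ∈ facetSet a u ∨ i = 1) := by
  rw [mem_polytope] at hu
  obtain ⟨j, rfl⟩ := Nat.exists_eq_add_of_le' hi
  rw [gam_mem, del_mem, gam_mem, Nat.add_sub_cancel, Nat.sub_eq_zero_of_le hin,
    Nat.sub_eq_zero_of_le (by omega : j ≤ n), psum_zero, psum_succ, bound_succ hin]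
  have h0 := hu.2.1 (j + 1)
  have h1 := hu.2.2 (j + 1) (by omega)
  rw [Nat.sub_eq_zero_of_le hin, psum_zero, psum_succ, bound_succ hin] at h1
  simp only [Nat.cast_add] at h1 ⊢
  -- For `j = 0` the preceding constraint is the identity `ψ_0 = b_0 = 0`, always tight; this
  -- accounts for the alternative `i = 1`.
  rcases Nat.eq_zero_or_pos j with rfl | hj
  · have hp : psum u 0 = 0 := psum_zero _
    have hb : bound a 0 = 0 := bound_zero
    simp only [hp, hb, Nat.cast_zero] at h1 ⊢
    constructor
    · rintro ⟨⟨-, h2⟩, -, h3⟩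
      refine ⟨?_, Or.inr trivial⟩
      have : (label a (0 + 1) : ℝ) = 0 := by linarith
      exact_mod_cast this
    · rintro ⟨h2, -⟩
      rw [h2, Nat.cast_zero] at h1 ⊢
      refine ⟨⟨le_rfl, ?_⟩, le_rfl, ?_⟩ <;> linarith
  · have h2 := hu.2.2 j hj
    rw [Nat.sub_eq_zero_of_le (by omega : j ≤ n), psum_zero] at h2
    have hl : (0 : ℝ) ≤ label a (j + 1) := Nat.cast_nonneg _
    constructor
    · rintro ⟨⟨-, h3⟩, -, h4⟩
      refine ⟨?_, Or.inl ⟨hj, ?_⟩⟩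
      · have : (label a (j + 1) : ℝ) = 0 := by linarith
        exact_mod_cast this
      · linarith
    · rintro ⟨h3, h4⟩
      have h4 := (h4.resolve_right (by omega)).2
      rw [h3, Nat.cast_zero] at h1 ⊢
      refine ⟨⟨by omega, ?_⟩, by omega, ?_⟩ <;> linarith

/-- Read off from `ψ_i(x) + x_{i-n} = ψ_{i-1}(x) + x_i`: both values of `ψ` are at most the level,
and both coordinates are nonnegative. -/
lemma both_mem_of_gt {u : ℕ →₀ ℝ} (hu : u ∈ polytope a) {i : ℕ} (hin : n < i) :
    (Facet.Gam i ∈ facetSet a u ∧ Facet.Del i ∈ facetSet a u) ↔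
      Facet.Gam (i - 1) ∈ facetSet a u ∧ Facet.Del (i - n) ∈ facetSet a u := by
  rw [mem_polytope] at hu
  have hpos := Nat.pos_of_ne_zero (NeZero.ne n)
  rw [gam_mem, del_mem, gam_mem, del_mem, psum_eq_add (by omega : 1 ≤ i), bound_of_ge (by omega),
    bound_of_ge (by omega), psum_eq_add (by omega : 1 ≤ i - n),
    show i - n - 1 = i - 1 - n by omega]
  have h0 := hu.2.1 i
  have h1 := hu.2.1 (i - n)
  have h2 := hu.2.2 i (by omega)
  have h3 := hu.2.2 (i - 1) (by omega)
  rw [psum_eq_add (by omega : 1 ≤ i), bound_of_ge (by omega), psum_eq_add (by omega : 1 ≤ i - n),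
    show i - n - 1 = i - 1 - n by omega] at h2
  rw [bound_of_ge (by omega)] at h3
  constructor
  · rintro ⟨⟨-, h4⟩, -, h5⟩
    refine ⟨⟨by omega, ?_⟩, by omega, ?_⟩ <;> linarith
  · rintro ⟨⟨-, h4⟩, -, h5⟩
    refine ⟨⟨by omega, ?_⟩, by omega, ?_⟩ <;> linarith

lemma level_pos {n : ℕ} {a : Fin n → ℕ} (ha : a ≠ 0) : 0 < ∑ l, a l := by
  obtain ⟨l, hl⟩ := Function.ne_iff.1 ha
  exact lt_of_lt_of_le (Nat.pos_of_ne_zero hl)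
    (Finset.single_le_sum (fun _ _ => Nat.zero_le _) (Finset.mem_univ l))

/-- Far beyond the support `ψ_i` vanishes, while `b_i` is the level, which is positive as `λ ≠ 0`.
-/
lemma finite_gam (ha : a ≠ 0) (u : ℕ →₀ ℝ) : {i | Facet.Gam i ∈ facetSet a u}.Finite := by
  refine (Set.finite_Iic (n + u.support.sup id)).subset fun i hi => ?_
  rw [Set.mem_Iic]
  by_contra h
  have hz : ∀ j, u.support.sup id < j → u j = 0 := fun j hj => by
    by_contra h'
    have := Finset.le_sup (f := id) (Finsupp.mem_support_iff.2 h')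
    simp only [id] at this
    omega
  have h1 := (gam_mem.1 hi).2
  rw [psum_eq_of_support hz (i := i) (by omega), psum_eq_of_support hz (i := i - n) (by omega),
    bound_of_ge (by omega), right_eq_add] at h1
  have := level_pos ha
  have h2 : ∑ l, a l = 0 := by exact_mod_cast h1
  omega

/-- The vertex set condition in terms of indices. -/
lemma facetSet_mem_Omega (ha : a ≠ 0) {u : ℕ →₀ ℝ} (hu : u ∈ polytope a)
    (h : ∀ i, 1 ≤ i → Facet.Gam i ∈ facetSet a u ∨ Facet.Del i ∈ facetSet a u) :
    facetSet a u ∈ Omega n (zeroSet a) := by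
  refine ⟨⟨fun h => ?_, fun h => ?_⟩, h, finite_gam ha u, fun i hi hiA => ?_, fun i hiA => ?_⟩
  · have := (gam_mem.1 h).1
    omega
  · have := (del_mem.1 h).1
    omega
  · by_cases hin : i ≤ n
    · rw [both_mem_of_le hu hi hin]
      constructor
      · rintro ⟨h1, -⟩
        exact absurd ⟨hi, hin, h1⟩ hiA
      · rintro ⟨h1, -⟩
        omega
    · rw [both_mem_of_gt hu (by omega), ← and_assoc, and_assoc]
      exact (and_iff_right (by omega)).symm
  · rw [both_mem_of_le hu hiA.1 hiA.2.1, and_iff_right hiA.2.2]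

/-! ### Selections of facets and the classification of vertices -/

/-- `y` selects a facet of `ω` for each index. -/
def Selects (y : Finset ℕ) (ω : Set Facet) : Prop :=
  0 ∉ y ∧ ∀ i, 1 ≤ i → (i ∈ y → Facet.Gam i ∈ ω) ∧ (i ∉ y → Facet.Del i ∈ ω)

lemma Selects.mono {y : Finset ℕ} {ω ω' : Set Facet} (h : Selects y ω) (hω : ω ⊆ ω') :
    Selects y ω' :=
  ⟨h.1, fun i hi => ⟨fun hy => hω ((h.2 i hi).1 hy), fun hy => hω ((h.2 i hi).2 hy)⟩⟩

lemma eq_of_selects {y : Finset ℕ} {u v : ℕ →₀ ℝ} (hu : u ∈ polytope a) (hv : v ∈ polytope a)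
    (hyu : Selects y (facetSet a u)) (hyv : Selects y (facetSet a v)) : u = v := by
  apply ext_psum (by rw [hu.1, hv.1])
  intro i
  have hpos := Nat.pos_of_ne_zero (NeZero.ne n)
  induction i using Nat.strong_induction_on with
  | _ i ih =>
    rcases Nat.eq_zero_or_pos i with rfl | hi
    · rw [psum_zero, psum_zero]
    · by_cases h : i ∈ y
      · rw [(gam_mem.1 ((hyu.2 i hi).1 h)).2, (gam_mem.1 ((hyv.2 i hi).1 h)).2,
          ih _ (by omega)]
      · rw [psum_eq_add hi, psum_eq_add hi, (del_mem.1 ((hyu.2 i hi).2 h)).2,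
          (del_mem.1 ((hyv.2 i hi).2 h)).2, ih _ (by omega)]

/-- The numbers `b_i` as integers. -/
def bnd (a : Fin n → ℕ) (i : ℕ) : ℤ := bound a i

/-- By induction: `0` and the solution of the `Γ_i`-equation are the ends of the interval allowed
for `x_i`, and the interval is nonempty since `psum (i - 1) ≤ b_{i-1} + psum (i - 1 - n) ≤ b_i +
psum (i - n)`. So every selection yields a point of `Π`. -/
lemma vert_constraints (hn : 2 ≤ n) (y : Finset ℕ) (i : ℕ) :
    0 ≤ vert n (bnd a) y i ∧
      (1 ≤ i → psum (vert n (bnd a) y) i ≤ bnd a i + psum (vert n (bnd a) y) (i - n)) := by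
  set u := vert n (bnd a) y with hu
  induction i using Nat.strong_induction_on with
  | _ i ih =>
    rcases Nat.eq_zero_or_pos i with rfl | hi
    · exact ⟨vert_zero.ge, fun h => absurd h (by omega)⟩
    have hb : bnd a (i - 1) ≤ bnd a i := by
      have := bound_le_succ (a := a) (i - 1)
      rw [Nat.sub_add_cancel hi] at this
      exact Int.ofNat_le.2 this
    have hprev : psum u (i - 1) ≤ bnd a i + psum u (i - n) := by
      rcases Nat.eq_zero_or_pos (i - 1) with h0 | h1
      · rw [h0, psum_zero, Nat.sub_eq_zero_of_le (by omega : i ≤ n), psum_zero, add_zero]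
        exact Int.natCast_nonneg _
      · have h2 := (ih (i - 1) (by omega)).2 h1
        have h3 : psum u (i - 1 - n) ≤ psum u (i - n) := by
          rcases Nat.eq_zero_or_pos (i - n) with h0 | h4
          · rw [h0, show i - 1 - n = 0 by omega]
          · rw [psum_eq_add h4, show i - n - 1 = i - 1 - n by omega]
            linarith [(ih (i - n) (by omega)).1]
        linarith
    by_cases hy : i ∈ y
    · have h1 := psum_vert (b := bnd a) hn hi hy
      rw [← hu] at h1
      refine ⟨?_, fun _ => h1.le⟩
      rw [psum_eq_add hi] at h1
      linarith
    · have h1 : u i = 0 := vert_notMem hy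
      refine ⟨h1.ge, fun _ => ?_⟩
      rw [psum_eq_add hi, h1, add_zero]
      exact hprev

lemma vert_mem_polytope (hn : 2 ≤ n) (y : Finset ℕ) : toReal (vert n (bnd a) y) ∈ polytope a := by
  rw [mem_polytope]
  refine ⟨by rw [toReal_apply, vert_zero, Int.cast_zero], fun i => ?_, fun i hi => ?_⟩
  · rw [toReal_apply]
    exact_mod_cast (vert_constraints hn y i).1
  · rw [psum_toReal, psum_toReal]
    exact_mod_cast (vert_constraints hn y i).2 hi

lemma selects_vert (hn : 2 ≤ n) {y : Finset ℕ} (hy : 0 ∉ y) :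
    Selects y (facetSet a (toReal (vert n (bnd a) y))) := by
  refine ⟨hy, fun i hi => ⟨fun h => ?_, fun h => ?_⟩⟩
  · rw [gam_mem, psum_toReal, psum_toReal]
    exact ⟨hi, by exact_mod_cast psum_vert (b := bnd a) hn hi h⟩
  · rw [del_mem, toReal_apply, vert_notMem h, Int.cast_zero]
    exact ⟨hi, rfl⟩

lemma Selects.gam_or_del {y : Finset ℕ} {ω : Set Facet} (h : Selects y ω) (i : ℕ) (hi : 1 ≤ i) :
    Facet.Gam i ∈ ω ∨ Facet.Del i ∈ ω := by
  by_cases hy : i ∈ y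
  · exact Or.inl ((h.2 i hi).1 hy)
  · exact Or.inr ((h.2 i hi).2 hy)

lemma exists_selects {ω : Set Facet} (h0 : Facet.Gam 0 ∉ ω)
    (h : ∀ i, 1 ≤ i → Facet.Gam i ∈ ω ∨ Facet.Del i ∈ ω)
    (hfin : {i | Facet.Gam i ∈ ω}.Finite) : ∃ y, Selects y ω := by
  refine ⟨hfin.toFinset, by simpa using h0, fun i hi => ⟨fun hy => by simpa using hy,
    fun hy => (h i hi).resolve_left (by simpa using hy)⟩⟩

/-- Given a maximal `u`, select `Γ_i` exactly where `u` lies on `Γ_i` but not on `Δ_i`. The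
resulting point `v` lies on all facets of `u`: where `u` lies on both, the recursive criteria
`both_mem_of_le` and `both_mem_of_gt` carry this over to `v`. By maximality `u` has a facet at every
index. Conversely, one facet per index determines the point. -/
lemma mem_vertices_iff (hn : 2 ≤ n) (ha : a ≠ 0) {u : ℕ →₀ ℝ} : u ∈ vertices a ↔
    u ∈ polytope a ∧ ∀ i, 1 ≤ i → Facet.Gam i ∈ facetSet a u ∨ Facet.Del i ∈ facetSet a u := by
  constructor
  · rintro ⟨hu, hmax⟩
    refine ⟨hu, ?_⟩
    have hfin : {i | Facet.Gam i ∈ facetSet a u ∧ Facet.Del i ∉ facetSet a u}.Finite :=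
      (finite_gam ha u).subset fun i hi => hi.1
    set y := hfin.toFinset with hy
    have hmem : ∀ i, i ∈ y ↔ Facet.Gam i ∈ facetSet a u ∧ Facet.Del i ∉ facetSet a u := fun i => by
      simp [hy]
    have h0 : 0 ∉ y := fun h => by
      have := (gam_mem.1 ((hmem 0).1 h).1).1
      omega
    have hv := vert_mem_polytope (a := a) hn y
    have hsel := selects_vert (a := a) hn h0
    set v := toReal (vert n (bnd a) y)
    have key : ∀ i, (Facet.Gam i ∈ facetSet a u → Facet.Gam i ∈ facetSet a v) ∧
        (Facet.Del i ∈ facetSet a u → Facet.Del i ∈ facetSet a v) := by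
      intro i
      induction i using Nat.strong_induction_on with
      | _ i ih =>
        rcases Nat.eq_zero_or_pos i with rfl | hi
        · refine ⟨fun h => ?_, fun h => ?_⟩
          · have := (gam_mem.1 h).1
            omega
          · have := (del_mem.1 h).1
            omega
        by_cases hiy : i ∈ y
        · exact ⟨fun _ => (hsel.2 i hi).1 hiy, fun h => absurd h ((hmem i).1 hiy).2⟩
        · refine ⟨fun h => ?_, fun _ => (hsel.2 i hi).2 hiy⟩
          have hd : Facet.Del i ∈ facetSet a u := by
            by_contra hd
            exact hiy ((hmem i).2 ⟨h, hd⟩)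
          by_cases hin : i ≤ n
          · have h1 := (both_mem_of_le hu hi hin).1 ⟨h, hd⟩
            exact ((both_mem_of_le hv hi hin).2
              ⟨h1.1, h1.2.imp_left (ih (i - 1) (by omega)).1⟩).1
          · have h1 := (both_mem_of_gt hu (by omega)).1 ⟨h, hd⟩
            exact ((both_mem_of_gt hv (by omega)).2
              ⟨(ih (i - 1) (by omega)).1 h1.1, (ih (i - n) (by omega)).2 h1.2⟩).1
    have hsub : facetSet a u ⊆ facetSet a v := by
      rintro (i | i) hf
      · exact (key i).1 hf
      · exact (key i).2 hf
    rw [← hmax v hv hsub]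
    exact hsel.gam_or_del
  · rintro ⟨hu, h⟩
    refine ⟨hu, fun v hv hsub => ?_⟩
    obtain ⟨y, hy⟩ := exists_selects
      (fun h => by have := (gam_mem.1 h).1; omega) h (finite_gam ha u)
    rw [eq_of_selects hu hv hy (hy.mono hsub)]

lemma vert_mem_vertices (hn : 2 ≤ n) (ha : a ≠ 0) {y : Finset ℕ} (hy : 0 ∉ y) :
    toReal (vert n (bnd a) y) ∈ vertices a :=
  (mem_vertices_iff hn ha).2 ⟨vert_mem_polytope hn y, (selects_vert hn hy).gam_or_del⟩

lemma facetSet_vert_mem (hn : 2 ≤ n) (ha : a ≠ 0) {y : Finset ℕ} (hy : 0 ∉ y) :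
    facetSet a (toReal (vert n (bnd a) y)) ∈ Omega n (zeroSet a) :=
  facetSet_mem_Omega ha (vert_mem_polytope hn y) (selects_vert hn hy).gam_or_del

lemma exists_selects_of_mem_Omega {n : ℕ} {A : Set ℕ} {ω : Set Facet} (h : ω ∈ Omega n A) :
    ∃ y, Selects y ω := exists_selects h.1.1 h.2.1 h.2.2.1

/-- Both sets contain the facets chosen by `y`, so only the indices carrying both facets matter.
Conditions (3) and (4) decide these from smaller indices, and enlarging `A` can only help: at an
index `i ∈ A \ A'`, where `i ≤ n`, the set `ω'` never contains both. -/
lemma subset_of_selects {A A' : Set ℕ} (hA : A' ⊆ A) (hAn : ∀ i ∈ A, 1 ≤ i ∧ i ≤ n)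
    {ω ω' : Set Facet} (hω : ω ∈ Omega n A) (hω' : ω' ∈ Omega n A') {y : Finset ℕ}
    (hy : Selects y ω) (hy' : Selects y ω') : ω' ⊆ ω := by
  have hpos := Nat.pos_of_ne_zero (NeZero.ne n)
  have key : ∀ i, (Facet.Gam i ∈ ω' → Facet.Gam i ∈ ω) ∧
      (Facet.Del i ∈ ω' → Facet.Del i ∈ ω) := by
    intro i
    induction i using Nat.strong_induction_on with
    | _ i ih =>
      rcases Nat.eq_zero_or_pos i with rfl | hi
      · exact ⟨fun h => absurd h hω'.1.1, fun h => absurd h hω'.1.2⟩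
      have hboth : Facet.Gam i ∈ ω' ∧ Facet.Del i ∈ ω' → Facet.Gam i ∈ ω ∧ Facet.Del i ∈ ω := by
        intro hb
        by_cases hiA : i ∈ A
        · by_cases hiA' : i ∈ A'
          · exact (hω.2.2.2.2 i hiA).2 (((hω'.2.2.2.2 i hiA').1 hb).imp_left
              (ih (i - 1) (by omega)).1)
          · have h1 := (hω'.2.2.2.1 i hi hiA').1 hb
            have h2 := hAn i hiA
            omega
        · have h1 := (hω'.2.2.2.1 i hi fun h => hiA (hA h)).1 hb
          exact (hω.2.2.2.1 i hi hiA).2 ⟨h1.1, (ih (i - 1) (by omega)).1 h1.2.1,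
            (ih (i - n) (by omega)).2 h1.2.2⟩
      refine ⟨fun h => ?_, fun h => ?_⟩
      · by_cases hiy : i ∈ y
        · exact (hy.2 i hi).1 hiy
        · exact (hboth ⟨h, (hy'.2 i hi).2 hiy⟩).1
      · by_cases hiy : i ∈ y
        · exact (hboth ⟨(hy'.2 i hi).1 hiy, h⟩).2
        · exact (hy.2 i hi).2 hiy
  rintro (i | i) hf
  · exact (key i).1 hf
  · exact (key i).2 hf

lemma eq_of_selects_Omega {A : Set ℕ} (hAn : ∀ i ∈ A, 1 ≤ i ∧ i ≤ n)
    {ω ω' : Set Facet} (hω : ω ∈ Omega n A) (hω' : ω' ∈ Omega n A) {y : Finset ℕ}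
    (hy : Selects y ω) (hy' : Selects y ω') : ω = ω' :=
  (subset_of_selects subset_rfl hAn hω' hω hy' hy).antisymm
    (subset_of_selects subset_rfl hAn hω hω' hy hy')

lemma mem_zeroSet_bounds : ∀ i ∈ zeroSet a, 1 ≤ i ∧ i ≤ n := fun _ h => ⟨h.1, h.2.1⟩

/-- A vertex is the solution of the equations of a selection of its facets. -/
lemma eq_vert_of_selects (hn : 2 ≤ n) {u : ℕ →₀ ℝ} (hu : u ∈ polytope a)
    {y : Finset ℕ} (hy : Selects y (facetSet a u)) : u = toReal (vert n (bnd a) y) :=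
  eq_of_selects hu (vert_mem_polytope hn y) hy (selects_vert hn hy.1)

theorem bijOn_facetSet (hn : 2 ≤ n) (ha : a ≠ 0) :
    Set.BijOn (facetSet a) (vertices a) (Omega n (zeroSet a)) := by
  refine ⟨fun u hu => ?_, fun u hu v hv huv => ?_, fun ω hω => ?_⟩
  · rw [mem_vertices_iff hn ha] at hu
    exact facetSet_mem_Omega ha hu.1 hu.2
  · have hu' := (mem_vertices_iff hn ha).1 hu
    obtain ⟨y, hy⟩ := exists_selects_of_mem_Omega (facetSet_mem_Omega ha hu'.1 hu'.2)
    exact eq_of_selects hu.1 hv.1 hy (huv ▸ hy)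
  · obtain ⟨y, hy⟩ := exists_selects_of_mem_Omega hω
    exact ⟨_, vert_mem_vertices hn ha hy.1, eq_of_selects_Omega mem_zeroSet_bounds
      (facetSet_vert_mem hn ha hy.1) hω (selects_vert hn hy.1) hy⟩

end vertices

/-! ### The characters `τ_ω` -/

section tau

variable {n : ℕ}

lemma finite_selects {ω : Set Facet} (h : {i | Facet.Gam i ∈ ω}.Finite) :
    {y | Selects y ω}.Finite := by
  refine (h.toFinset.powerset.finite_toSet).subset fun y hy => ?_
  rw [Finset.mem_coe, Finset.mem_powerset]
  intro i hi
  have hi0 : 1 ≤ i := Nat.pos_of_ne_zero fun h => hy.1 (h ▸ hi)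
  simpa using (hy.2 i hi0).1 hi

/-- The sum of the characters `F_y` over the selections `y` of facets of `ω`. -/
def tauChar (n : ℕ) (ω : Set Facet) : CharRing n := ∑ᶠ y ∈ {y | Selects y ω}, charF n y

lemma vert_zero_bound (hn : 2 ≤ n) (y : Finset ℕ) : vert n (fun _ => 0) y = 0 := by
  symm
  refine eq_vert hn rfl (fun j _ _ => ?_) fun j _ _ => rfl
  simp [psum]

lemma vertexSum_eq (hn : 2 ≤ n) {ω : Set Facet} (hfin : {i | Facet.Gam i ∈ ω}.Finite)
    (h : ∀ i, 1 ≤ i → Facet.Gam i ∈ ω ∨ Facet.Del i ∈ ω) {m : ℕ}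
    (hm : ∀ i, m < i → Facet.Gam i ∉ ω) :
    vertexSum n ω (fun _ => 0) m ∅ =
      ∑ y ∈ (finite_selects hfin).toFinset, partialF n y m := by
  classical
  have hI : (finite_selects hfin).toFinset =
      (Finset.Icc 1 m).powerset.filter fun y => Selects y ω := by
    ext y
    simp only [Set.Finite.mem_toFinset, Set.mem_ofPred_eq, Finset.mem_filter, Finset.mem_powerset]
    refine ⟨fun hy => ⟨fun i hi => ?_, hy⟩, fun hy => hy.2⟩
    have hi0 : 1 ≤ i := Nat.pos_of_ne_zero fun h => hy.1 (h ▸ hi)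
    refine Finset.mem_Icc.2 ⟨hi0, ?_⟩
    by_contra hmi
    exact hm i (by omega) ((hy.2 i hi0).1 hi)
  rw [hI, Finset.sum_filter, vertexSum]
  refine Finset.sum_congr rfl fun y hy => ?_
  rw [Finset.mem_powerset] at hy
  rw [Finset.union_empty, vert_zero_bound hn, expStar, starWeight_zero, expo_zero, one_mul,
    Finset.prod_mul_distrib, ← map_prod]
  split_ifs with hs
  · rw [Finset.prod_eq_one, map_one, one_mul, partialF]
    intro j hj
    have := hs.2 j (Finset.mem_Icc.1 hj).1
    rw [selInd]
    split_ifs with h1 h2 h3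
    · rfl
    · exact absurd (this.1 h1) h2
    · rfl
    · exact absurd (this.2 h1) h3
  · have : ∃ j ∈ Finset.Icc 1 m, selInd ω y j = 0 := by
      by_contra hcon
      push Not at hcon
      refine hs ⟨fun h0 => by have := Finset.mem_Icc.1 (hy h0); omega, fun i hi => ?_⟩
      by_cases him : i ≤ m
      · have := hcon i (Finset.mem_Icc.2 ⟨hi, him⟩)
        rw [selInd] at this
        split_ifs at this with h1 h2 h3
        · exact ⟨fun _ => h2, fun h => absurd h1 h⟩
        · exact absurd rfl this
        · exact ⟨fun h => absurd h h1, fun _ => h3⟩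
        · exact absurd rfl this
      · exact ⟨fun h => absurd (Finset.mem_Icc.1 (hy h)).2 him,
          fun _ => (h i hi).resolve_left (hm i (by omega))⟩
    obtain ⟨j, hj, hj0⟩ := this
    rw [Finset.prod_eq_zero hj hj0, map_zero, zero_mul]

lemma eventually_nonneg_add_mul {B A : ℝ} (hB : 0 ≤ B) (hA : B = 0 → 0 ≤ A) :
    ∀ᶠ t in nhdsWithin (0 : ℝ) (Set.Ioi 0), 0 ≤ B + t * A := by
  rcases hB.eq_or_lt with h | h
  · filter_upwards [self_mem_nhdsWithin] with t ht
    rw [← h, zero_add]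
    exact mul_nonneg (le_of_lt ht) (hA h.symm)
  · have hc : Tendsto (fun t : ℝ => B + t * A) (nhds 0) (nhds (B + 0 * A)) := by
      apply Continuous.tendsto
      fun_prop
    rw [zero_mul, add_zero] at hc
    filter_upwards [(hc.mono_left nhdsWithin_le_nhds).eventually (lt_mem_nhds h)] with t ht
    exact le_of_lt ht

/-! ### Vertex cones and the independence of `τ_ω` from the weight -/

variable [NeZero n] {a : Fin n → ℕ}

/-- The cone at `v` is cut out by the constraints tight at `v`: any displacement respecting them
stays in `Π` when scaled by a small `t > 0`. -/
lemma mem_coneSection_iff {v : ℕ →₀ ℤ} (hv : toReal v ∈ polytope a) {m : ℕ}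
    (hm : ∀ j, m < j → v j = 0) (hΓ : ∀ i, m < i → Facet.Gam i ∉ facetSet a (toReal v))
    (x : ℕ →₀ ℤ) : toReal x ∈ coneSection a (toReal v) m ↔
      x - v ∈ region n (facetSet a (toReal v)) (fun _ => 0) m m ∅ := by
  have hv' := mem_polytope.1 hv
  have hpos := Nat.pos_of_ne_zero (NeZero.ne n)
  constructor
  · rintro ⟨⟨w, hw, c, hc, hx⟩, hsupp⟩
    have hw' := mem_polytope.1 hw
    have hz : ∀ j, (((x - v) j : ℤ) : ℝ) = c * (w j - toReal v j) := fun j => by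
      have := DFunLike.congr_fun hx j
      simp only [toReal_apply, Finsupp.add_apply, Finsupp.smul_apply, Finsupp.sub_apply,
        smul_eq_mul] at this
      rw [Finsupp.sub_apply, Int.cast_sub, this, toReal_apply]
      ring
    have hp : ∀ j, ((psum (x - v) j : ℤ) : ℝ) = c * (psum w j - psum (toReal v) j) := fun j => by
      rw [psum, psum, psum, Int.cast_sum, ← Finset.sum_sub_distrib, Finset.mul_sum]
      exact Finset.sum_congr rfl fun l _ => hz l
    refine ⟨?_, fun j hj => ?_, fun j hj1 hjm => ⟨fun hΓj => ?_, fun hΔj => ?_⟩,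
      fun j hj1 hj2 => by omega⟩
    · have := hz 0
      rw [hw'.1, hv'.1, sub_zero, mul_zero] at this
      exact_mod_cast this
    · have := hsupp j hj
      rw [toReal_apply] at this
      rw [Finsupp.sub_apply, hm j hj, sub_zero]
      exact_mod_cast this
    · have h1 := (gam_mem.1 hΓj).2
      have h2 := hw'.2.2 j hj1
      have : ((psum (x - v) j : ℤ) : ℝ) ≤ ((psum (x - v) (j - n) : ℤ) : ℝ) := by
        rw [hp, hp]
        exact mul_le_mul_of_nonneg_left (by linarith) hc
      rw [zero_add]
      exact_mod_cast this
    · have h1 := (del_mem.1 hΔj).2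
      have : (0 : ℝ) ≤ (((x - v) j : ℤ) : ℝ) := by
        rw [hz, h1, sub_zero]
        exact mul_nonneg hc (hw'.2.1 j)
      exact_mod_cast this
  · rintro ⟨hz0, hzm, hzc, -⟩
    set z := x - v with hz
    have hxz : ∀ j, (x j : ℝ) = (v j : ℝ) + (z j : ℝ) := fun j => by
      rw [hz, Finsupp.sub_apply]; push_cast; ring
    -- For `j > m + n` the partial sums of the displacement at `j` and `j - n` coincide, so only
    -- finitely many conditions restrict `t`.
    have hev : ∀ᶠ t in nhdsWithin (0 : ℝ) (Set.Ioi 0), ∀ j ∈ Finset.range (m + n + 1),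
        0 ≤ toReal v j + t * (z j : ℝ) ∧ (1 ≤ j → 0 ≤ (bound a j + psum (toReal v) (j - n) -
          psum (toReal v) j) + t * ((psum z (j - n) - psum z j : ℤ) : ℝ)) := by
      refine (Filter.eventually_all_finset _).2 fun j _ => ?_
      refine Filter.Eventually.and (eventually_nonneg_add_mul (hv'.2.1 j) fun h0 => ?_) ?_
      · rcases Nat.eq_zero_or_pos j with rfl | hj
        · rw [hz0, Int.cast_zero]
        by_cases hjm : j ≤ m
        · exact_mod_cast (hzc j hj hjm).2 (del_mem.2 ⟨hj, h0⟩)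
        · rw [hzm j (by omega), Int.cast_zero]
      · by_cases hj : 1 ≤ j
        · have := eventually_nonneg_add_mul (sub_nonneg.2 (hv'.2.2 j hj))
            (A := ((psum z (j - n) - psum z j : ℤ) : ℝ)) fun h0 => by
              have hΓj : Facet.Gam j ∈ facetSet a (toReal v) :=
                gam_mem.2 ⟨hj, (sub_eq_zero.1 h0).symm⟩
              have hjm : j ≤ m := by
                by_contra h
                exact hΓ j (by omega) hΓj
              have := (hzc j hj hjm).1 hΓj
              rw [zero_add] at this
              exact_mod_cast sub_nonneg.2 this
          exact this.mono fun t ht _ => ht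
        · exact Eventually.of_forall fun t h => absurd h hj
    obtain ⟨t, ht, ht0⟩ := (hev.and self_mem_nhdsWithin).exists
    have ht0 : 0 < t := ht0
    have hw : toReal v + t • toReal z ∈ polytope a := by
      have hp : ∀ j, psum (toReal v + t • toReal z) j =
          psum (toReal v) j + t * ((psum z j : ℤ) : ℝ) := fun j => by
        rw [← psum_toReal, Finsupp.coe_add, psum_add]
        congr 1
        rw [psum, psum, Finset.mul_sum]
        rfl
      rw [mem_polytope]
      refine ⟨?_, fun j => ?_, fun j hj => ?_⟩
      · rw [Finsupp.add_apply, Finsupp.smul_apply, hv'.1, toReal_apply, hz0]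
        simp
      · by_cases hjm : j ≤ m
        · exact (ht j (Finset.mem_range.2 (by omega))).1
        · rw [Finsupp.add_apply, Finsupp.smul_apply, toReal_apply z, hzm j (by omega),
            Int.cast_zero, smul_zero, add_zero]
          exact hv'.2.1 j
      · rw [hp, hp]
        by_cases hjm : j < m + n + 1
        · have := (ht j (Finset.mem_range.2 hjm)).2 hj
          push_cast at this
          linarith
        · rw [psum_eq_of_support hzm (by omega : m ≤ j),
            psum_eq_of_support hzm (by omega : m ≤ j - n)]
          have := hv'.2.2 j hj
          linarith
    refine ⟨⟨_, hw, t⁻¹, inv_nonneg.2 ht0.le, ?_⟩, fun j hj => ?_⟩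
    · rw [add_sub_cancel_left, smul_smul, inv_mul_cancel₀ ht0.ne', one_smul]
      ext j
      rw [toReal_apply, hxz]
      rfl
    · rw [toReal_apply, hxz, hm j hj, hzm j hj]
      simp

/-- With the vertex moved to the origin the cone is a region with `b = 0`. All choices then share
the apex `0`, and those which are not selections of facets of `ω` have coefficient `0`
(`vertexSum_eq`). -/
lemma isSigmaStar_coneSection (hn : 2 ≤ n) (ha : a ≠ 0) {v : ℕ →₀ ℤ}
    (hv : toReal v ∈ vertices a) {m : ℕ} (hm : ∀ j, m < j → v j = 0)
    (hΓ : ∀ i, m < i → Facet.Gam i ∉ facetSet a (toReal v)) :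
    IsSigmaStar n (coneSection a (toReal v) m)
      (expStar n v * ∑ y ∈ (finite_selects (finite_gam ha (toReal v))).toFinset,
        partialF n y m) := by
  have hv' := (mem_vertices_iff hn ha).1 hv
  have hω := facetSet_mem_Omega ha hv'.1 hv'.2
  set ω := facetSet a (toReal v) with hωdef
  have h := isSig_region (n := n) (ω := ω) (b := fun _ => 0) (m := m) (i := m) (y := ∅) hn
    (fun i _ => hv'.2 (i + 1) (by omega)) (fun i him h1 h2 z hz => ?_) le_rfl (by simp)
  · rw [vertexSum_eq hn (finite_gam ha (toReal v)) hv'.2 hΓ] at h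
    have h2 := h.laurentMul (AddMonoidAlgebra.single v 1)
    rw [substStar_single] at h2
    have h3 : genFun (coneSection a (toReal v) m) =
        laurentMul (AddMonoidAlgebra.single v 1) (indFun (region n ω (fun _ => 0) m m ∅)) := by
      classical
      funext x
      rw [laurentMul_single, one_mul, indFun_apply, genFun, Set.indicator_apply]
      exact if_congr (mem_coneSection_iff hv'.1 hm hΓ x) rfl rfl
    change IsSig n _ _
    rw [h3]
    exact h2
  -- Where `ω` has both facets at `i + 1`, the point with coordinate `0` must satisfy the
  -- `Γ`-inequality. For `i > 0` this follows from `Γ_i ∈ ω`, combined with `Δ_{i+1-n} ∈ ω` when `i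
  -- + 1 ∉ A`; the case `i = 0` is trivial.
  · rw [zero_add]
    have hpsum : Facet.Gam i ∈ ω → psum z i ≤ psum z (i - n) := fun hg => by
      have hi : 1 ≤ i := (gam_mem.1 hg).1
      have := (hz i hi le_rfl).1 hg
      rwa [zero_add] at this
    by_cases hA : i + 1 ∈ zeroSet a
    · have hin : i + 1 ≤ n := hA.2.1
      rw [Nat.sub_eq_zero_of_le hin, psum_zero]
      rcases (hω.2.2.2.2 _ hA).1 ⟨h1, h2⟩ with h3 | h3
      · have := hpsum h3
        rwa [Nat.sub_eq_zero_of_le (by omega : i ≤ n), psum_zero] at this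
      · rw [show i = 0 by omega, psum_zero]
    · obtain ⟨h3, h4, h5⟩ := (hω.2.2.2.1 _ (by omega) hA).1 ⟨h1, h2⟩
      have h6 := hpsum h4
      have hpos := Nat.pos_of_ne_zero (NeZero.ne n)
      have h7 := (hz (i + 1 - n) (by omega) (by omega)).2 h5
      rw [psum_eq_add (by omega : 1 ≤ i + 1 - n), show i + 1 - n - 1 = i - n by omega]
      linarith

lemma isTauVertex_iff (hn : 2 ≤ n) (ha : a ≠ 0) {v : ℕ →₀ ℤ} (hv : toReal v ∈ vertices a)
    {t : CharRing n} : IsTauVertex a (toReal v) t ↔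
      t = expStar n v * tauChar n (facetSet a (toReal v)) := by
  have hfin := finite_gam ha (toReal v)
  set s : ℕ → CharRing n := fun m => expStar n v *
    ∑ y ∈ (finite_selects hfin).toFinset, partialF n y m with hs
  have h1 : ∀ᶠ m in atTop, IsSigmaStar n (coneSection a (toReal v) m) (s m) := by
    obtain ⟨M, hM⟩ := exists_bound hfin.toFinset
    filter_upwards [eventually_ge_atTop (max M (v.support.sup id))] with m hm
    refine isSigmaStar_coneSection hn ha hv (fun j hj => ?_) fun i hi h => ?_
    · by_contra h'
      have := Finset.le_sup (f := id) (Finsupp.mem_support_iff.2 h')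
      simp only [id] at this
      omega
    · exact hM i (by omega) (by simpa using h)
  have h2 : Stabilizes s (expStar n v * tauChar n (facetSet a (toReal v))) := by
    rw [tauChar, finsum_mem_eq_finite_toFinset_sum _ (finite_selects hfin)]
    exact (Stabilizes.sum fun y _ => stabilizes_charF hn y).expo_mul _
  constructor
  · rintro ⟨s', hs', ht⟩
    refine ht.unique (h2.congr ?_)
    filter_upwards [h1, hs'] with m h3 h4
    exact IsSig.unique h3 h4
  · rintro rfl
    exact ⟨s, h1, h2⟩

lemma ne_zero_of_zeroSet_eq {a' : Fin n → ℕ} (h : zeroSet a' = zeroSet a) (ha : a ≠ 0) :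
    a' ≠ 0 := by
  rintro rfl
  apply ha
  have hpos := Nat.pos_of_ne_zero (NeZero.ne n)
  have key : ∀ i, 1 ≤ i → i ≤ n → label a i = 0 := fun i h1 h2 => by
    have : i ∈ zeroSet (0 : Fin n → ℕ) := ⟨h1, h2, rfl⟩
    rw [h] at this
    exact this.2.2
  funext l
  rcases Nat.eq_zero_or_pos (l : ℕ) with h0 | h1
  · have := key n hpos le_rfl
    rw [label_add_self, label] at this
    refine Eq.trans (congrArg a ?_) this
    ext
    simp [h0]
  · have := key l h1 l.2.le
    rw [label] at this
    refine Eq.trans (congrArg a ?_) this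
    ext
    simp [Fin.ofNat, Nat.mod_eq_of_lt l.2]

lemma tau_eq (hn : 2 ≤ n) (ha : a ≠ 0) {ω : Set Facet} (hω : ω ∈ Omega n (zeroSet a)) :
    tau n (zeroSet a) ω = tauChar n ω := by
  have huniq : ∀ t, IsTau n (zeroSet a) ω t → t = tauChar n ω := by
    rintro t ⟨a', ha', u, hu, hf, s, hs, rfl⟩
    rw [isTauVertex_iff hn (ne_zero_of_zeroSet_eq ha' ha) hu] at hs
    rw [hs, hf, ← mul_assoc, ← expStar_add, neg_add_cancel, expStar, starWeight_zero, expo_zero,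
      one_mul]
  obtain ⟨y, hy⟩ := exists_selects_of_mem_Omega hω
  have hv := vert_mem_vertices hn ha hy.1
  have hf : facetSet a (toReal (vert n (bnd a) y)) = ω :=
    eq_of_selects_Omega mem_zeroSet_bounds (facetSet_vert_mem hn ha hy.1) hω
      (selects_vert hn hy.1) hy
  have hex : ∃ t, IsTau n (zeroSet a) ω t :=
    ⟨_, a, rfl, _, hv, hf, _, (isTauVertex_iff hn ha hv).2 rfl, rfl⟩
  rw [tau, dif_pos hex]
  exact huniq _ hex.choose_spec

lemma exists_isTauVertex (hn : 2 ≤ n) (ha : a ≠ 0) {u : ℕ →₀ ℝ} (hu : u ∈ vertices a) :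
    ∃ v : ℕ →₀ ℤ, toReal v = u ∧
      IsTauVertex a u (expStar n v * tau n (zeroSet a) (facetSet a u)) := by
  have hu' := (mem_vertices_iff hn ha).1 hu
  have hω := facetSet_mem_Omega ha hu'.1 hu'.2
  obtain ⟨y, hy⟩ := exists_selects_of_mem_Omega hω
  obtain rfl := eq_vert_of_selects hn hu'.1 hy
  exact ⟨_, rfl, (isTauVertex_iff hn ha hu).2 (by rw [tau_eq hn ha hω])⟩

lemma zeroSet_one : zeroSet (1 : Fin n → ℕ) = ∅ := by
  ext i
  simp [zeroSet, label]

/-- Every selection of facets determines an element of `Ω_A`. -/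
lemma exists_mem_Omega (hn : 2 ≤ n) (ha : a ≠ 0) {y : Finset ℕ} (hy : 0 ∉ y) :
    ∃ ω ∈ Omega n (zeroSet a), Selects y ω :=
  ⟨_, facetSet_vert_mem hn ha hy, selects_vert hn hy⟩

/-- The selections of `ω` are the disjoint union of the selections of those `ω' ∈ Ω_∅` contained in
it, so the formula regroups a finite sum. Fibres are finite because distinct `ω'` have distinct
selections. The weight with all labels `1` realizes `Ω_∅`. -/
theorem exists_degeneration (hn : 2 ≤ n) (ha : a ≠ 0) :
    ∃ φ : Omega n ∅ → Omega n (zeroSet a),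
      (∀ ω' ω, φ ω' = ω ↔ (ω' : Set Facet) ⊆ (ω : Set Facet)) ∧
      Function.Surjective φ ∧
      ∀ ω, {ω' | φ ω' = ω}.Finite ∧
        tau n (zeroSet a) (ω : Set Facet) =
          ∑ᶠ ω' ∈ {ω' | φ ω' = ω}, tau n ∅ (ω' : Set Facet) := by
  have hone : (1 : Fin n → ℕ) ≠ 0 := fun h => by
    have := congrFun h 0
    simp at this
  have hsub : ∀ {ω ω' : Set Facet}, ω ∈ Omega n (zeroSet a) → ω' ∈ Omega n ∅ →
      ∀ {y}, Selects y ω → Selects y ω' → ω' ⊆ ω := fun hω hω' _ hy hy' =>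
    subset_of_selects (Set.empty_subset _) mem_zeroSet_bounds hω hω' hy hy'
  have hex : ∀ {y : Finset ℕ}, 0 ∉ y → ∃ ω ∈ Omega n ∅, Selects y ω := fun hy => by
    have := exists_mem_Omega (n := n) hn hone hy
    rwa [zeroSet_one] at this
  have hφ : ∀ ω' : Omega n ∅, ∃ ω : Omega n (zeroSet a), (ω' : Set Facet) ⊆ ω := fun ω' => by
    obtain ⟨y, hy⟩ := exists_selects_of_mem_Omega ω'.2
    obtain ⟨ω, hω, hyω⟩ := exists_mem_Omega (a := a) hn ha hy.1
    exact ⟨⟨ω, hω⟩, hsub hω ω'.2 hyω hy⟩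
  choose φ hφ using hφ
  have hiff : ∀ ω' ω, φ ω' = ω ↔ (ω' : Set Facet) ⊆ (ω : Set Facet) := fun ω' ω => by
    refine ⟨fun h => h ▸ hφ ω', fun h => Subtype.ext ?_⟩
    obtain ⟨y, hy⟩ := exists_selects_of_mem_Omega ω'.2
    exact eq_of_selects_Omega mem_zeroSet_bounds (φ ω').2 ω.2 (hy.mono (hφ ω')) (hy.mono h)
  refine ⟨φ, hiff, fun ω => ?_, fun ω => ?_⟩
  · obtain ⟨y, hy⟩ := exists_selects_of_mem_Omega ω.2
    obtain ⟨ω', hω', hy'⟩ := hex hy.1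
    exact ⟨⟨ω', hω'⟩, (hiff _ _).2 (hsub ω.2 hω' hy hy')⟩
  · have hselfin : ∀ {A : Set ℕ} (ω : Omega n A), {y | Selects y (ω : Set Facet)}.Finite :=
      fun ω => finite_selects ω.2.2.2.1
    have hfin : {ω' | φ ω' = ω}.Finite := by
      choose! f hf using fun ω' : Omega n ∅ => exists_selects_of_mem_Omega ω'.2
      refine Set.Finite.of_finite_image (f := f) ((hselfin ω).subset ?_) ?_
      · rintro _ ⟨ω', hω', rfl⟩
        exact (hf ω').mono ((hiff _ _).1 hω')
      · intro ω₁ _ ω₂ _ h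
        exact Subtype.ext (eq_of_selects_Omega (by simp) ω₁.2 ω₂.2 (hf ω₁) (h ▸ hf ω₂))
    refine ⟨hfin, ?_⟩
    have hunion : {y | Selects y (ω : Set Facet)} =
        ⋃ ω' ∈ {ω' | φ ω' = ω}, {y | Selects y (ω' : Set Facet)} := by
      ext y
      simp only [Set.mem_ofPred_eq, Set.mem_iUnion, exists_prop]
      constructor
      · intro hy
        obtain ⟨ω', hω', hy'⟩ := hex hy.1
        exact ⟨⟨ω', hω'⟩, (hiff _ _).2 (hsub ω.2 hω' hy hy'), hy'⟩
      · rintro ⟨ω', hω', hy⟩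
        exact hy.mono ((hiff _ _).1 hω')
    have hdisj : {ω' | φ ω' = ω}.PairwiseDisjoint
        fun ω' : Omega n ∅ => {y | Selects y (ω' : Set Facet)} := by
      intro ω₁ _ ω₂ _ hne
      rw [Function.onFun, Set.disjoint_left]
      intro y h1 h2
      exact hne (Subtype.ext (eq_of_selects_Omega (by simp) ω₁.2 ω₂.2 h1 h2))
    rw [tau_eq hn ha ω.2, tauChar, hunion,
      finsum_mem_biUnion hdisj hfin fun ω' _ => hselfin ω']
    refine finsum_mem_congr rfl fun ω' _ => ?_
    have := tau_eq (a := (1 : Fin n → ℕ)) (ω := (ω' : Set Facet)) hn hone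
      (by rw [zeroSet_one]; exact ω'.2)
    rw [zeroSet_one] at this
    rw [this, tauChar]

end tau

/-! ### Cancellation of the contributions of bad sequences -/

section cancellation

variable {n : ℕ} {y y' : Finset ℕ} {i j r W : ℕ}

/-- The recursion for the partial sums along an edge, in terms of the children `j + 1`, `j + n`
of `j`. -/
lemma edge_eq (hn : 2 ≤ n) (hj : 1 ≤ j) :
    edge n y j = Finsupp.single j 1 - Finsupp.single (j + 1) 1 +
      (if j + 1 ∈ y then 0 else edge n y (j + 1)) +
      if j + n ∈ y then edge n y (j + n) else 0 := by
  -- The indicator of the subtree below `j` is that of `j` itself plus those of the subtrees below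
  -- its children. The indicator of `j` is the partial sum function of `e_j - e_{j+1}`.
  set S : ℕ → ℤ := fun l => (if l = j then 1 else 0) +
    (if j + 1 ∈ y then 0 else sol n y (Finsupp.single (j + 1) 1) l) +
    if j + n ∈ y then sol n y (Finsupp.single (j + n) 1) l else 0 with hS
  have key : ∀ l, S l = sol n y (Finsupp.single j 1) l := by
    refine eq_sol hn ?_ (fun l hl hy => ?_) (fun l hl hy => ?_)
    · simp [hS, sol_zero, show ¬ 0 = j by omega]
    · simp only [hS]
      rw [sol_mem hn hl hy, sol_mem hn hl hy]
      simp only [Finsupp.single_apply]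
      by_cases h1 : l = j + 1
      · subst h1
        simp only [hy]
        split_ifs <;> first | contradiction | omega
      · by_cases h2 : l = j + n
        · subst h2
          simp only [hy]
          split_ifs <;> first | contradiction | omega
        · split_ifs <;> first | contradiction | omega
    · simp only [hS]
      rw [sol_notMem hl hy, sol_notMem hl hy]
      simp only [Finsupp.single_apply]
      by_cases h1 : l = j + 1
      · subst h1
        simp only [hy]
        split_ifs <;> first | contradiction | omega
      · by_cases h2 : l = j + n
        · subst h2
          simp only [hy]
          split_ifs <;> first | contradiction | omega
        · split_ifs <;> first | contradiction | omega
  ext l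
  rw [edge, solSeq_apply, ← key, ← key]
  simp only [hS, Finsupp.add_apply, Finsupp.sub_apply, Finsupp.single_apply]
  rcases Nat.eq_zero_or_pos l with rfl | hl
  · have e1 : edge n y (j + 1) 0 = 0 := edge_of_lt hn (by omega)
    have e2 : edge n y (j + n) 0 = 0 := edge_of_lt hn (by omega)
    split_ifs <;> simp [e1, e2] <;> omega
  · have e0 : l - 1 = j ↔ j + 1 = l := by omega
    have e1 : edge n y (j + 1) l = sol n y (Finsupp.single (j + 1) 1) l -
      sol n y (Finsupp.single (j + 1) 1) (l - 1) := rfl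
    have e2 : edge n y (j + n) l = sol n y (Finsupp.single (j + n) 1) l -
      sol n y (Finsupp.single (j + n) 1) (l - 1) := rfl
    simp only [e0, eq_comm (a := l) (b := j)]
    split_ifs <;> simp only [e1, e2, Finsupp.zero_apply] <;> ring

lemma starWeight_single (i : ℕ) : starWeight n (Finsupp.single i 1) = gamma n i := by
  rw [starWeight, Finsupp.sum_single_index] <;> simp

lemma eta_eq (hn : 2 ≤ n) (hj : 1 ≤ j) :
    eta n y j = gamma n j - gamma n (j + 1) +
      (if j + 1 ∈ y then 0 else eta n y (j + 1)) + if j + n ∈ y then eta n y (j + n) else 0 := by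
  rw [eta, edge_eq hn hj, starWeight_add, starWeight_add, sub_eq_add_neg, starWeight_add,
    starWeight_neg, starWeight_single, starWeight_single, ← sub_eq_add_neg]
  congr 1
  · congr 1
    split_ifs
    · exact starWeight_zero n
    · rfl
  · split_ifs
    · rfl
    · exact starWeight_zero n

lemma eta_of_notMem (hn : 2 ≤ n) (hj : 1 ≤ j) (h1 : j + 1 ∉ y) (h2 : j + n ∉ y) :
    eta n y j = gamma n j - gamma n (j + 1) + eta n y (j + 1) := by
  rw [eta_eq hn hj, if_neg h1, if_neg h2, add_zero]

lemma eta_of_mem_of_notMem (hn : 2 ≤ n) (hj : 1 ≤ j) (h1 : j + 1 ∈ y) (h2 : j + n ∉ y) :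
    eta n y j = gamma n j - gamma n (j + 1) := by
  rw [eta_eq hn hj, if_pos h1, if_neg h2, add_zero, add_zero]

lemma eta_of_mem_of_mem (hn : 2 ≤ n) (hj : 1 ≤ j) (h1 : j + 1 ∈ y) (h2 : j + n ∈ y) :
    eta n y j = gamma n j - gamma n (j + 1) + eta n y (j + n) := by
  rw [eta_eq hn hj, if_pos h1, if_pos h2, add_zero]

/-! ### The index at which a bad sequence is changed -/

/-- The index `i + (n - 1)` belongs to `y`, which is good above `i`, and `r + 1` is the next element
of `y` after `i`. -/
structure Pre (n : ℕ) (y : Finset ℕ) (i r : ℕ) : Prop where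
  one_le : 1 ≤ i
  le : i ≤ r
  mem : r + 1 ∈ y
  notMem : ∀ j, i < j → j ≤ r → j ∉ y
  top_mem : i + (n - 1) ∈ y
  good : ∀ j, i < j → j ∉ y → j + (n - 1) ∉ y

lemma Pre.lt (hn : 2 ≤ n) (h : Pre n y i r) : r < i + (n - 1) := by
  by_contra h'
  exact h.notMem _ (by omega) (by omega) h.top_mem

lemma exists_pre (hn : 2 ≤ n) (h1 : 1 ≤ i) (htop : i + (n - 1) ∈ y)
    (hgood : ∀ j, i < j → j ∉ y → j + (n - 1) ∉ y) : ∃ r, Pre n y i r := by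
  classical
  have hex : ∃ r, i ≤ r ∧ r + 1 ∈ y := ⟨i + (n - 1) - 1, by omega, by
    rwa [Nat.sub_add_cancel (by omega)]⟩
  refine ⟨Nat.find hex, h1, (Nat.find_spec hex).1, (Nat.find_spec hex).2, fun j h2 h3 h4 => ?_,
    htop, hgood⟩
  exact Nat.find_min hex (m := j - 1) (by omega) ⟨by omega, by rwa [Nat.sub_add_cancel (by omega)]⟩

lemma Pre.unique {r' : ℕ} (h : Pre n y i r) (h' : Pre n y i r') : r = r' := by
  rcases lt_trichotomy r r' with h1 | h1 | h1
  · exact absurd h.mem (h'.notMem _ (by have := h.le; omega) h1)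
  · exact h1
  · exact absurd h'.mem (h.notMem _ (by have := h'.le; omega) h1)

/-- The index `W` at which a bad sequence `y` whose last bad index is `i` is to be changed. -/
inductive FlipAt (n : ℕ) (y : Finset ℕ) : ℕ → ℕ → Prop
  | base {i r : ℕ} (h : Pre n y i r) (hq : r + n + (n - 1) ∉ y) : FlipAt n y i (r + n)
  | step {i r W : ℕ} (h : Pre n y i r) (hq : r + n + (n - 1) ∈ y) (hr : FlipAt n y (r + n) W) :
      FlipAt n y i W

lemma FlipAt.lt (h : FlipAt n y i W) : i + n ≤ W := by
  induction h with
  | base h hq => have := h.le; omega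
  | step h hq hr ih => have := h.le; omega

lemma FlipAt.unique {W' : ℕ} (h : FlipAt n y i W) (h' : FlipAt n y i W') : W = W' := by
  induction h with
  | base h hq =>
    cases h' with
    | base h' hq' => rw [h.unique h']
    | step h' hq' hr' => rw [h.unique h'] at hq; exact absurd hq' hq
  | step h hq hr ih =>
    cases h' with
    | base h' hq' => rw [h.unique h'] at hq; exact absurd hq hq'
    | step h' hq' hr' => rw [h.unique h'] at ih; exact ih hr'

lemma exists_flipAt (hn : 2 ≤ n) (h1 : 1 ≤ i) (htop : i + (n - 1) ∈ y)
    (hgood : ∀ j, i < j → j ∉ y → j + (n - 1) ∉ y) : ∃ W, FlipAt n y i W := by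
  obtain ⟨M, hM⟩ := exists_bound y
  induction hk : M - i using Nat.strong_induction_on generalizing i with
  | _ k ih =>
    obtain ⟨r, hr⟩ := exists_pre hn h1 htop hgood
    by_cases hq : r + n + (n - 1) ∈ y
    · have hle := hr.le
      have hi : i < M := by
        by_contra hi
        exact hM _ (by omega) htop
      obtain ⟨W, hW⟩ := ih (M - (r + n)) (by omega) (i := r + n) (by omega) hq
        (fun j hj => hgood j (by omega)) rfl
      exact ⟨W, .step hr hq hW⟩
    · exact ⟨_, .base hr hq⟩


/-- The property is inherited by the sequence obtained from `y` by changing the index `W`. -/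
lemma FlipAt.exchange (hn : 2 ≤ n) (h : FlipAt n y i W) (hne : ∀ j, j ≠ W → (j ∈ y' ↔ j ∈ y)) :
    FlipAt n y' i W := by
  induction h with
  | @base i r h hq =>
    have hlt := h.lt hn
    have hle := h.le
    refine .base ⟨h.one_le, h.le, (hne _ (by omega)).2 h.mem, fun j h1 h2 => ?_,
      (hne _ (by omega)).2 h.top_mem, fun j h1 h2 => ?_⟩ ?_
    · rw [hne _ (by omega)]
      exact h.notMem j h1 h2
    -- The index `r + n` enters goodness above `i` only in the pairs `(r + n, r + n + (n - 1))` and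
    -- `(r + 1, r + n)`. The first is harmless by `hq`, the second because `r + 1` is chosen.
    · by_cases hj : j = r + n
      · subst hj
        rwa [hne _ (by omega)]
      · by_cases hj' : j = r + 1
        · subst hj'
          exact absurd ((hne _ (by omega)).2 h.mem) h2
        · rw [hne _ (by omega)]
          exact h.good j h1 fun h3 => h2 ((hne _ hj).2 h3)
    · rwa [hne _ (by omega)]
  | @step i r W h hq hr ih =>
    have hlt := h.lt hn
    have hle := h.le
    have hW := hr.lt
    have ih := ih hne
    have hgood' : ∀ j, r + n < j → j ∉ y' → j + (n - 1) ∉ y' := by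
      cases ih with
      | base h' => exact h'.good
      | step h' => exact h'.good
    refine .step ⟨h.one_le, h.le, (hne _ (by omega)).2 h.mem, fun j h1 h2 => ?_,
      (hne _ (by omega)).2 h.top_mem, fun j h1 h2 => ?_⟩ ((hne _ (by omega)).2 hq) ih
    · rw [hne _ (by omega)]
      exact h.notMem j h1 h2
    · by_cases hj : r + n < j
      · exact hgood' j hj h2
      · rw [hne _ (by omega)]
        exact h.good j h1 fun h3 => h2 ((hne _ (by omega)).2 h3)

/-- A solution of the facet equations for `y` above `i` solves both facet equations at `W`. -/
lemma FlipAt.solution (hn : 2 ≤ n) (h : FlipAt n y i W) {S : ℕ → ℤ} {k : ℤ}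
    (h1 : ∀ l, i < l → n ≤ l → l ∈ y → S l = k + S (l - n))
    (h2 : ∀ l, i < l → l ∉ y → S l = S (l - 1)) (h0 : S (i + (n - 1)) = k + S i) :
    S W = S (W - 1) ∧ S W = k + S (W - n) := by
  -- No index in `(i, r]` lies in `y`, and by goodness neither does its translate by `n - 1`. So `S`
  -- is constant on both stretches and the relation moves from `i` to `r`. It says that `Γ` and `Δ`
  -- prescribe the same value at `r + n`.
  have chain : ∀ {i r : ℕ}, Pre n y i r → (∀ l, i < l → l ∉ y → S l = S (l - 1)) →
      S (i + (n - 1)) = k + S i → S (r + n - 1) = k + S r := by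
    intro i r h h2 h0
    have c1 : ∀ d, i + d ≤ r → S (i + d) = S i ∧ S (i + d + (n - 1)) = S (i + (n - 1)) := by
      intro d
      induction d with
      | zero => exact fun _ => ⟨rfl, rfl⟩
      | succ d ih =>
        intro hd
        have h3 := h.notMem (i + (d + 1)) (by omega) (by omega)
        have h4 := h.good _ (by omega) h3
        rw [h2 _ (by omega) h3, h2 _ (by omega) h4,
          show i + (d + 1) - 1 = i + d by omega,
          show i + (d + 1) + (n - 1) - 1 = i + d + (n - 1) by omega]
        exact ih (by omega)
    have hle := h.le
    have := c1 (r - i) (by omega)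
    rw [show i + (r - i) = r by omega] at this
    rw [show r + n - 1 = r + (n - 1) by omega, this.1, this.2, h0]
  induction h with
  | @base i r h hq =>
    have := chain h h2 h0
    have hle := h.le
    rw [show r + n - n = r by omega, ← this]
    by_cases hr : r + n ∈ y
    · rw [h1 _ (by omega) (by omega) hr, this, show r + n - n = r by omega]
      exact ⟨rfl, rfl⟩
    · rw [h2 _ (by omega) hr]
      exact ⟨rfl, rfl⟩
  | @step i r W h hq hr ih =>
    have := chain h h2 h0
    have hle := h.le
    have hqy : r + n ∈ y := by
      by_contra h'
      exact h.good _ (by omega) h' hq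
    -- Both `r + n` and `r + n + (n - 1)` are governed by `Γ`, so the relation reappears with `r +
    -- n` in place of `i`.
    refine ih (fun l hl => h1 l (by omega)) (fun l hl => h2 l (by omega)) ?_
    rw [h1 _ (by omega) (by omega) hq, h1 _ (by omega) (by omega) hqy,
      show r + n + (n - 1) - n = r + n - 1 by omega, this, show r + n - n = r by omega]

end cancellation

/-! ### Edge weights before and after the change -/

section exchange

variable {n : ℕ} {y y' : Finset ℕ} {i j r W : ℕ}

lemma gamma_add_sub (hn : 2 ≤ n) (hi : 1 ≤ i) (hj : 1 ≤ j) :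
    gamma n (i + (n - 1)) - gamma n (j + (n - 1)) = gamma n i - gamma n j := by
  rw [gamma_add hn hi, gamma_add hn hj, add_sub_add_right_eq_sub]

/-- For each index in `[i, r)`, and for its translate by `n - 1`, the only child is the successor.
The weights thus change by differences of `γ`, which are invariant under this translation. -/
lemma Pre.eta_eq (hn : 2 ≤ n) (h : Pre n y i r) {d : ℕ} (hd : i + d ≤ r) :
    eta n y (r - d) = gamma n (r - d) - gamma n r + eta n y r ∧
      eta n y (r - d + (n - 1)) = gamma n (r - d) - gamma n r + eta n y (r + (n - 1)) := by
  have h1 := h.one_le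
  induction d with
  | zero => simp
  | succ d ih =>
    obtain ⟨ih1, ih2⟩ := ih (by omega)
    have h2 := h.notMem (r - d) (by omega) (by omega)
    have h3 := h.good _ (by omega) h2
    have h4 := h.good _ (by omega) h3
    have e : r - (d + 1) + 1 = r - d := by omega
    have hg := gamma_add_sub hn (i := r - (d + 1)) (j := r - d) (by omega) (by omega)
    constructor
    · rw [eta_of_notMem hn (by omega) (by rwa [e])
        (by rwa [show r - (d + 1) + n = r - d + (n - 1) by omega]), e, ih1]
      ring
    · have e' : r - (d + 1) + (n - 1) + 1 = r - d + (n - 1) := by omega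
      rw [eta_of_notMem hn (by omega) (by rwa [e'])
        (by rwa [show r - (d + 1) + (n - 1) + n = r - d + (n - 1) + (n - 1) by omega]), e', ih2]
      linear_combination hg

lemma Pre.eta_eq' (hn : 2 ≤ n) (h : Pre n y i r) (h1 : i ≤ j) (h2 : j ≤ r) :
    eta n y j = gamma n j - gamma n r + eta n y r ∧
      eta n y (j + (n - 1)) = gamma n j - gamma n r + eta n y (r + (n - 1)) := by
  have := h.eta_eq hn (d := r - j) (by omega)
  rwa [show r - (r - j) = j by omega] at this

/-- Goodness excludes elements of `y` strictly between `i + (n - 1)` and `r + n`: they would be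
translates of indices in `(i, r]`. -/
lemma Pre.sum_eq (hn : 2 ≤ n) (h : Pre n y i r) {M : Type*} [AddCommMonoid M] (f : ℕ → M) :
    ∑ j ∈ y with i < j, f j = ∑ j ∈ y with i < j ∧ j < i + (n - 1), f j +
      (f (i + (n - 1)) + ∑ j ∈ y with r + n ≤ j, f j) := by
  have hT : f (i + (n - 1)) = ∑ j ∈ y, if j = i + (n - 1) then f j else 0 := by
    rw [Finset.sum_ite_eq', if_pos h.top_mem]
  rw [hT, Finset.sum_filter, Finset.sum_filter, Finset.sum_filter, ← Finset.sum_add_distrib,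
    ← Finset.sum_add_distrib]
  refine Finset.sum_congr rfl fun j hj => ?_
  have hlt := h.lt hn
  have hle := h.le
  have h1 : i + (n - 1) < j → r + n ≤ j := fun h2 => by
    by_contra h3
    refine h.good (j - (n - 1)) (by omega) (h.notMem _ (by omega) (by omega)) ?_
    rwa [Nat.sub_add_cancel (by omega)]
  rcases lt_trichotomy j (i + (n - 1)) with h2 | h2 | h2
  · rw [if_neg (show ¬ j = i + (n - 1) by omega), if_neg (show ¬ r + n ≤ j by omega), add_zero,
      add_zero]
    simp only [h2, and_true]
  · rw [if_pos (show i < j by omega), if_neg (show ¬ (i < j ∧ j < i + (n - 1)) by omega),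
      if_pos h2, if_neg (show ¬ r + n ≤ j by omega), add_zero, zero_add]
  · rw [if_pos (show i < j by omega), if_neg (show ¬ (i < j ∧ j < i + (n - 1)) by omega),
      if_neg (show ¬ j = i + (n - 1) by omega), if_pos (h1 h2), zero_add, zero_add]

lemma sum_filter_le {M : Type*} [AddCommMonoid M] (z : Finset ℕ) (f : ℕ → M) (q : ℕ) :
    ∑ j ∈ z with q ≤ j, f j = (if q ∈ z then f q else 0) + ∑ j ∈ z with q < j, f j := by
  rw [Finset.sum_filter, Finset.sum_filter, ← Finset.sum_ite_eq' z q f, ← Finset.sum_add_distrib]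
  refine Finset.sum_congr rfl fun j _ => ?_
  rcases lt_trichotomy q j with h | h | h
  · rw [if_pos h.le, if_neg (show ¬ j = q by omega), if_pos h, zero_add]
  · rw [if_pos h.le, if_pos h.symm, if_neg (show ¬ q < j by omega), add_zero]
  · rw [if_neg (show ¬ q ≤ j by omega), if_neg (show ¬ j = q by omega),
      if_neg (show ¬ q < j by omega), add_zero]

/-- The relations between the weights of the edge directions for two sequences differing at the
index `W`. -/
structure EtaExchange (n : ℕ) (y y' : Finset ℕ) (i W : ℕ) : Prop where
  fst : eta n y' i = eta n y (i + (n - 1))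
  snd : eta n y i = eta n y' (i + (n - 1))
  mid : ∀ r, Pre n y i r → ∀ j, r < j → j < i + (n - 1) → eta n y' j = eta n y j
  prod : ∀ (g : (Fin n → ℤ) → CharRing n) N, W < N →
    ∏ j ∈ Finset.Ico i N, g (eta n y' j) = ∏ j ∈ Finset.Ico i N, g (eta n y j)
  sum : ∑ j ∈ y' with i < j, eta n y' j = ∑ j ∈ y with i < j, eta n y j

/-- An exchange of the weights at `r` and `r + (n - 1)` propagates down both chains to `i` and `i +
(n - 1)`, while downward induction shows that the weights strictly between `r` and `i + (n - 1)` do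
not change. -/
lemma EtaExchange.of_pre (hn : 2 ≤ n) (h : Pre n y i r) (h' : Pre n y' i r) (hW : r + n ≤ W)
    (hne : ∀ j, j < r + n + (n - 1) → j ≠ r + n → (j ∈ y' ↔ j ∈ y))
    (fst : eta n y' r = eta n y (r + (n - 1))) (snd : eta n y r = eta n y' (r + (n - 1)))
    (mid : ∀ j ∈ y, r + n < j → j < r + n + (n - 1) → eta n y' j = eta n y j)
    (prod : ∀ (g : (Fin n → ℤ) → CharRing n) N, W < N →
      ∏ j ∈ Finset.Ico (r + n) N, g (eta n y' j) = ∏ j ∈ Finset.Ico (r + n) N, g (eta n y j))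
    (sum : eta n y' (r + (n - 1)) + ∑ j ∈ y' with r + n ≤ j, eta n y' j =
      eta n y (r + (n - 1)) + ∑ j ∈ y with r + n ≤ j, eta n y j) : EtaExchange n y y' i W := by
  have hlt := h.lt hn
  have hle := h.le
  have h1 := h.one_le
  have hfst : ∀ j, i ≤ j → j ≤ r → eta n y' j = eta n y (j + (n - 1)) := fun j h2 h3 => by
    rw [(h'.eta_eq' hn h2 h3).1, (h.eta_eq' hn h2 h3).2, fst]
  have hsnd : ∀ j, i ≤ j → j ≤ r → eta n y j = eta n y' (j + (n - 1)) := fun j h2 h3 => by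
    rw [(h.eta_eq' hn h2 h3).1, (h'.eta_eq' hn h2 h3).2, snd]
  have hmid : ∀ d, d < i + (n - 1) → r < i + (n - 1) - 1 - d →
      eta n y' (i + (n - 1) - 1 - d) = eta n y (i + (n - 1) - 1 - d) := by
    intro d
    induction d with
    | zero =>
      intro _ h3
      have e : i + (n - 1) - 1 - 0 + 1 = i + (n - 1) := by omega
      rw [FSChar.eta_eq hn (by omega), FSChar.eta_eq hn (y := y) (by omega), e, if_pos h'.top_mem,
        if_pos h.top_mem, ]
      simp only [hne (i + (n - 1) - 1 - 0 + n) (by omega) (by omega)]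
      split_ifs with h4
      · rw [mid _ h4 (by omega) (by omega)]
      · rfl
    | succ d ih =>
      intro h2 h3
      have ih := ih (by omega) (by omega)
      have e : i + (n - 1) - 1 - (d + 1) + 1 = i + (n - 1) - 1 - d := by omega
      rw [FSChar.eta_eq hn (by omega), FSChar.eta_eq hn (y := y) (by omega), e, ih]
      simp only [hne (i + (n - 1) - 1 - (d + 1) + n) (by omega) (by omega),
        hne (i + (n - 1) - 1 - d) (by omega) (by omega)]
      split_ifs with h4 h5 h5
      · rw [mid _ h5 (by omega) (by omega)]
      · rfl
      · rw [mid _ h5 (by omega) (by omega)]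
      · rfl
  have hmid' : ∀ j, r < j → j < i + (n - 1) → eta n y' j = eta n y j := fun j h2 h3 => by
    have := hmid (i + (n - 1) - 1 - j) (by omega)
    rw [show i + (n - 1) - 1 - (i + (n - 1) - 1 - j) = j by omega] at this
    exact this h2
  refine ⟨hfst i le_rfl hle, hsnd i le_rfl hle, fun r' hr' => ?_, fun g N hN => ?_, ?_⟩
  · rw [← h.unique hr']
    exact hmid'
  -- The range splits into `[i, r]`, its translate by `n - 1`, the gap between them, and the tail.
  -- The change swaps the first two factors.
  · have split : ∀ F : ℕ → CharRing n, ∏ j ∈ Finset.Ico i N, F j =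
        ((∏ j ∈ Finset.Ico i (r + 1), F j) * ∏ j ∈ Finset.Ico i (r + 1), F (j + (n - 1))) *
          (∏ j ∈ Finset.Ico (r + 1) (i + (n - 1)), F j) * ∏ j ∈ Finset.Ico (r + n) N, F j := by
      intro F
      rw [← Finset.prod_Ico_consecutive F (show i ≤ r + n by omega) (show r + n ≤ N by omega),
        ← Finset.prod_Ico_consecutive F (show i ≤ r + 1 by omega) (show r + 1 ≤ r + n by omega),
        ← Finset.prod_Ico_consecutive F (show r + 1 ≤ i + (n - 1) by omega)
          (show i + (n - 1) ≤ r + n by omega),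
        Finset.prod_Ico_add' F i (r + 1) (n - 1), show r + 1 + (n - 1) = r + n by omega]
      ring
    rw [split, split, prod g N hN]
    congr 2
    · rw [mul_comm]
      congr 1
      · refine Finset.prod_congr rfl fun j hj => ?_
        rw [Finset.mem_Ico] at hj
        rw [hsnd j hj.1 (by omega)]
      · refine Finset.prod_congr rfl fun j hj => ?_
        rw [Finset.mem_Ico] at hj
        rw [hfst j hj.1 (by omega)]
    · refine Finset.prod_congr rfl fun j hj => ?_
      rw [Finset.mem_Ico] at hj
      rw [hmid' j (by omega) hj.2]
  · rw [h.sum_eq hn, h'.sum_eq hn, (h.eta_eq' hn le_rfl hle).2, (h'.eta_eq' hn le_rfl hle).2,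
      add_assoc _ _ (Finset.sum _ _), add_assoc _ _ (Finset.sum _ _), sum]
    congr 1
    refine Finset.sum_congr (Finset.ext fun j => ?_) fun j hj => ?_
    · simp only [Finset.mem_filter]
      exact and_congr_left fun h2 => hne j (by omega) (by omega)
    · rw [Finset.mem_filter] at hj
      refine hmid' j ?_ hj.2.2
      by_contra h2
      exact h.notMem j hj.2.1 (by omega) hj.1

lemma FlipAt.pre_exchange (hn : 2 ≤ n) (h : FlipAt n y i W) (hne : ∀ j, j ≠ W → (j ∈ y' ↔ j ∈ y))
    (hr : Pre n y i r) : Pre n y' i r := by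
  obtain ⟨r', h'⟩ : ∃ r', Pre n y' i r' := by
    cases h.exchange hn hne with
    | base h' => exact ⟨_, h'⟩
    | step h' => exact ⟨_, h'⟩
  have hW := h.lt
  have h1 := hr.lt hn
  have h2 := h'.lt hn
  have h3 := hr.le
  have h4 := h'.le
  rcases lt_trichotomy r r' with h5 | rfl | h5
  · exact absurd ((hne _ (by omega)).2 hr.mem) (h'.notMem _ (by omega) (by omega))
  · exact h'
  · exact absurd ((hne _ (by omega)).1 h'.mem) (hr.notMem _ (by omega) (by omega))

/-- The weights of the edge directions of the sequences `y`, `y'` differing at `W` are the same, up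
to order. -/
theorem FlipAt.etaExchange (hn : 2 ≤ n) (h : FlipAt n y i W)
    (hne : ∀ j, j ≠ W → (j ∈ y' ↔ j ∈ y)) (hW : W ∈ y' ↔ W ∉ y) : EtaExchange n y y' i W := by
  induction h with
  | @base i r h hq =>
    have h' : Pre n y' i r := (FlipAt.base h hq).pre_exchange hn hne h
    have hle := h.le
    have h1 := h.one_le
    have heta : ∀ j, r + n ≤ j → eta n y' j = eta n y j := fun j hj =>
      eta_congr hn (by omega) fun l hl => hne l (by omega)
    have hq' : r + n + (n - 1) ∉ y' := by rwa [hne _ (by omega)]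
    have hg := gamma_add_sub hn (i := r) (j := r + 1) (by omega) (by omega)
    have e1 : r + (n - 1) + 1 = r + n := by omega
    have e2 : r + (n - 1) + n = r + n + (n - 1) := by omega
    have e3 : r + 1 + (n - 1) = r + n := by omega
    rw [e3] at hg
    -- The subtree below `r + n` hangs from `r` if `r + n ∈ z` and from `r + (n - 1)` otherwise, and
    -- neither of these two has another child. Changing the membership of `r + n` moves the subtree
    -- across.
    have key : ∀ {z : Finset ℕ}, r + 1 ∈ z → r + n + (n - 1) ∉ z →
        (r + n ∈ z → eta n z r = gamma n r - gamma n (r + 1) + eta n z (r + n) ∧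
          eta n z (r + (n - 1)) = gamma n r - gamma n (r + 1)) ∧
        (r + n ∉ z → eta n z r = gamma n r - gamma n (r + 1) ∧
          eta n z (r + (n - 1)) = gamma n r - gamma n (r + 1) + eta n z (r + n)) := by
      intro z hz1 hz2
      refine ⟨fun hz => ⟨eta_of_mem_of_mem hn (by omega) hz1 hz, ?_⟩,
        fun hz => ⟨eta_of_mem_of_notMem hn (by omega) hz1 hz, ?_⟩⟩
      · rw [eta_of_mem_of_notMem hn (by omega) (by rwa [e1]) (by rwa [e2]), e1, hg]
      · rw [eta_of_notMem hn (by omega) (by rwa [e1]) (by rwa [e2]), e1, hg]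
    have k := key h.mem hq
    have k' := key h'.mem hq'
    have htail : ∑ j ∈ y' with r + n < j, eta n y' j = ∑ j ∈ y with r + n < j, eta n y j := by
      refine Finset.sum_congr (Finset.ext fun j => ?_) fun j hj => ?_
      · simp only [Finset.mem_filter]
        exact and_congr_left fun h3 => hne j (by omega)
      · rw [Finset.mem_filter] at hj
        exact heta j hj.2.le
    refine .of_pre hn h h' le_rfl (fun j _ => hne j) ?_ ?_ (fun j _ hj _ => heta j hj.le)
      (fun g N _ => Finset.prod_congr rfl fun j hj => by
        rw [heta j (Finset.mem_Ico.1 hj).1]) ?_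
    · by_cases hy : r + n ∈ y
      · rw [(k'.2 fun h3 => hW.1 h3 hy).1, (k.1 hy).2]
      · rw [(k'.1 (hW.2 hy)).1, (k.2 hy).2, heta _ le_rfl]
    · by_cases hy : r + n ∈ y
      · rw [(k'.2 fun h3 => hW.1 h3 hy).2, (k.1 hy).1, heta _ le_rfl]
      · rw [(k'.1 (hW.2 hy)).2, (k.2 hy).1]
    -- The weight at `r + n` is counted either as a summand of its own or inside the weight at `r +
    -- (n - 1)`, so the total is unaffected.
    · rw [sum_filter_le, sum_filter_le, htail]
      by_cases hy : r + n ∈ y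
      · have hy' : r + n ∉ y' := fun h3 => hW.1 h3 hy
        rw [(k'.2 hy').2, (k.1 hy).2, if_pos hy, if_neg hy', heta _ le_rfl]
        ring
      · rw [(k'.1 (hW.2 hy)).2, (k.2 hy).2, if_neg hy, if_pos (hW.2 hy), heta _ le_rfl]
        ring
  | @step i r W h hq hr ih =>
    have h' : Pre n y' i r := (FlipAt.step h hq hr).pre_exchange hn hne h
    have ih := ih hne hW
    have hle := h.le
    have h1 := h.one_le
    have hlt := hr.lt
    obtain ⟨r', hr'⟩ : ∃ r', Pre n y (r + n) r' := by
      cases hr with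
      | base h' => exact ⟨_, h'⟩
      | step h' => exact ⟨_, h'⟩
    have hqy : r + n ∈ y := by
      by_contra h3
      exact h.good _ (by omega) h3 hq
    have hqy' : r + n ∈ y' := (hne _ (by omega)).2 hqy
    have hq' : r + n + (n - 1) ∈ y' := (hne _ (by omega)).2 hq
    have hg := gamma_add_sub hn (i := r) (j := r + 1) (by omega) (by omega)
    have e1 : r + (n - 1) + 1 = r + n := by omega
    have e2 : r + (n - 1) + n = r + n + (n - 1) := by omega
    have e3 : r + 1 + (n - 1) = r + n := by omega
    rw [e3] at hg
    -- Here the only child of `r` is `r + n` and that of `r + (n - 1)` is `r + n + (n - 1)`, so the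
    -- exchange of the children's weights passes to the parents.
    have key : ∀ {z : Finset ℕ}, r + 1 ∈ z → r + n ∈ z → r + n + (n - 1) ∈ z →
        eta n z r = gamma n r - gamma n (r + 1) + eta n z (r + n) ∧
          eta n z (r + (n - 1)) =
            gamma n r - gamma n (r + 1) + eta n z (r + n + (n - 1)) := by
      intro z hz1 hz2 hz3
      refine ⟨eta_of_mem_of_mem hn (by omega) hz1 hz2, ?_⟩
      rw [eta_of_mem_of_mem hn (by omega) (by rwa [e1]) (by rwa [e2]), e1, e2, hg]
    have k := key h.mem hqy hq
    have k' := key h'.mem hqy' hq'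
    refine .of_pre hn h h' (by omega) (fun j hj _ => hne j (by omega)) ?_ ?_ ?_ ih.prod ?_
    · rw [k'.1, k.2, ih.fst]
    · rw [k'.2, k.1, ih.snd]
    · intro j hj h2 h3
      refine ih.mid r' hr' j ?_ h3
      by_contra h4
      exact hr'.notMem j h2 (by omega) hj
    · rw [sum_filter_le, sum_filter_le, ih.sum, k'.2, k.2, if_pos hqy, if_pos hqy', ← ih.snd,
        ih.fst]
      ring

end exchange

/-! ### The sign-reversing involution on bad sequences -/

section flip

variable {n : ℕ} {y y' : Finset ℕ} {i j W : ℕ}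

/-- In this form `y` enters only through the parity of its size, the sum of its edge weights and the
multiset of all edge weights up to `N`. -/
lemma partialF_eq (N : ℕ) (hn : 2 ≤ n) (hy : y ⊆ Finset.Icc 1 N) :
    partialF n y N = (-1) ^ y.card * expo (∑ j ∈ y, eta n y j) *
      ∏ j ∈ Finset.Icc 1 N, geom (eta n y j) := by
  have h1 : ∀ j ∈ Finset.Icc 1 N, geom (epsWt n y j) =
      (if j ∈ y then -1 * expo (eta n y j) else 1) * geom (eta n y j) := fun j hj => by
    rw [epsWt]
    split_ifs
    · rw [(eta_definite hn (Finset.mem_Icc.1 hj).1).geom_neg]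
      ring
    · rw [one_mul]
  have h2 : ∏ j ∈ y, (expo (eta n y j) : CharRing n) = expo (∑ j ∈ y, eta n y j) := by
    generalize eta n y = f
    clear hy h1
    induction y using Finset.cons_induction with
    | empty => rw [Finset.prod_empty, Finset.sum_empty, expo_zero]
    | cons a s ha ih => rw [Finset.prod_cons, Finset.sum_cons, ih, expo_add]
  rw [partialF, Finset.prod_congr rfl h1, Finset.prod_mul_distrib, Finset.prod_ite_mem,
    Finset.inter_eq_right.2 hy, Finset.prod_mul_distrib, Finset.prod_const, h2]

/-- The sequence `y` is bad, and is to be changed at the index `W`. -/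
def IsFlip (n : ℕ) (y : Finset ℕ) (W : ℕ) : Prop := ∃ i, 1 ≤ i ∧ i ∉ y ∧ FlipAt n y i W

lemma FlipAt.exists_pre (h : FlipAt n y i W) : ∃ r, Pre n y i r := by
  cases h with
  | base h => exact ⟨_, h⟩
  | step h => exact ⟨_, h⟩

/-- The index `i` is forced to be the last bad one: a larger bad index would contradict goodness
above `i`. -/
lemma IsFlip.unique {W' : ℕ} (h : IsFlip n y W) (h' : IsFlip n y W') : W = W' := by
  obtain ⟨i, _, hi, h⟩ := h
  obtain ⟨i', _, hi', h'⟩ := h'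
  obtain ⟨r, hr⟩ := h.exists_pre
  obtain ⟨r', hr'⟩ := h'.exists_pre
  rcases lt_trichotomy i i' with h3 | rfl | h3
  · exact absurd hr'.top_mem (hr.good _ h3 hi')
  · exact h.unique h'
  · exact absurd hr.top_mem (hr'.good _ h3 hi)

lemma IsFlip.exchange (hn : 2 ≤ n) (h : IsFlip n y W) (hne : ∀ j, j ≠ W → (j ∈ y' ↔ j ∈ y)) :
    IsFlip n y' W := by
  obtain ⟨i, h1, hi, h⟩ := h
  have := h.lt
  exact ⟨i, h1, by rwa [hne _ (by omega)], h.exchange hn hne⟩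

lemma IsFlip.lt (h : IsFlip n y W) : n < W := by
  obtain ⟨i, h1, hi, h⟩ := h
  have := h.lt
  omega

lemma IsFlip.notMem_goodSeqs (hn : 2 ≤ n) (h : IsFlip n y W) : y ∉ goodSeqs n := by
  obtain ⟨i, h1, hi, h⟩ := h
  obtain ⟨r, hr⟩ := h.exists_pre
  intro hy
  refine hy.2 i h1 hi ?_
  rw [show i + n - 1 = i + (n - 1) by omega]
  exact hr.top_mem

lemma exists_isFlip (hn : 2 ≤ n) (h0 : 0 ∉ y) (hy : y ∉ goodSeqs n) : ∃ W, IsFlip n y W := by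
  classical
  obtain ⟨M, hM⟩ := exists_bound y
  set B := {i ∈ Finset.range (M + 1) | 1 ≤ i ∧ i ∉ y ∧ i + (n - 1) ∈ y} with hB
  have hmem : ∀ i, 1 ≤ i → i ∉ y → i + (n - 1) ∈ y → i ∈ B := fun i h1 h2 h3 => by
    refine Finset.mem_filter.2 ⟨Finset.mem_range.2 ?_, h1, h2, h3⟩
    by_contra h4
    exact hM _ (by omega) h3
  have hne : B.Nonempty := by
    by_contra h
    rw [Finset.not_nonempty_iff_eq_empty] at h
    refine hy ⟨h0, fun i h1 h2 h3 => ?_⟩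
    have := hmem i h1 h2 (by rwa [show i + (n - 1) = i + n - 1 by omega])
    rw [h] at this
    exact absurd this (Finset.notMem_empty _)
  have hmax := Finset.mem_filter.1 (B.max'_mem hne)
  obtain ⟨W, hW⟩ := exists_flipAt hn hmax.2.1 hmax.2.2.2 fun j hj h2 h3 => by
    have := B.le_max' j (hmem j (by omega) h2 h3)
    omega
  exact ⟨W, _, hmax.2.1, hmax.2.2.1, hW⟩

/-- Since `i ∉ y` and `i + (n - 1) ∈ y`, the partial sums of the edge agree at `i + (n - 1)`, `i -
1` and `i`. By `FlipAt.solution` with `k = 0` the edge satisfies both equations at `W`, so it is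
also an edge for `y'`. -/
lemma FlipAt.eta_of_lt (hn : 2 ≤ n) (h : FlipAt n y i W) (hi : i ∉ y)
    (hne : ∀ j, j ≠ W → (j ∈ y' ↔ j ∈ y)) (h1 : 1 ≤ j) (hj : j < i) : eta n y' j = eta n y j := by
  obtain ⟨r, hr⟩ := h.exists_pre
  have hW := h.lt
  have hsol := h.solution hn (S := sol n y (Finsupp.single j 1)) (k := 0)
    (fun l hl _ hly => by rw [edge_sol_mem hn (by omega) hly, zero_add])
    (fun l hl hly => edge_sol_notMem (by omega) hly) (by
      rw [edge_sol_mem hn (by omega) hr.top_mem, edge_sol_notMem hj hi, zero_add]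
      congr 1
      omega)
  rw [eta, eta, eq_edge (y := y') hn h1 (x := edge n y j) (fun l hl => edge_of_lt hn hl)
    (edge_self hn h1) (fun l hl hly => ?_) fun l hl hly => ?_]
  · by_cases hlW : l = W
    · rw [hlW, psum_edge, psum_edge, hsol.2, zero_add]
    · rw [psum_edge, psum_edge, edge_sol_mem hn hl ((hne l hlW).1 hly)]
  · by_cases hlW : l = W
    · rw [hlW, edge, solSeq_apply, hsol.1, sub_self]
    · exact edge_notMem hl fun h3 => hly ((hne l hlW).2 h3)

/-- The inhomogeneous version of the argument for edges: all `Γ`-equations involved have index at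
least `n`, hence the same right-hand side `k`, and the vertex lies on both facets with index `W`. -/
lemma IsFlip.vert_eq (hn : 2 ≤ n) (h : IsFlip n y W) (hne : ∀ j, j ≠ W → (j ∈ y' ↔ j ∈ y))
    {b : ℕ → ℤ} {k : ℤ} (hb : ∀ j, n ≤ j → b j = k) : vert n b y' = vert n b y := by
  obtain ⟨i, h1, hi, h⟩ := h
  obtain ⟨r, hr⟩ := h.exists_pre
  have hW := h.lt
  have hS : ∀ l, 1 ≤ l → l ∉ y → psum (vert n b y) l = psum (vert n b y) (l - 1) := fun l hl hly => by
    rw [psum_eq_add hl, vert_notMem hly, add_zero]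
  have hsol := h.solution hn (S := psum (vert n b y)) (k := k)
    (fun l hl hnl hly => by rw [psum_vert hn (by omega) hly, hb l hnl])
    (fun l hl hly => hS l (by omega) hly) (by
      rw [psum_vert hn (by omega) hr.top_mem, hb _ (by omega), hS i h1 hi]
      congr 2
      omega)
  symm
  refine eq_vert hn vert_zero (fun l hl hly => ?_) fun l hl hly => ?_
  · by_cases hlW : l = W
    · rw [hlW, hsol.2, hb _ (by omega)]
    · exact psum_vert hn hl ((hne l hlW).1 hly)
  · by_cases hlW : l = W
    · have := psum_eq_add (x := vert n b y) hl
      rw [hlW] at this ⊢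
      linarith [hsol.1]
    · exact vert_notMem fun h3 => hly ((hne l hlW).2 h3)

lemma IsFlip.partialF_neg (hn : 2 ≤ n) (h : IsFlip n y W) (hne : ∀ j, j ≠ W → (j ∈ y' ↔ j ∈ y))
    (hW' : W ∈ y' ↔ W ∉ y) {N : ℕ} (hWN : W ≤ N) (hy : y ⊆ Finset.Icc 1 N) :
    partialF n y' N = -partialF n y N := by
  have hW := h.lt
  obtain ⟨i, h1, hi, h⟩ := h
  have hiW := h.lt
  have hi' : i ∉ y' := by rwa [hne _ (by omega)]
  have hy' : y' ⊆ Finset.Icc 1 N := fun j hj => by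
    by_cases hjW : j = W
    · rw [Finset.mem_Icc]
      omega
    · exact hy ((hne j hjW).1 hj)
  have hE := h.etaExchange hn hne hW'
  have hlt := fun j h1 h2 => h.eta_of_lt (j := j) hn hi hne h1 h2
  have hcard : ((-1) ^ y'.card : CharRing n) = -(-1) ^ y.card := by
    by_cases hWy : W ∈ y
    · have : y = insert W y' := by
        ext j
        by_cases hjW : j = W
        · simp [hjW, hWy]
        · simp [hjW, hne j hjW]
      rw [this, Finset.card_insert_of_notMem fun h3 => hW'.1 h3 hWy]
      ring
    · have : y' = insert W y := by
        ext j
        by_cases hjW : j = W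
        · simp [hjW, hW'.2 hWy]
        · simp [hjW, hne j hjW]
      rw [this, Finset.card_insert_of_notMem hWy]
      ring
  have hsplit : ∀ z : Finset ℕ, i ∉ z → ∑ j ∈ z, eta n z j =
      ∑ j ∈ z with j < i, eta n z j + ∑ j ∈ z with i < j, eta n z j := fun z hz => by
    rw [← Finset.sum_filter_add_sum_filter_not z (· < i)]
    congr 1
    refine Finset.sum_congr (Finset.filter_congr fun j hj => ?_) fun _ _ => rfl
    have : j ≠ i := fun h3 => hz (h3 ▸ hj)
    omega
  have hsum : ∑ j ∈ y', eta n y' j = ∑ j ∈ y, eta n y j := by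
    rw [hsplit y' hi', hsplit y hi, hE.sum]
    congr 1
    refine Finset.sum_congr (Finset.ext fun j => ?_) fun j hj => ?_
    · simp only [Finset.mem_filter]
      exact and_congr_left fun h3 => hne j (by omega)
    · rw [Finset.mem_filter] at hj
      exact hlt j (Finset.mem_Icc.1 (hy hj.1)).1 hj.2
  have hprod : ∏ j ∈ Finset.Icc 1 N, geom (eta n y' j) = ∏ j ∈ Finset.Icc 1 N, geom (eta n y j) := by
    rw [show Finset.Icc 1 N = Finset.Ico 1 (N + 1) from rfl,
      ← Finset.prod_Ico_consecutive _ h1 (show i ≤ N + 1 by omega),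
      ← Finset.prod_Ico_consecutive _ h1 (show i ≤ N + 1 by omega), hE.prod geom _ (by omega)]
    congr 1
    refine Finset.prod_congr rfl fun j hj => ?_
    rw [Finset.mem_Ico] at hj
    rw [hlt j hj.1 hj.2]
  rw [partialF_eq N hn hy', partialF_eq N hn hy, hcard, hsum, hprod]
  ring

/-- The contributions of the bad sequences cancel in pairs. -/
theorem sum_bad_eq_zero (hn : 2 ≤ n) {b : ℕ → ℤ} {k : ℤ} (hb : ∀ j, n ≤ j → b j = k)
    (hv : ∀ y, 0 ≤ starWeight n (vert n b y)) {m : Fin n → ℤ} {M : ℕ}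
    (hM : ∀ i, M < i → ¬ gamma n i ≤ m) {s : Finset (Finset ℕ)}
    (hs : ∀ y, y ∈ s ↔ y ⊆ Finset.Icc 1 M ∧ y ∉ goodSeqs n) :
    ∑ y ∈ s, (expo (starWeight n (vert n b y)) * charF n y).coeff m = 0 := by
  classical
  have hneg : ∀ {y y' : Finset ℕ} {W : ℕ}, y ⊆ Finset.Icc 1 M → IsFlip n y W →
      (∀ j, j ≠ W → (j ∈ y' ↔ j ∈ y)) → (W ∈ y' ↔ W ∉ y) →
      (expo (starWeight n (vert n b y')) * charF n y').coeff m =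
        -(expo (starWeight n (vert n b y)) * charF n y).coeff m := by
    intro y y' W hy h hne hW
    have hy1 : ∀ j, max M W < j → j ∉ y := fun j hj h3 => by
      have := Finset.mem_Icc.1 (hy h3); omega
    have hM' : ∀ i, max M W < i → ¬ gamma n i ≤ m := fun i hi => hM i (by omega)
    rw [expo_mul_charF_coeff hn (M := max M W) hy1 hM' (hv y),
      expo_mul_charF_coeff hn (M := max M W) (fun j hj => by
        rw [hne j (by omega)]
        exact hy1 j hj) hM' (hv y'), h.vert_eq hn hne hb,
      h.partialF_neg hn hne hW (le_max_right M W)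
        (hy.trans (Finset.Icc_subset_Icc_right (le_max_left M W))),
      show ∀ f g : CharRing n, f * -g = -(f * g) from fun f g => by ring, HahnSeries.coeff_neg]
  have hex : ∀ y ∈ s, ∃ W, IsFlip n y W := fun y hy =>
    exists_isFlip hn (fun h0 => by have := Finset.mem_Icc.1 (((hs y).1 hy).1 h0); omega)
      ((hs y).1 hy).2
  choose! w hw using hex
  let g : Finset ℕ → Finset ℕ := fun y => symmDiff y {w y}
  have hg1 : ∀ y j, j ≠ w y → (j ∈ g y ↔ j ∈ y) := fun y j hj => by
    simp [g, Finset.mem_symmDiff, hj]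
  have hg2 : ∀ y, w y ∈ g y ↔ w y ∉ y := fun y => by
    simp [g, Finset.mem_symmDiff]
  -- The change can lead out of the subsets of `[1, M]` if `W > M`, but then the new term vanishes,
  -- and with it the old one. Restricting to nonzero terms makes the index set stable.
  rw [← Finset.sum_filter_ne_zero]
  have hmem : ∀ y ∈ s, (expo (starWeight n (vert n b y)) * charF n y).coeff m ≠ 0 → g y ∈ s ∧
      (expo (starWeight n (vert n b (g y))) * charF n (g y)).coeff m ≠ 0 := by
    intro y hy h0
    have h1 := hneg ((hs y).1 hy).1 (hw y hy) (hg1 y) (hg2 y)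
    have h2 : (expo (starWeight n (vert n b (g y))) * charF n (g y)).coeff m ≠ 0 := by
      rw [h1]
      exact neg_ne_zero.2 h0
    have h3 : IsFlip n (g y) (w y) := (hw y hy).exchange hn (hg1 y)
    refine ⟨(hs _).2 ⟨fun j hj => ?_, h3.notMem_goodSeqs hn⟩, h2⟩
    by_cases hjw : j = w y
    · have hwn := (hw y hy).lt
      rw [Finset.mem_Icc]
      refine ⟨by omega, ?_⟩
      by_contra h4
      exact h2 (expo_mul_charF_coeff_eq_zero hn (by omega) hj (hM j (by omega)) (hv _))
    · exact ((hs y).1 hy).1 ((hg1 y j hjw).1 hj)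
  refine Finset.sum_involution (fun y _ => g y) (fun y hy => ?_) (fun y hy _ => ?_)
    (fun y hy => ?_) fun y hy => ?_
  · rw [Finset.mem_filter] at hy
    rw [hneg ((hs y).1 hy.1).1 (hw y hy.1) (hg1 y) (hg2 y), add_neg_cancel]
  · intro h
    have := hg2 y
    rw [h] at this
    tauto
  · rw [Finset.mem_filter] at hy ⊢
    exact hmem y hy.1 hy.2
  · rw [Finset.mem_filter] at hy
    have h1 := hmem y hy.1 hy.2
    have h2 : w (g y) = w y := (hw _ h1.1).unique ((hw y hy.1).exchange hn (hg1 y))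
    simp only [g] at h2 ⊢
    rw [h2, symmDiff_symmDiff_cancel_right]

end flip

/-! ### The action of the Weyl group -/

section weyl

variable {n : ℕ} {y : Finset ℕ}

/-- The form is the standard one on cyclic differences, and those of `γ_i` are a difference of two
unit vectors (`gamma_diff`). -/
lemma form_eq [NeZero n] (m m' : Fin n → ℤ) :
    form m m' = ∑ i, (m i - m (i + 1)) * (m' i - m' (i + 1)) := by
  have h : ∑ i, m (i + 1) * m' (i + 1) = ∑ i, m i * m' i :=
    Equiv.sum_comp (Equiv.addRight (1 : Fin n)) fun i => m i * m' i
  have h1 : ∑ i, (m i - m (i + 1)) * (m' i - m' (i + 1)) =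
      form m m' + (∑ i, m (i + 1) * m' (i + 1) - ∑ i, m i * m' i) := by
    rw [form, ← Finset.sum_sub_distrib, ← Finset.sum_add_distrib]
    exact Finset.sum_congr rfl fun i _ => by ring
  rw [h1, h, sub_self, add_zero]

lemma form_sum [NeZero n] {ι : Type*} (s : Finset ι) (f : ι → Fin n → ℤ) (m : Fin n → ℤ) :
    form (∑ j ∈ s, f j) m = ∑ j ∈ s, form (f j) m := by
  simp only [form]
  rw [Finset.sum_comm]
  refine Finset.sum_congr rfl fun i _ => ?_
  simp only [Finset.sum_apply, Finset.mul_sum, Finset.sum_mul, Finset.sum_sub_distrib]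

lemma form_smul [NeZero n] (c : ℤ) (m m' : Fin n → ℤ) : form (c • m) m' = c * form m m' := by
  simp only [form, Finset.mul_sum, Pi.smul_apply, smul_eq_mul]
  exact Finset.sum_congr rfl fun i _ => by ring

lemma gamma_diff [NeZero n] (hn : 2 ≤ n) (i : ℕ) (l : Fin n) :
    gamma n i l - gamma n i (l + 1) =
      (if (l : ℕ) = (i - 1) % (n - 1) + 1 then 1 else 0) - if (l : ℕ) = 0 then 1 else 0 := by
  have hr : (i - 1) % (n - 1) < n - 1 := Nat.mod_lt _ (by omega)
  have hl := l.2
  have hv : ((l + 1 : Fin n) : ℕ) = if (l : ℕ) + 1 = n then 0 else (l : ℕ) + 1 := by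
    rw [Fin.val_add, Fin.val_one', Nat.mod_eq_of_lt (show 1 < n by omega)]
    split_ifs with h
    · rw [h, Nat.mod_self]
    · exact Nat.mod_eq_of_lt (by omega)
  simp only [gamma, hv]
  split_ifs <;> omega

lemma form_gamma [NeZero n] (hn : 2 ≤ n) (i j : ℕ) : form (gamma n i) (gamma n j) =
    1 + if (i - 1) % (n - 1) = (j - 1) % (n - 1) then 1 else 0 := by
  have hi : (i - 1) % (n - 1) < n - 1 := Nat.mod_lt _ (by omega)
  have hj : (j - 1) % (n - 1) < n - 1 := Nat.mod_lt _ (by omega)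
  rw [form_eq]
  simp only [gamma_diff hn]
  generalize (i - 1) % (n - 1) = r at *
  generalize (j - 1) % (n - 1) = s at *
  have h1 : ∀ l : Fin n, ((if (l : ℕ) = r + 1 then (1 : ℤ) else 0) - if (l : ℕ) = 0 then 1 else 0) *
      ((if (l : ℕ) = s + 1 then (1 : ℤ) else 0) - if (l : ℕ) = 0 then 1 else 0) =
      (if l = ⟨0, by omega⟩ then 1 else 0) +
        if l = ⟨r + 1, by omega⟩ then (if r = s then 1 else 0) else 0 := fun l => by
    simp only [Fin.ext_iff]
    split_ifs <;> omega
  rw [Finset.sum_congr rfl fun l _ => h1 l, Finset.sum_add_distrib, Finset.sum_ite_eq',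
    Finset.sum_ite_eq']
  simp

/-- The value of `⟨λ, γ_i⟩` for `1 ≤ i ≤ n - 1`. -/
lemma sum_label_mul_gamma [NeZero n] (hn : 2 ≤ n) (a : Fin n → ℕ) {i : ℕ} (h1 : 1 ≤ i)
    (hi : i ≤ n - 1) : ∑ l, (a l : ℤ) * gamma n i l = bnd a i := by
  have hg : ∀ l : Fin n, gamma n i l = if 1 ≤ (l : ℕ) ∧ (l : ℕ) ≤ i then 1 else 0 := fun l => by
    rw [gamma, Nat.div_eq_of_lt (by omega), Nat.mod_eq_of_lt (by omega), Nat.sub_add_cancel h1]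
    simp
  have hlab : ∀ l : Fin n, a l = label a l := fun l => by
    rw [label]
    congr 1
    ext
    simp [Fin.ofNat, Nat.mod_eq_of_lt l.2]
  have h2 : ∀ l : Fin n, (a l : ℤ) * gamma n i l =
      (fun t : ℕ => if 1 ≤ t ∧ t ≤ i then (label a t : ℤ) else 0) l := fun l => by
    rw [hg, hlab]
    simp
  rw [Finset.sum_congr rfl fun l _ => h2 l, Fin.sum_univ_eq_sum_range
    (fun t : ℕ => if 1 ≤ t ∧ t ≤ i then (label a t : ℤ) else 0), ← Finset.sum_filter, bnd,
    bound_of_le (by omega), Nat.cast_sum]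
  refine Finset.sum_congr (Finset.ext fun t => ?_) fun _ _ => rfl
  simp only [Finset.mem_filter, Finset.mem_range, Finset.mem_Icc]
  omega

/-- The reflections in the definition of `w_y` give the coordinates of the vertex. -/
lemma vert_eq_pairing [NeZero n] (hn : 2 ≤ n) (a : Fin n → ℕ) (hy : y ∈ goodSeqs n) {i : ℕ}
    (hi : 1 ≤ i) (hiy : i ∈ y) :
    vert n (bnd a) y i = ∑ l, (a l : ℤ) * gamma n i l -
      form (∑ j ∈ Finset.Ico 1 i, vert n (bnd a) y j • gamma n j) (gamma n i) := by
  set x := vert n (bnd a) y with hx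
  set ρ : ℕ → ℕ := fun j => (j - 1) % (n - 1) with hρ
  set T : ℕ → ℤ := fun i => ∑ j ∈ Finset.Ico 1 i, if ρ j = ρ i then x j else 0 with hT
  have hform : ∀ i, 1 ≤ i → form (∑ j ∈ Finset.Ico 1 i, x j • gamma n j) (gamma n i) =
      psum x (i - 1) + T i := fun i hi => by
    rw [form_sum, psum, hT, show Finset.Icc 1 (i - 1) = Finset.Ico 1 i by ext; simp; omega,
      ← Finset.sum_add_distrib]
    refine Finset.sum_congr rfl fun j _ => ?_
    rw [form_smul, form_gamma hn]
    simp only [hρ]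
    split_ifs <;> ring
  -- By `form_gamma` the pairing with earlier terms is an ordinary partial sum plus `T i`, the part
  -- in the residue class of `i` modulo `n - 1`. The induction descends by `n - 1`, and goodness of
  -- `y` keeps the smaller index in `y`.
  have key : ∀ i, 1 ≤ i → i ∈ y →
      bnd a i + psum x (i - n) = ∑ l, (a l : ℤ) * gamma n i l - T i := by
    intro i
    induction i using Nat.strong_induction_on with
    | _ i ih =>
      intro h1 hiy
      by_cases hin : i ≤ n - 1
      · have hT0 : T i = 0 := Finset.sum_eq_zero fun j hj => by
          rw [Finset.mem_Ico] at hj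
          refine if_neg fun h => ?_
          simp only [hρ] at h
          rw [Nat.mod_eq_of_lt (by omega), Nat.mod_eq_of_lt (by omega)] at h
          omega
        rw [sum_label_mul_gamma hn a h1 hin, hT0, show i - n = 0 by omega, psum_zero]
        ring
      · obtain ⟨j, rfl⟩ : ∃ j, i = j + (n - 1) := ⟨i - (n - 1), by omega⟩
        have hj : 1 ≤ j := by omega
        have hjy : j ∈ y := by
          by_contra h
          refine hy.2 j hj h ?_
          rwa [show j + n - 1 = j + (n - 1) by omega]
        have hk := ih j (by omega) hj hjy
        have hρj : ρ (j + (n - 1)) = ρ j := by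
          simp only [hρ]
          rw [show j + (n - 1) - 1 = j - 1 + (n - 1) by omega, Nat.add_mod_right]
        have hTj : T (j + (n - 1)) = T j + x j := by
          simp only [hT, hρj]
          rw [← Finset.sum_Ico_consecutive _ hj (show j ≤ j + (n - 1) by omega)]
          congr 1
          rw [Finset.sum_eq_single j]
          · rw [if_pos rfl]
          · intro l hl hlj
            rw [Finset.mem_Ico] at hl
            refine if_neg fun h => ?_
            simp only [hρ] at h
            have := (Nat.modEq_iff_dvd' (show j - 1 ≤ l - 1 by omega)).1 (Eq.symm h)
            have := Nat.le_of_dvd (by omega) this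
            omega
          · intro h
            exact absurd (Finset.mem_Ico.2 ⟨le_rfl, by omega⟩) h
        have hG : ∑ l, (a l : ℤ) * gamma n (j + (n - 1)) l =
            ∑ l, (a l : ℤ) * gamma n j l + bnd a (j + (n - 1)) := by
          rw [gamma_add hn hj, bnd, bound_of_ge (by omega), Nat.cast_sum,
            ← Finset.sum_add_distrib]
          refine Finset.sum_congr rfl fun l _ => ?_
          rw [Pi.add_apply, Pi.one_apply]
          ring
        have hS := psum_vert (b := bnd a) hn hj hjy
        rw [← hx, psum_eq_add hj] at hS
        rw [hG, hTj, show j + (n - 1) - n = j - 1 by omega]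
        linarith
  have hS := psum_vert (b := bnd a) hn hi hiy
  rw [← hx, psum_eq_add hi] at hS
  rw [hform i hi]
  linarith [key i hi hiy]

lemma weylShift_eq [NeZero n] (hn : 2 ≤ n) (a : Fin n → ℕ) (hy : y ∈ goodSeqs n) :
    weylShift a y = starWeight n (vert n (bnd a) y) := by
  set x := vert n (bnd a) y with hx
  have hpos : ∀ j ∈ y, 1 ≤ j := fun j hj => by
    by_contra h
    exact hy.1 (by rwa [show (0 : ℕ) = j by omega])
  -- After an initial segment of reflections the shift is the corresponding part of the weight of
  -- the vertex. The next reflection adds `x_i γ_i`, by `vert_eq_pairing`.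
  have key : ∀ l : List ℕ, l <+: y.sort (· ≤ ·) →
      l.foldl (fun m i => reflect a (gamma n i) m) 0 = ∑ j ∈ l.toFinset, x j • gamma n j := by
    intro l
    induction l using List.reverseRecOn with
    | nil => intro _; simp
    | append_singleton l i ih =>
      intro hl
      have hl' : l <+: y.sort (· ≤ ·) := (List.prefix_append l [i]).trans hl
      obtain ⟨t, ht⟩ := hl
      have hsort : (l ++ [i] ++ t).Pairwise (· < ·) := by
        rw [ht]
        exact (Finset.sortedLT_sort y).pairwise
      rw [List.append_assoc, List.pairwise_append] at hsort
      have hmem : ∀ j, j ∈ y ↔ j ∈ l ∨ j = i ∨ j ∈ t := fun j => by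
        rw [← Finset.mem_sort (· ≤ ·), ← ht]
        simp
      have hlt : ∀ j ∈ l, j < i := fun j hj => hsort.2.2 j hj i (by simp)
      have hgt : ∀ j ∈ t, i < j := fun j hj => by
        have := (List.pairwise_cons.1 hsort.2.1).1
        exact this j hj
      have hiy : i ∈ y := (hmem i).2 (by simp)
      have hil : i ∉ l.toFinset := fun h => lt_irrefl _ (hlt i (List.mem_toFinset.1 h))
      have hsum : ∑ j ∈ l.toFinset, x j • gamma n j = ∑ j ∈ Finset.Ico 1 i, x j • gamma n j := by
        refine Finset.sum_subset (fun j hj => ?_) fun j hj hjl => ?_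
        · rw [List.mem_toFinset] at hj
          exact Finset.mem_Ico.2 ⟨hpos j ((hmem j).2 (Or.inl hj)), hlt j hj⟩
        · rw [Finset.mem_Ico] at hj
          rw [hx, vert_notMem, zero_smul]
          intro hjy
          rcases (hmem j).1 hjy with h | h | h
          · exact hjl (List.mem_toFinset.2 h)
          · omega
          · have := hgt j h
            omega
      rw [List.foldl_append, ih hl', List.foldl_cons, List.foldl_nil, List.toFinset_append,
        List.toFinset_cons, List.toFinset_nil, insert_empty_eq, Finset.union_comm,
        ← Finset.insert_eq, Finset.sum_insert hil, reflect, hsum,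
        vert_eq_pairing hn a hy (hpos i hiy) hiy, ← hx]
      ring
  have := key _ (List.prefix_refl _)
  rw [Finset.sort_toFinset] at this
  rw [weylShift, this, starWeight, Finsupp.sum_of_support_subset (s := y)]
  · intro j hj
    by_contra h
    exact Finsupp.mem_support_iff.1 hj (vert_notMem h)
  · intro i _
    exact zero_smul _ _

end weyl

/-! ### The character formula -/

section character

variable {n : ℕ} [NeZero n] {a : Fin n → ℕ} {M : ℕ} {m : Fin n → ℤ}

/-- The integral points of the polytope with vanishing coordinates at the indices `j > M`. -/
def points (a : Fin n → ℕ) (M : ℕ) : Set (ℕ →₀ ℤ) :=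
  region n Set.univ (bnd a) M M ∅

lemma mem_points {z : ℕ →₀ ℤ} : z ∈ points a M ↔
    toReal z ∈ polytope a ∧ ∀ j, M < j → z j = 0 := by
  have hcast : toReal z ∈ polytope a ↔ z 0 = 0 ∧ (∀ i, 0 ≤ z i) ∧
      ∀ i, 1 ≤ i → psum z i ≤ bnd a i + psum z (i - n) := by
    rw [mem_polytope]
    refine and_congr (by rw [toReal_apply, Int.cast_eq_zero]) (and_congr ?_ ?_)
    · exact forall_congr' fun i => by rw [toReal_apply, Int.cast_nonneg_iff]
    · refine forall_congr' fun i => imp_congr_right fun _ => ?_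
      rw [psum_toReal, psum_toReal, bnd]
      exact_mod_cast Iff.rfl
  rw [hcast]
  constructor
  · rintro ⟨h0, h1, h2, -⟩
    have hnn : ∀ i, 0 ≤ z i := fun i => by
      rcases Nat.eq_zero_or_pos i with rfl | hi
      · exact h0.ge
      · by_cases hiM : i ≤ M
        · exact (h2 i hi hiM).2 (Set.mem_univ _)
        · exact (h1 i (by omega)).ge
    have hc : ∀ i, 1 ≤ i → i ≤ M → psum z i ≤ bnd a i + psum z (i - n) := fun i hi hiM =>
      (h2 i hi hiM).1 (Set.mem_univ _)
    refine ⟨⟨h0, hnn, fun i hi => ?_⟩, h1⟩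
    -- Only the constraints up to `M` are imposed; later ones follow, because the partial sums are
    -- stationary while `b_i` and `psum z (i - n)` do not decrease.
    induction i, hi using Nat.le_induction with
    | base =>
      by_cases hM : 1 ≤ M
      · exact hc 1 le_rfl hM
      · rw [psum_eq_add le_rfl, h1 1 (by omega)]
        have hn1 := Nat.pos_of_ne_zero (NeZero.ne n)
        rw [show 1 - 1 = 0 from rfl, show 1 - n = 0 by omega, psum_zero, bnd]
        positivity
    | succ i hi ih =>
      by_cases hM : i + 1 ≤ M
      · exact hc _ (by omega) hM
      · rw [psum_succ, h1 (i + 1) (by omega), add_zero]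
        have h3 : bnd a i ≤ bnd a (i + 1) := Int.ofNat_le.2 (bound_le_succ i)
        have h4 : psum z (i - n) ≤ psum z (i + 1 - n) := Finset.sum_le_sum_of_subset_of_nonneg
          (Finset.Icc_subset_Icc_right (by omega)) fun j _ _ => hnn j
        linarith
  · rintro ⟨⟨h0, h1, h2⟩, h3⟩
    exact ⟨h0, h3, fun j hj _ => ⟨fun _ => h2 j hj, fun _ => h1 j⟩, fun j h4 h5 => by omega⟩

lemma nonneg_of_mem_points {z : ℕ →₀ ℤ} (hz : z ∈ points a M) (i : ℕ) : 0 ≤ z i := by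
  have := (mem_points.1 hz).1.2.1 i
  rwa [toReal_apply, Int.cast_nonneg_iff] at this

lemma finite_points : (points a M).Finite := by
  refine (Set.finite_Icc 0 (Finsupp.indicator (Finset.Icc 1 M) fun j _ => bnd a j)).subset
    fun z hz => ⟨fun i => nonneg_of_mem_points hz i, fun i => ?_⟩
  obtain ⟨h0, h1, h2, -⟩ := id hz
  by_cases hi : i ∈ Finset.Icc 1 M
  · rw [Finsupp.indicator_of_mem hi]
    rw [Finset.mem_Icc] at hi
    have h3 := (h2 i hi.1 hi.2).1 (Set.mem_univ _)
    have hn1 := Nat.pos_of_ne_zero (NeZero.ne n)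
    have h4 : psum z (i - n) ≤ psum z (i - 1) := Finset.sum_le_sum_of_subset_of_nonneg
      (Finset.Icc_subset_Icc_right (by omega)) fun j _ _ => nonneg_of_mem_points hz j
    rw [psum_eq_add hi.1] at h3
    linarith
  · rw [Finsupp.indicator_of_notMem hi]
    rw [Finset.mem_Icc] at hi
    by_cases hi0 : i = 0
    · rw [hi0, h0]
    · rw [h1 i (by omega)]

lemma starWeight_vert_nonneg (hn : 2 ≤ n) (y : Finset ℕ) :
    0 ≤ starWeight n (vert n (bnd a) y) :=
  starWeight_nonneg n fun i => (vert_constraints hn y i).1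

/-- The same finite generating function is evaluated as a Laurent polynomial and by `isSig_region`
with all facets allowed, so that every subset of `[1, M]` is a selection. -/
lemma sum_expStar_points (hn : 2 ≤ n) : ∑ z ∈ (finite_points (a := a) (M := M)).toFinset, expStar n z =
    ∑ y ∈ (Finset.Icc 1 M).powerset,
      expo (starWeight n (vert n (bnd a) y)) * partialF n y M := by
  classical
  have h1 : IsSig n (indFun (points a M)) (vertexSum n Set.univ (bnd a) M ∅) := by
    refine isSig_region hn (fun i _ => Or.inl (Set.mem_univ _)) (fun i _ _ _ z hz => ?_) le_rfl
      (by simp)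
    have h3 : bnd a i ≤ bnd a (i + 1) := Int.ofNat_le.2 (bound_le_succ i)
    have h4 : psum z (i - n) ≤ psum z (i + 1 - n) := Finset.sum_le_sum_of_subset_of_nonneg
      (Finset.Icc_subset_Icc_right (by omega)) fun j hj _ => by
        rw [Finset.mem_Icc] at hj
        exact (hz j hj.1 (by omega)).2 (Set.mem_univ _)
    rcases Nat.eq_zero_or_pos i with rfl | hi
    · rw [psum_zero, show 0 + 1 - n = 0 by omega, psum_zero, bnd]
      positivity
    · have := (hz i hi le_rfl).1 (Set.mem_univ _)
      linarith
  set p : LaurentPoly := ∑ z ∈ (finite_points (a := a) (M := M)).toFinset,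
    AddMonoidAlgebra.single z 1 with hp
  have h2 : indFun (points a M) = p.coeff := by
    funext z
    rw [indFun_apply, hp, AddMonoidAlgebra.coeff_sum, Finsupp.finsetSum_apply]
    simp only [AddMonoidAlgebra.coeff_single, Finsupp.single_apply, Finset.sum_ite_eq',
      Set.Finite.mem_toFinset]
  have h3 : substStar n p = ∑ z ∈ (finite_points (a := a) (M := M)).toFinset, expStar n z := by
    rw [substStar_eq, hp, map_sum]
    exact Finset.sum_congr rfl fun z _ => by rw [← substStar_eq, substStar_single]
  rw [h2] at h1
  rw [← h3, (isSig_coeff p).unique h1, vertexSum]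
  refine Finset.sum_congr rfl fun y _ => ?_
  rw [Finset.union_empty, expStar, partialF]
  congr 1
  refine Finset.prod_congr rfl fun j _ => ?_
  rw [selInd]
  simp

lemma card_points (hn : 2 ≤ n) (hM : ∀ i, M < i → ¬ gamma n i ≤ m) :
    ((finite_points (a := a) (M := M)).toFinset.filter fun z => starWeight n z = m).card =
      ∑ y ∈ (Finset.Icc 1 M).powerset,
        (expo (starWeight n (vert n (bnd a) y)) * charF n y).coeff m := by
  have h1 := congrArg (fun f => HahnSeries.coeff f m) (sum_expStar_points (a := a) (M := M) hn)
  simp only [HahnSeries.coeff_sum] at h1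
  rw [Finset.card_filter, Nat.cast_sum]
  refine Eq.trans ?_ (h1.trans ?_)
  · refine Finset.sum_congr rfl fun z _ => ?_
    rw [expStar, expo, HahnSeries.coeff_single, Nat.cast_ite, Nat.cast_one, Nat.cast_zero]
    by_cases h : starWeight n z = m
    · rw [if_pos h, if_pos h.symm]
    · rw [if_neg h, if_neg (Ne.symm h)]
  · refine Finset.sum_congr rfl fun y hy => ?_
    rw [expo_mul_charF_coeff hn (fun j hj hjy => ?_) hM (starWeight_vert_nonneg hn y)]
    have := Finset.mem_Icc.1 (Finset.mem_powerset.1 hy hjy)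
    omega

/-! ### Weight spaces of `S` and lattice points -/

/-- The exponents of the monomials in `S` of weight `m`. -/
def exponents (a : Fin n → ℕ) (m : Fin n → ℤ) : Set (ℕ →₀ ℕ) :=
  {x | x.mapRange (fun c : ℕ => (c : ℝ)) Nat.cast_zero ∈ polytope a ∧
    Finsupp.weight (gamma n) x = m}

lemma weightSpace_eq (a : Fin n → ℕ) (m : Fin n → ℤ) :
    weightSpace a m = MvPolynomial.restrictSupport ℂ (exponents a m) := by
  have h1 : monomialSpan a = MvPolynomial.restrictSupport ℂ
      {x : ℕ →₀ ℕ | x.mapRange (fun c : ℕ => (c : ℝ)) Nat.cast_zero ∈ polytope a} := by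
    rw [monomialSpan, MvPolynomial.restrictSupport_eq_span]
    congr 1
    ext p
    simp only [Set.mem_image, Set.mem_ofPred_eq, eq_comm]
  ext p
  rw [weightSpace, h1, Submodule.mem_inf, MvPolynomial.mem_weightedHomogeneousSubmodule,
    MvPolynomial.mem_restrictSupport_iff, MvPolynomial.mem_restrictSupport_iff]
  constructor
  · rintro ⟨h2, h3⟩ x hx
    exact ⟨h2 hx, h3 (MvPolynomial.mem_support_iff.1 hx)⟩
  · intro h
    exact ⟨fun x hx => (h hx).1, fun x hx => (h (MvPolynomial.mem_support_iff.2 hx)).2⟩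

/-- A natural sequence as an integral one. -/
def ofNat (x : ℕ →₀ ℕ) : ℕ →₀ ℤ := x.mapRange (fun c : ℕ => (c : ℤ)) Nat.cast_zero

lemma ofNat_injective : Function.Injective ofNat :=
  Finsupp.mapRange_injective _ Nat.cast_zero Nat.cast_injective

lemma toReal_ofNat (x : ℕ →₀ ℕ) :
    toReal (ofNat x) = x.mapRange (fun c : ℕ => (c : ℝ)) Nat.cast_zero := by
  ext i
  simp [toReal, ofNat]

lemma starWeight_ofNat {n : ℕ} (x : ℕ →₀ ℕ) : starWeight n (ofNat x) = Finsupp.weight (gamma n) x := by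
  rw [Finsupp.weight_apply, starWeight, ofNat, Finsupp.sum_mapRange_index (by simp)]
  exact Finsupp.sum_congr fun i _ => natCast_zsmul _ _

/-- A monomial of weight `m` cannot contain `X_j` with `j > M`, as its weight would then be at least
`γ_j`; truncation at `M` therefore loses nothing. -/
lemma image_exponents (hM : ∀ i, M < i → ¬ gamma n i ≤ m) :
    ofNat '' exponents a m =
      (finite_points (a := a) (M := M)).toFinset.filter fun z => starWeight n z = m := by
  ext z
  simp only [Finset.coe_filter, Set.Finite.mem_toFinset, Set.mem_ofPred_eq, Set.mem_image]
  constructor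
  · rintro ⟨x, ⟨h1, h2⟩, rfl⟩
    rw [← toReal_ofNat] at h1
    rw [← starWeight_ofNat] at h2
    refine ⟨mem_points.2 ⟨h1, fun j hj => ?_⟩, h2⟩
    by_contra h3
    refine hM j hj (h2 ▸ gamma_le_starWeight n (fun i => ?_) h3)
    exact Int.natCast_nonneg _
  · rintro ⟨h1, h2⟩
    have hz : ofNat (z.mapRange Int.toNat Int.toNat_zero) = z := by
      ext i
      simp [ofNat, nonneg_of_mem_points h1 i]
    refine ⟨z.mapRange Int.toNat Int.toNat_zero, ⟨?_, ?_⟩, hz⟩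
    · rw [← toReal_ofNat, hz]
      exact (mem_points.1 h1).1
    · rw [← starWeight_ofNat, hz, h2]

theorem character_formula (hn : 2 ≤ n) (a : Fin n → ℕ) (m : Fin n → ℤ) :
    FiniteDimensional ℂ (weightSpace a m) ∧
      {y ∈ goodSeqs n | (expo (weylShift a y) * charF n y).coeff m ≠ 0}.Finite ∧
      (Module.finrank ℂ (weightSpace a m) : ℂ) =
        ∑ᶠ y ∈ goodSeqs n, (expo (weylShift a y) * charF n y).coeff m := by
  classical
  obtain ⟨M, hM⟩ := exists_not_gamma_le hn m
  have himg := image_exponents (a := a) hM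
  have hfin : (exponents a m).Finite := by
    refine Set.Finite.of_finite_image ?_ (ofNat_injective.injOn)
    rw [himg]
    exact Finset.finite_toSet _
  have hsub : ∀ y ∈ goodSeqs n, (expo (weylShift a y) * charF n y).coeff m ≠ 0 →
      y ⊆ Finset.Icc 1 M := fun y hy h j hj => by
    have h1 : 1 ≤ j := by
      by_contra h0
      exact hy.1 (by rwa [show (0 : ℕ) = j by omega])
    refine Finset.mem_Icc.2 ⟨h1, ?_⟩
    by_contra h2
    rw [weylShift_eq hn a hy] at h
    exact h (expo_mul_charF_coeff_eq_zero hn h1 hj (hM j (by omega)) (starWeight_vert_nonneg hn y))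
  have := hfin.to_subtype
  refine ⟨?_, (Finset.finite_toSet (Finset.Icc 1 M).powerset).subset fun y hy =>
    Finset.mem_coe.2 (Finset.mem_powerset.2 (hsub y hy.1 hy.2)), ?_⟩
  · rw [weightSpace_eq]
    exact Module.Finite.of_basis (MvPolynomial.basisRestrictSupport ℂ (exponents a m))
  have hcard : Module.finrank ℂ (weightSpace a m) =
      ((finite_points (a := a) (M := M)).toFinset.filter fun z => starWeight n z = m).card := by
    rw [weightSpace_eq, Module.finrank_eq_nat_card_basis
      (MvPolynomial.basisRestrictSupport ℂ (exponents a m)), ← Set.ncard_coe_finset, ← himg,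
      Set.ncard_image_of_injective _ ofNat_injective]
    rfl
  have hbad := sum_bad_eq_zero hn (b := bnd a) (k := (∑ l, a l : ℕ))
    (fun j hj => by rw [bnd, bound_of_ge hj]) (starWeight_vert_nonneg hn) hM
    (s := {y ∈ (Finset.Icc 1 M).powerset | y ∉ goodSeqs n}) (fun y => by
      rw [Finset.mem_filter, Finset.mem_powerset])
  rw [hcard, card_points hn hM,
    ← Finset.sum_filter_add_sum_filter_not (Finset.Icc 1 M).powerset (· ∈ goodSeqs n), hbad, add_zero,
    finsum_mem_eq_sum_of_inter_support_eq (t := {y ∈ (Finset.Icc 1 M).powerset | y ∈ goodSeqs n})]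
  · refine Finset.sum_congr rfl fun y hy => ?_
    rw [weylShift_eq hn a (Finset.mem_filter.1 hy).2]
  · ext y
    simp only [Set.mem_inter_iff, Function.mem_support, Finset.coe_filter, Set.mem_ofPred_eq,
      Finset.mem_powerset]
    constructor
    · rintro ⟨h1, h2⟩
      exact ⟨⟨hsub y h1 h2, h1⟩, h2⟩
    · rintro ⟨⟨_, h1⟩, h2⟩
      exact ⟨h1, h2⟩

end character

end FSChar

end

theorem mainTheorem7 (n : ℕ) [NeZero n] (hn : 2 ≤ n) (a : Fin n → ℕ) :
    (a ≠ 0 →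
      -- vertices and vertex data correspond, and the characters `τ_ω` are well defined
      Set.BijOn (FSChar.facetSet a) (FSChar.vertices a) (FSChar.Omega n (FSChar.zeroSet a)) ∧
      (∀ u ∈ FSChar.vertices a, ∃ v : ℕ →₀ ℤ, FSChar.toReal v = u ∧
        FSChar.IsTauVertex a u
          (FSChar.expStar n v * FSChar.tau n (FSChar.zeroSet a) (FSChar.facetSet a u))) ∧
      -- the surjection `φ` from `Ω_∅` to `Ω_{A_λ}`, and the sum over its fibres
      ∃ φ : FSChar.Omega n ∅ → FSChar.Omega n (FSChar.zeroSet a),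
        (∀ ω' ω, φ ω' = ω ↔ (ω' : Set FSChar.Facet) ⊆ (ω : Set FSChar.Facet)) ∧
        Function.Surjective φ ∧
        ∀ ω, {ω' | φ ω' = ω}.Finite ∧
          FSChar.tau n (FSChar.zeroSet a) (ω : Set FSChar.Facet) =
            ∑ᶠ ω' ∈ {ω' | φ ω' = ω}, FSChar.tau n ∅ (ω' : Set FSChar.Facet)) ∧
    -- the character formula
    ∃ F : Finset ℕ → FSChar.CharRing n,
      (∀ y ∈ FSChar.goodSeqs n, FSChar.IsF n y (F y)) ∧
      ∀ m : Fin n → ℤ,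
        FiniteDimensional ℂ (FSChar.weightSpace a m) ∧
        {y ∈ FSChar.goodSeqs n |
          (FSChar.expo (FSChar.weylShift a y) * F y).coeff m ≠ 0}.Finite ∧
        (Module.finrank ℂ (FSChar.weightSpace a m) : ℂ) =
          ∑ᶠ y ∈ FSChar.goodSeqs n, (FSChar.expo (FSChar.weylShift a y) * F y).coeff m := by
  exact ⟨fun ha => ⟨FSChar.bijOn_facetSet hn ha, fun _ hu => FSChar.exists_isTauVertex hn ha hu,
    FSChar.exists_degeneration hn ha⟩, FSChar.charF n, fun y _ => FSChar.isF_charF hn y,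
    FSChar.character_formula hn a⟩
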